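/- For a real number $R>1$ and an integer $n\ge 0$ put $$\Lambda_R(n)=\sum_{\substack{1\le k<R\\ k\mid n}}\mu(k)\log\frac Rk,\qquad \nu(n)=\nu_R(n)=\frac{\Lambda_R(n)^2}{\log R},$$ where $\mu$ is the Möbius function (and every $k$ divides $0$). **Theorem (Siegel–Walfisz for $\nu$).** Let $\varepsilon,c_1,c_2>0$. There is a constant $C>0$ depending only on $\varepsilon,c_1,c_2$ such that the following holds for every $N\in\mathbb N$ and every real $R\ge 3$ of size $N^\varepsilon$, in the sense that $c_1N^\varepsilon\le R\le c_2N^\varepsilon$. (1) For every integer $q\ge 1$, every interval $I\subset[0,N]$ (open, closed or half-open) of length $|I|\ge qR^3$, and every $q$-periodic function $f:\mathbb Z_{\ge 0}\to\mathbb C$, $$\left|\frac1{|I|}\sum_{n\in I}f(n)\nu(n)-\frac{q}{\phi(q)|I|}\sum_{\substack{n\in I\\(n,q)=1}}f(n)\right|\le C\,\frac{\|f\|_\infty\log\log R}{\log R},$$ where the sums run over the integers in $I$, $\phi$ is Euler's totient function and $\|f\|_\infty=\max_{1\le r\le q}|f(r)|$. (2) In particular, if $R^3\le N$, then $$\left|\frac1N\sum_{1\le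 n\le N}\nu(n)-1\right|\le C\,\frac{\log\log R}{\log R}.$$ -/

import Mathlib

/-- The truncated von Mangoldt function of Goldston and Yildirim,
`Λ_R(n) = ∑_{1 ≤ k < R, k ∣ n} μ(k) log (R / k)`. (For a natural number `k`, one has
`k < ⌈R⌉₊` if and only if `k < R`. Every `k` divides `n = 0`.) -/
noncomputable def LambdaR (R : ℝ) (n : ℕ) : ℝ :=
  ∑ k ∈ (Finset.Ico 1 ⌈R⌉₊).filter (fun k => k ∣ n),
    (ArithmeticFunction.moebius k : ℝ) * Real.log (R / k)

/-- The pseudo random measure `ν(n) = Λ_R(n)² / log R`. -/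
noncomputable def nuR (R : ℝ) (n : ℕ) : ℝ :=
  LambdaR R n ^ 2 / Real.log R

open Classical in
/-- The natural numbers `n ≤ N` lying in a set `I` of reals; for `I ⊆ [0, N]` these are all the
integers in `I`. -/
noncomputable def natPoints (N : ℕ) (I : Set ℝ) : Finset ℕ :=
  (Finset.range (N + 1)).filter (fun n => (n : ℝ) ∈ I)

/-- The norm `max_{1 ≤ r ≤ q} |f(r)|` of a `q`-periodic function. -/
noncomputable def periodicSupNorm (q : ℕ) (f : ℕ → ℂ) : ℝ :=
  ((Finset.Icc 1 q).sup (fun r => ‖f r‖₊) : NNReal)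

/-! Put λ_k = μ(k) log⁺(R/k), so that Λ_R(n)² = ∑ λ_k λ_l 1_{[k,l] ∣ n}. The function f·1_{[k,l] ∣
n} has period [k,l]q but at most q nonzero values per period, so its sum over I differs from |I|
times its mean by at most q‖f‖. Summed over k, l ≤ R this costs q‖f‖R² log² R, which is affordable
for |I| ≥ qR³. Hence averages over I may be replaced by averages over the common period Q = q·⌊R⌋!.

There a pair k, l meets integers coprime to q only if [k,l] is coprime to q, and then multiplication
by [k,l] permutes the residues mod q. So the sum of f·Λ_R² over n coprime to q is the sum of f over
reduced residues times a quantity independent of f (`totient_mul_sum_range_coprime_LambdaR_sq`). It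
remains to see that the mean of Λ_R² is log R + O(1) (`exists_diagonalForm_log_le`) and that the n
not coprime to q contribute only O(1 + log(3 + log q)) to it
(`exists_sum_range_not_coprime_LambdaR_sq_le`).

Selberg's diagonalisation, gcd(k,l) = ∑ φ(d), turns the mean into ∑ φ(d)/d² · m_d(R/d)² over
squarefree d ≤ R, where m_d(x) = ∑ μ(m)/m · log(x/m) over m ≤ x coprime to d. The analytic input is
m_1(x) = 1 + O((1 + log x)⁻²). Since m_d(x) = ∑ m_1(x/b)/b over b ≤ x composed of primes of d,
m_d(x) is close to ∑ 1/b ≤ d/φ(d). Each n is uniquely d·b of this shape, d being its radical, so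
double sums over d, b collapse to harmonic sums over n ≤ R. On multiples of a prime p, Λ_R(pm) =
Λ_R(m) − Λ_{R/p}(m) for p ∤ m; the same method bounds the mean square of this difference by O(1 +
log p), and ∑_{p ∣ q} log p / p is O(1 + log(3 + log q)).

For m_1: the Laplace transform of m_1(e^u) − (1 − e^{-u}) is 1/(s²ζ(1+s)) − 1/(s(s+1)), which
extends holomorphically across Re s = 0 and is O((1 + |Im s|)^{-13/10}) together with two
derivatives on 0 ≤ Re s ≤ 1. Fourier inversion then gives O(u⁻²). The estimates for 1/ζ come from ζ
= O(t^{1/20}) slightly left of the line Re = 1 and from the 3-4-1 inequality. -/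

/-! ### Upper bound for ζ near the line Re = 1 by Euler–Maclaurin. -/

open Filter Topology in
-- The subtracted quotient is the integral of x^(-w) over [n, n+1]. The mean value inequality is
-- applied twice: to x^(-w), then to an antiderivative of (n+1)^(-w) − x^(-w).
theorem emTerm_norm_le (n : ℕ) (hn : 0 < n) (w : ℂ) (hw : 0 < w.re) (hw1 : w ≠ 1) :
    ‖((n + 1 : ℕ) : ℂ) ^ (-w) -
      (((n + 1 : ℕ) : ℂ) ^ (1 - w) - (n : ℂ) ^ (1 - w)) / (1 - w)‖ ≤ ‖w‖ * (n : ℝ) ^ (-w.re - 1) := by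
  have hn' : (0 : ℝ) < n := by exact_mod_cast hn
  have hw1' : 1 - w ≠ 0 := sub_ne_zero.mpr (Ne.symm hw1)
  have key1 : ∀ x ∈ Set.Icc (n : ℝ) (n + 1),
      HasDerivWithinAt (fun x : ℝ => (x : ℂ) ^ (-w)) (-w * (x : ℂ) ^ (-w - 1))
        (Set.Icc (n : ℝ) (n + 1)) x := by
    intro x hx
    have hx0 : x ≠ 0 := (lt_of_lt_of_le hn' hx.1).ne'
    have hw0 : -w ≠ 0 := by
      intro h
      rw [neg_eq_zero] at h
      simp [h] at hw
    exact (hasDerivAt_ofReal_cpow_const hx0 hw0 : _).hasDerivWithinAt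
  have bd1 : ∀ x ∈ Set.Icc (n : ℝ) (n + 1),
      ‖-w * (x : ℂ) ^ (-w - 1)‖ ≤ ‖w‖ * (n : ℝ) ^ (-w.re - 1) := by
    intro x hx
    have hx0 : 0 < x := lt_of_lt_of_le hn' hx.1
    rw [norm_mul, norm_neg, Complex.norm_cpow_eq_rpow_re_of_pos hx0]
    gcongr ?_ * ?_
    simp only [Complex.sub_re, Complex.neg_re, Complex.one_re]
    exact Real.rpow_le_rpow_of_nonpos hn' hx.1 (by linarith)
  have mv1 : ∀ x ∈ Set.Icc (n : ℝ) (n + 1),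
      ‖((n + 1 : ℕ) : ℂ) ^ (-w) - (x : ℂ) ^ (-w)‖ ≤ ‖w‖ * (n : ℝ) ^ (-w.re - 1) := by
    intro x hx
    have := (convex_Icc (n : ℝ) (n + 1)).norm_image_sub_le_of_norm_hasDerivWithin_le key1 bd1 hx
      (Set.right_mem_Icc.mpr (by linarith))
    have h2 : ‖(n + 1 : ℝ) - x‖ ≤ 1 := by
      rw [Real.norm_eq_abs, abs_of_nonneg (by linarith [hx.2])]; linarith [hx.1]
    push_cast at this ⊢
    refine this.trans (mul_le_of_le_one_right (by positivity) h2)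
  have key2 : ∀ x ∈ Set.Icc (n : ℝ) (n + 1),
      HasDerivWithinAt (fun x : ℝ => (x : ℂ) * ((n + 1 : ℕ) : ℂ) ^ (-w) - (x : ℂ) ^ (1 - w) / (1 - w))
        (((n + 1 : ℕ) : ℂ) ^ (-w) - (x : ℂ) ^ (-w))
        (Set.Icc (n : ℝ) (n + 1)) x := by
    intro x hx
    have hx0 : x ≠ 0 := (lt_of_lt_of_le hn' hx.1).ne'
    have h1 := (hasDerivAt_ofReal_cpow_const hx0 hw1').div_const (1 - w)
    have h2 := (Complex.ofRealCLM.hasDerivAt (x := x)).mul_const (((n + 1 : ℕ) : ℂ) ^ (-w))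
    refine ((h2.sub h1).congr_deriv ?_).hasDerivWithinAt
    rw [show (1 - w - 1 : ℂ) = -w by ring]
    field_simp
    simp
  have := (convex_Icc (n : ℝ) (n + 1)).norm_image_sub_le_of_norm_hasDerivWithin_le key2 mv1
    (Set.left_mem_Icc.mpr (by linarith)) (Set.right_mem_Icc.mpr (by linarith))
  have e : ‖(n + 1 : ℝ) - n‖ = 1 := by simp
  rw [e, mul_one] at this
  refine le_trans (le_of_eq ?_) this
  congr 1
  push_cast
  ring

/-- The terms of the Euler-Maclaurin expansion of `ζ`. -/
noncomputable def emTerm (n : ℕ) (w : ℂ) : ℂ :=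
  ((n + 1 : ℕ) : ℂ) ^ (-w) - (((n + 1 : ℕ) : ℂ) ^ (1 - w) - (n : ℂ) ^ (1 - w)) / (1 - w)

theorem summable_shift_rpow {a : ℝ} (N : ℕ) (ha : a < -1) :
    Summable (fun k : ℕ => ((N + k : ℕ) : ℝ) ^ a) := by
  have := (summable_nat_add_iff N).mpr (Real.summable_nat_rpow.mpr ha)
  simpa [add_comm] using this

theorem differentiableOn_tsum_emTerm (N : ℕ) (hN : 0 < N) (U : Set ℂ) (hU : IsOpen U)
    (hU0 : ∀ w ∈ U, 0 < w.re) (hU1 : ∀ w ∈ U, w ≠ 1) :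
    DifferentiableOn ℂ (fun w => ∑' k : ℕ, emTerm (N + k) w) U := by
  intro w hw
  -- a ball around `w`
  set V : Set ℂ := U ∩ ({z | w.re / 2 < z.re} ∩ Metric.ball 0 (‖w‖ + 1)) with hV
  have hVo : IsOpen V := hU.inter ((isOpen_lt continuous_const Complex.continuous_re).inter
    Metric.isOpen_ball)
  have hwV : w ∈ V := ⟨hw, by simp; linarith [hU0 w hw], by simp⟩
  have : DifferentiableOn ℂ (fun w => ∑' k : ℕ, emTerm (N + k) w) V := by
    refine Complex.differentiableOn_tsum_of_summable_norm
      (u := fun k => (‖w‖ + 1) * ((N + k : ℕ) : ℝ) ^ (-(w.re / 2) - 1)) ?_ ?_ hVo ?_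
    · exact (summable_shift_rpow N (by linarith [hU0 w hw])).mul_left _
    · intro k z hz
      have hz1 : z ≠ 1 := hU1 z hz.1
      have h1 : (1 : ℂ) - z ≠ 0 := sub_ne_zero.mpr (Ne.symm hz1)
      have hNk : ((N + k : ℕ) : ℂ) ≠ 0 := by norm_cast; omega
      have hNk' : ((N + k + 1 : ℕ) : ℂ) ≠ 0 := by norm_cast
      refine DifferentiableAt.differentiableWithinAt ?_
      unfold emTerm
      refine DifferentiableAt.sub ?_ (DifferentiableAt.div (DifferentiableAt.sub ?_ ?_) ?_ h1)
      · exact DifferentiableAt.const_cpow (by fun_prop) (Or.inl hNk')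
      · exact DifferentiableAt.const_cpow (by fun_prop) (Or.inl hNk')
      · exact DifferentiableAt.const_cpow (by fun_prop) (Or.inl hNk)
      · fun_prop
    · intro k z hz
      refine (emTerm_norm_le (N + k) (by omega) z (hU0 z hz.1) (hU1 z hz.1)).trans ?_
      have h1 : ‖z‖ ≤ ‖w‖ + 1 := by
        have := hz.2.2; simp at this; exact this.le
      have h2 : w.re / 2 < z.re := hz.2.1
      gcongr ?_ * ?_
      refine Real.rpow_le_rpow_of_exponent_le ?_ (by linarith)
      exact_mod_cast (by omega : 1 ≤ N + k)
  exact (this.differentiableAt (hVo.mem_nhds hwV)).differentiableWithinAt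

open Filter Topology in
-- The integrals inside `emTerm` telescope, and M^(1-w) → 0 for Re w > 1.
theorem riemannZeta_eq_of_one_lt_re (N : ℕ) (hN : 0 < N) (w : ℂ) (hw : 1 < w.re) :
    riemannZeta w = ∑ n ∈ Finset.range N, ((n + 1 : ℕ) : ℂ) ^ (-w) - (N : ℂ) ^ (1 - w) / (1 - w)
      + ∑' k : ℕ, emTerm (N + k) w := by
  have hw1 : w ≠ 1 := by rintro rfl; simp at hw
  have hs : HasSum (fun n : ℕ => ((n + 1 : ℕ) : ℂ) ^ (-w)) (riemannZeta w) := by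
    rw [zeta_eq_tsum_one_div_nat_add_one_cpow hw]
    have : Summable (fun n : ℕ => 1 / ((n : ℂ) + 1) ^ w) := by
      have := (summable_nat_add_iff 1).mpr (Complex.summable_one_div_nat_cpow.mpr hw)
      simpa using this
    convert this.hasSum using 2 with n
    push_cast
    rw [Complex.cpow_neg, one_div]
  have hsT : Summable (fun k => emTerm (N + k) w) := by
    refine Summable.of_norm_bounded (g := fun k => ‖w‖ * ((N + k : ℕ) : ℝ) ^ (-w.re - 1)) 
      ((summable_shift_rpow N (by linarith)).mul_left _) fun k => ?_
    exact emTerm_norm_le (N + k) (by omega) w (by linarith) hw1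
  have l1 := hsT.hasSum.tendsto_sum_nat
  have e : ∀ m : ℕ, ∑ k ∈ Finset.range m, emTerm (N + k) w =
      (∑ n ∈ Finset.range (N + m), ((n + 1 : ℕ) : ℂ) ^ (-w) 
        - ∑ n ∈ Finset.range N, ((n + 1 : ℕ) : ℂ) ^ (-w))
      - (((N + m : ℕ) : ℂ) ^ (1 - w) - (N : ℂ) ^ (1 - w)) / (1 - w) := by
    intro m
    induction m with
    | zero => simp
    | succ m ih =>
      rw [Finset.sum_range_succ, ih, ← add_assoc, Finset.sum_range_succ, emTerm]
      ring
  have l2 : Tendsto (fun m : ℕ => ((N + m : ℕ) : ℂ) ^ (1 - w)) atTop (𝓝 0) := by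
    rw [tendsto_zero_iff_norm_tendsto_zero]
    have : ∀ m : ℕ, ‖((N + m : ℕ) : ℂ) ^ (1 - w)‖ = ((N + m : ℕ) : ℝ) ^ (-(w.re - 1)) := by
      intro m
      rw [Complex.norm_natCast_cpow_of_pos (by omega)]
      simp
    simp_rw [this]
    refine (tendsto_rpow_neg_atTop (by linarith)).comp ?_
    exact tendsto_natCast_atTop_atTop.comp (tendsto_add_atTop_nat N |>.congr fun m => by ring)
  have l3 : Tendsto (fun m : ℕ => ∑ n ∈ Finset.range (N + m), ((n + 1 : ℕ) : ℂ) ^ (-w)) atTop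
      (𝓝 (riemannZeta w)) :=
    hs.tendsto_sum_nat.comp (tendsto_add_atTop_nat N |>.congr fun m => by ring)
  simp_rw [e] at l1
  have l4 := (l3.sub_const (∑ n ∈ Finset.range N, ((n + 1 : ℕ) : ℂ) ^ (-w))).sub
    ((l2.sub_const ((N : ℂ) ^ (1 - w))).div_const (1 - w))
  have := tendsto_nhds_unique l1 l4
  rw [this]
  ring

open Filter Topology in
-- Analytic continuation from Re w > 1. The open quadrant is convex, hence connected, and avoids the
-- pole.
theorem riemannZeta_eq_of_pos (N : ℕ) (hN : 0 < N) (w : ℂ) (hw : 0 < w.re) (hi : 0 < w.im) :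
    riemannZeta w = ∑ n ∈ Finset.range N, ((n + 1 : ℕ) : ℂ) ^ (-w) - (N : ℂ) ^ (1 - w) / (1 - w)
      + ∑' k : ℕ, emTerm (N + k) w := by
  set U : Set ℂ := {z | 0 < z.re} ∩ {z | 0 < z.im} with hU
  have hUo : IsOpen U := (isOpen_lt continuous_const Complex.continuous_re).inter
    (isOpen_lt continuous_const Complex.continuous_im)
  have hU1 : ∀ z ∈ U, z ≠ 1 := by
    rintro z hz rfl
    simp [hU] at hz
  have hUc : IsPreconnected U :=
    ((convex_halfSpace_re_gt 0).inter (convex_halfSpace_im_gt 0)).isPreconnected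
  have d1 : DifferentiableOn ℂ riemannZeta U := fun z hz =>
    (differentiableAt_riemannZeta (hU1 z hz)).differentiableWithinAt
  have d2 : DifferentiableOn ℂ (fun w => ∑ n ∈ Finset.range N, ((n + 1 : ℕ) : ℂ) ^ (-w)
      - (N : ℂ) ^ (1 - w) / (1 - w) + ∑' k : ℕ, emTerm (N + k) w) U := by
    refine DifferentiableOn.add ?_ (differentiableOn_tsum_emTerm N hN U hUo (fun z hz => hz.1) hU1)
    intro z hz
    have h1 : (1 : ℂ) - z ≠ 0 := sub_ne_zero.mpr (Ne.symm (hU1 z hz))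
    have hN' : (N : ℂ) ≠ 0 := by norm_cast; omega
    refine (DifferentiableAt.sub ?_ ?_).differentiableWithinAt
    · refine DifferentiableAt.fun_sum fun n _ => ?_
      exact DifferentiableAt.const_cpow (by fun_prop) (Or.inl (by norm_cast))
    · exact DifferentiableAt.div (DifferentiableAt.const_cpow (by fun_prop) (Or.inl hN'))
        (by fun_prop) h1
  have hz0 : (2 + Complex.I : ℂ) ∈ U := by simp [hU]
  refine (d1.analyticOnNhd hUo).eqOn_of_preconnected_of_eventuallyEq (d2.analyticOnNhd hUo) hUc hz0
    ?_ ⟨hw, hi⟩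
  have : {z : ℂ | 1 < z.re} ∈ 𝓝 (2 + Complex.I : ℂ) :=
    (isOpen_lt continuous_const Complex.continuous_re).mem_nhds (by simp)
  filter_upwards [this] with z hz
  exact riemannZeta_eq_of_one_lt_re N hN z hz

/-- The formula is cut at N = ⌈t⌉. In the finite sum n^(-39/40) = n^(-41/40) n^(1/20), the first
factor being summable; in the tail the factor ‖w‖ ≤ 4t is paid for by t^(-19/20). The exponent 1/20
is small enough to survive a later loss of its 14th power. -/
theorem norm_riemannZeta_le_of_im_pos : ∃ C : ℝ, 0 < C ∧ ∀ w : ℂ, 39 / 40 ≤ w.re → w.re ≤ 3 →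
    1 ≤ w.im → ‖riemannZeta w‖ ≤ C * w.im ^ (1 / 20 : ℝ) := by
  set S : ℝ := ∑' n : ℕ, (n : ℝ) ^ (-(41 / 40) : ℝ) with hS
  have hsum : Summable (fun n : ℕ => (n : ℝ) ^ (-(41 / 40) : ℝ)) :=
    Real.summable_nat_rpow.mpr (by norm_num)
  have hS0 : 0 ≤ S := tsum_nonneg fun n => by positivity
  refine ⟨2 * S + 2 + 4 * S, by positivity, fun w hw1 hw3 ht => ?_⟩
  set t := w.im with htdef
  have ht0 : 0 < t := by linarith
  set N := ⌈t⌉₊ with hN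
  have hN0 : 0 < N := Nat.ceil_pos.mpr ht0
  have hNt : t ≤ N := Nat.le_ceil t
  have hN2 : (N : ℝ) ≤ 2 * t := by linarith [(Nat.ceil_lt_add_one ht0.le)]
  have hN1 : (1 : ℝ) ≤ N := by exact_mod_cast hN0
  have hNr : (N : ℝ) ^ (1 / 20 : ℝ) ≤ 2 * t ^ (1 / 20 : ℝ) := by
    calc (N : ℝ) ^ (1 / 20 : ℝ) ≤ (2 * t) ^ (1 / 20 : ℝ) := by gcongr
      _ = 2 ^ (1 / 20 : ℝ) * t ^ (1 / 20 : ℝ) := Real.mul_rpow (by norm_num) ht0.le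
      _ ≤ 2 ^ (1 : ℝ) * t ^ (1 / 20 : ℝ) := by
        gcongr
        · norm_num
        · norm_num
      _ = _ := by norm_num
  have hw_ne : w ≠ 1 := by
    intro h; rw [h] at htdef; simp at htdef; linarith
  rw [riemannZeta_eq_of_pos N hN0 w (by linarith) (by linarith)]
  have b1 : ‖∑ n ∈ Finset.range N, ((n + 1 : ℕ) : ℂ) ^ (-w)‖ ≤ 2 * S * t ^ (1 / 20 : ℝ) := by
    calc ‖∑ n ∈ Finset.range N, ((n + 1 : ℕ) : ℂ) ^ (-w)‖
        ≤ ∑ n ∈ Finset.range N, ‖((n + 1 : ℕ) : ℂ) ^ (-w)‖ := norm_sum_le _ _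
      _ ≤ ∑ n ∈ Finset.range N, ((n + 1 : ℕ) : ℝ) ^ (-(41 / 40) : ℝ) * (N : ℝ) ^ (1 / 20 : ℝ) := by
        refine Finset.sum_le_sum fun n hn => ?_
        rw [Complex.norm_natCast_cpow_of_pos (by omega)]
        have hn1 : (1 : ℝ) ≤ ((n + 1 : ℕ) : ℝ) := by push_cast; linarith [n.cast_nonneg (α := ℝ)]
        calc ((n + 1 : ℕ) : ℝ) ^ (-w).re ≤ ((n + 1 : ℕ) : ℝ) ^ (-(41 / 40) + 1 / 20 : ℝ) := by
              refine Real.rpow_le_rpow_of_exponent_le hn1 ?_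
              simp only [Complex.neg_re]; linarith
          _ = ((n + 1 : ℕ) : ℝ) ^ (-(41 / 40) : ℝ) * ((n + 1 : ℕ) : ℝ) ^ (1 / 20 : ℝ) :=
              Real.rpow_add (by linarith) _ _
          _ ≤ _ := by
              gcongr
              have := Finset.mem_range.mp hn
              omega
      _ = (∑ n ∈ Finset.range N, ((n + 1 : ℕ) : ℝ) ^ (-(41 / 40) : ℝ)) * (N : ℝ) ^ (1 / 20 : ℝ) :=
        (Finset.sum_mul _ _ _).symm
      _ ≤ S * (2 * t ^ (1 / 20 : ℝ)) := by
        gcongr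
        have h := hsum.sum_le_tsum (Finset.range (N + 1)) (fun n _ => by positivity)
        rw [Finset.sum_range_succ'] at h
        have h0 : (0 : ℝ) ≤ ((0 : ℕ) : ℝ) ^ (-(41 / 40) : ℝ) := by positivity
        linarith
      _ = _ := by ring
  have b2 : ‖(N : ℂ) ^ (1 - w) / (1 - w)‖ ≤ 2 * t ^ (1 / 20 : ℝ) := by
    rw [norm_div, Complex.norm_natCast_cpow_of_pos hN0]
    have h1 : 1 ≤ ‖1 - w‖ := by
      calc 1 ≤ |(1 - w).im| := by simp [← htdef]; exact ht.trans (le_abs_self t)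
        _ ≤ _ := Complex.abs_im_le_norm _
    calc (N : ℝ) ^ (1 - w).re / ‖1 - w‖ ≤ (N : ℝ) ^ (1 - w).re := div_le_self (by positivity) h1
      _ ≤ (N : ℝ) ^ (1 / 20 : ℝ) := by
        refine Real.rpow_le_rpow_of_exponent_le hN1 ?_
        simp only [Complex.sub_re, Complex.one_re]; linarith
      _ ≤ _ := hNr
  have b3 : ‖∑' k : ℕ, emTerm (N + k) w‖ ≤ 4 * S * t ^ (1 / 20 : ℝ) := by
    have hwn : ‖w‖ ≤ 4 * t := by
      calc ‖w‖ ≤ |w.re| + |w.im| := Complex.norm_le_abs_re_add_abs_im w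
        _ ≤ _ := by
          rw [abs_of_nonneg (by linarith), ← htdef, abs_of_nonneg ht0.le]; linarith
    have hle : ∀ k, ‖emTerm (N + k) w‖ ≤
        (4 * t * t ^ (-(19 / 20) : ℝ)) * ((N + k : ℕ) : ℝ) ^ (-(41 / 40) : ℝ) := by
      intro k
      have hNk : (1 : ℝ) ≤ ((N + k : ℕ) : ℝ) := by push_cast; linarith [k.cast_nonneg (α := ℝ)]
      have hNk' : t ≤ ((N + k : ℕ) : ℝ) := by push_cast; linarith [k.cast_nonneg (α := ℝ)]
      calc ‖emTerm (N + k) w‖ ≤ ‖w‖ * ((N + k : ℕ) : ℝ) ^ (-w.re - 1) :=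
            emTerm_norm_le (N + k) (by omega) w (by linarith) hw_ne
        _ ≤ (4 * t) * ((N + k : ℕ) : ℝ) ^ (-(19 / 20) + -(41 / 40) : ℝ) := by
            gcongr ?_ * ?_
            exact Real.rpow_le_rpow_of_exponent_le hNk (by linarith)
        _ = (4 * t) * (((N + k : ℕ) : ℝ) ^ (-(19 / 20) : ℝ) * ((N + k : ℕ) : ℝ) ^ (-(41 / 40) : ℝ)) := by
            rw [Real.rpow_add (by linarith)]
        _ ≤ (4 * t) * (t ^ (-(19 / 20) : ℝ) * ((N + k : ℕ) : ℝ) ^ (-(41 / 40) : ℝ)) := by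
            gcongr ?_ * (?_ * ?_)
            exact Real.rpow_le_rpow_of_nonpos ht0 hNk' (by norm_num)
        _ = _ := by ring
    have hs2 := summable_shift_rpow N (a := -(41 / 40)) (by norm_num)
    have htt : t * t ^ (-(19 / 20) : ℝ) = t ^ (1 / 20 : ℝ) := by
      nth_rewrite 1 [← Real.rpow_one t]
      rw [← Real.rpow_add ht0]; norm_num
    calc ‖∑' k : ℕ, emTerm (N + k) w‖
        ≤ ∑' k : ℕ, (4 * t * t ^ (-(19 / 20) : ℝ)) * ((N + k : ℕ) : ℝ) ^ (-(41 / 40) : ℝ) :=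
          tsum_of_norm_bounded (hs2.mul_left _).hasSum hle
      _ = (4 * t ^ (1 / 20 : ℝ)) * ∑' k : ℕ, ((N + k : ℕ) : ℝ) ^ (-(41 / 40) : ℝ) := by
          rw [tsum_mul_left, mul_assoc 4, htt]
      _ ≤ (4 * t ^ (1 / 20 : ℝ)) * S := by
          gcongr
          have h := hsum.sum_add_tsum_nat_add N
          have h0 : 0 ≤ ∑ i ∈ Finset.range N, (i : ℝ) ^ (-(41 / 40) : ℝ) :=
            Finset.sum_nonneg fun i _ => by positivity
          have : ∑' k : ℕ, ((N + k : ℕ) : ℝ) ^ (-(41 / 40) : ℝ) =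
            ∑' k : ℕ, ((k + N : ℕ) : ℝ) ^ (-(41 / 40) : ℝ) := by simp_rw [add_comm]
          rw [this]; linarith
      _ = _ := by ring
  calc _ ≤ 2 * S * t ^ (1 / 20 : ℝ) + 2 * t ^ (1 / 20 : ℝ) + 4 * S * t ^ (1 / 20 : ℝ) :=
        (norm_add_le _ _).trans (add_le_add ((norm_sub_le _ _).trans (add_le_add b1 b2)) b3)
    _ = _ := by ring

theorem norm_riemannZeta_le : ∃ C : ℝ, 0 < C ∧ ∀ w : ℂ, 39 / 40 ≤ w.re → w.re ≤ 3 →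
    1 ≤ |w.im| → ‖riemannZeta w‖ ≤ C * |w.im| ^ (1 / 20 : ℝ) := by
  obtain ⟨C, hC, h⟩ := norm_riemannZeta_le_of_im_pos
  refine ⟨C, hC, fun w h1 h2 h3 => ?_⟩
  rcases le_or_gt 0 w.im with hi | hi
  · rw [abs_of_nonneg hi] at h3 ⊢
    exact h w h1 h2 h3
  · rw [abs_of_neg hi] at h3 ⊢
    have := h (starRingEnd ℂ w) (by simpa) (by simpa) (by simpa)
    rw [riemannZeta_conj, Complex.norm_conj] at this
    simpa using this

/-! ### The pole of ζ, and a lower bound for ζ around the line Re = 1. -/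

section

open Filter Topology

/-- The regular part `ζ(1 + s) - 1 / s` of the Riemann zeta function at its pole. -/
noncomputable def zetaReg : ℂ → ℂ :=
  Function.update (fun s => riemannZeta (1 + s) - 1 / s) 0 (Real.eulerMascheroniConstant : ℂ)

theorem zetaReg_of_ne {s : ℂ} (hs : s ≠ 0) : zetaReg s = riemannZeta (1 + s) - 1 / s := by
  simp [zetaReg, Function.update_of_ne hs]

theorem differentiable_zetaReg : Differentiable ℂ zetaReg := by
  rw [← differentiableOn_univ,
    ← Complex.differentiableOn_compl_singleton_and_continuousAt_iff (c := 0) univ_mem]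
  constructor
  · intro s hs
    have hs0 : s ≠ 0 := by simpa using hs
    have : DifferentiableAt ℂ (fun s => riemannZeta (1 + s) - 1 / s) s := by
      refine DifferentiableAt.sub ?_ (by fun_prop (disch := assumption))
      exact DifferentiableAt.comp (g := riemannZeta) (f := fun s => 1 + s) s
        (differentiableAt_riemannZeta (by simpa using hs0)) (by fun_prop)
    refine (this.congr_of_eventuallyEq ?_).differentiableWithinAt
    filter_upwards [isOpen_ne.mem_nhds hs0] with z hz
    exact zetaReg_of_ne hz
  · rw [zetaReg, continuousAt_update_same]
    have h := tendsto_riemannZeta_sub_one_div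
    have h2 : Tendsto (fun s : ℂ => 1 + s) (𝓝[≠] 0) (𝓝[≠] 1) := by
      refine tendsto_nhdsWithin_of_tendsto_nhds_of_eventually_within _ ?_ ?_
      · refine Tendsto.mono_left ?_ nhdsWithin_le_nhds
        have : ContinuousAt (fun s : ℂ => 1 + s) 0 := by fun_prop
        simpa [ContinuousAt] using this
      · filter_upwards [self_mem_nhdsWithin] with s hs
        simpa using hs
    refine (h.comp h2).congr fun s => ?_
    simp

theorem mul_zetaReg {s : ℂ} (hs : s ≠ 0) : 1 + s * zetaReg s = s * riemannZeta (1 + s) := by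
  rw [zetaReg_of_ne hs]; field_simp; ring

theorem one_add_mul_zetaReg_ne_zero {s : ℂ} (hs : 0 ≤ s.re) : 1 + s * zetaReg s ≠ 0 := by
  rcases eq_or_ne s 0 with rfl | h
  · simp
  · rw [mul_zetaReg h]
    exact mul_ne_zero h (riemannZeta_ne_zero_of_one_le_re (by simpa using hs))

/-- The function `1 / (s² ζ(1 + s)) - 1 / (s (s + 1))`, with its singularity at `0` removed. -/
noncomputable def invZetaReg (s : ℂ) : ℂ := (1 - zetaReg s) / ((1 + s * zetaReg s) * (s + 1))

theorem invZetaReg_eq {s : ℂ} (hs : s ≠ 0) (hs1 : s + 1 ≠ 0) (hz : riemannZeta (1 + s) ≠ 0) :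
    invZetaReg s = 1 / (s ^ 2 * riemannZeta (1 + s)) - 1 / (s * (s + 1)) := by
  rw [invZetaReg, mul_zetaReg hs, zetaReg_of_ne hs]
  field_simp
  ring

theorem norm_riemannZeta_one_add_le : ∃ C : ℝ, 1 ≤ C ∧ ∀ x : ℝ, 0 < x → x ≤ 1 →
    ‖riemannZeta (1 + x)‖ ≤ C / x := by
  obtain ⟨B, hB⟩ := (isCompact_Icc (a := (0 : ℝ)) (b := 1)).exists_bound_of_continuousOn
    (f := fun x : ℝ => zetaReg x)
    (differentiable_zetaReg.continuous.comp Complex.continuous_ofReal).continuousOn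
  have hB0 : 0 ≤ B := (norm_nonneg _).trans (hB 0 (by simp))
  refine ⟨1 + B, by linarith, fun x hx hx1 => ?_⟩
  have hx0 : (x : ℂ) ≠ 0 := by exact_mod_cast hx.ne'
  have h := zetaReg_of_ne hx0
  rw [show riemannZeta (1 + x) = zetaReg x + 1 / x by rw [h]; ring]
  calc ‖zetaReg x + 1 / x‖ ≤ B + 1 / x := by
        refine (norm_add_le _ _).trans (add_le_add (hB x ⟨hx.le, hx1⟩) ?_)
        simp [abs_of_pos hx]
    _ ≤ B / x + 1 / x := by
        gcongr
        exact le_div_self hB0 hx hx1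
    _ = _ := by ring

theorem norm_riemannZeta_product_ge_one {x : ℝ} (hx : 0 < x) (y : ℝ) :
    1 ≤ ‖riemannZeta (1 + x)‖ ^ 3 * ‖riemannZeta (1 + x + Complex.I * y)‖ ^ 4 *
      ‖riemannZeta (1 + x + 2 * Complex.I * y)‖ := by
  have h := DirichletCharacter.norm_LFunction_product_ge_one (N := 1) (χ := 1) hx y
  simpa [DirichletCharacter.LFunctionTrivChar, DirichletCharacter.LFunction_modOne_eq] using h

theorem two_mul_rpow_le (t : ℝ) (ht : 0 ≤ t) : (2 * t) ^ (1 / 20 : ℝ) ≤ 2 * t ^ (1 / 20 : ℝ) := by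
  calc (2 * t) ^ (1 / 20 : ℝ) = 2 ^ (1 / 20 : ℝ) * t ^ (1 / 20 : ℝ) := Real.mul_rpow (by norm_num) ht
      _ ≤ 2 ^ (1 : ℝ) * t ^ (1 / 20 : ℝ) := by
        gcongr
        · norm_num
        · norm_num
      _ = _ := by norm_num

/-- Cauchy's estimate on circles of radius 1/80: they stay within 1/40 of w₀, hence in Re ≥ 39/40
and |Im| ≥ 1, where the upper bound for ζ holds. -/
theorem riemannZeta_lipschitz : ∃ D : ℝ, 0 < D ∧ ∀ w₀ : ℂ, 1 ≤ w₀.re → w₀.re ≤ 2 → 3 ≤ |w₀.im| →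
    ∀ w ∈ Metric.closedBall w₀ (1 / 80),
      ‖riemannZeta w - riemannZeta w₀‖ ≤ D * |w₀.im| ^ (1 / 20 : ℝ) * ‖w - w₀‖ := by
  obtain ⟨C, hC, hz⟩ := norm_riemannZeta_le
  refine ⟨2 * C / (1 / 80), by positivity, fun w₀ h1 h2 h3 w hw => ?_⟩
  set τ := |w₀.im| ^ (1 / 20 : ℝ) with hτ
  have key : ∀ z, ‖z - w₀‖ ≤ 1 / 40 → z ≠ 1 ∧ ‖riemannZeta z‖ ≤ 2 * C * τ := by
    intro z hz'
    have hre : |z.re - w₀.re| ≤ 1 / 40 := (Complex.abs_re_le_norm (z - w₀)).trans hz'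
    have him : |z.im - w₀.im| ≤ 1 / 40 := (Complex.abs_im_le_norm (z - w₀)).trans hz'
    rw [abs_le] at hre
    have i1 : |w₀.im| - 1 / 40 ≤ |z.im| := by
      have := abs_sub_abs_le_abs_sub w₀.im z.im
      rw [abs_sub_comm] at him
      linarith
    have i2 : |z.im| ≤ |w₀.im| + 1 / 40 := by
      have := abs_sub_abs_le_abs_sub z.im w₀.im
      linarith
    constructor
    · rintro rfl
      simp at i1
      linarith
    · refine (hz z (by linarith) (by linarith) (by linarith)).trans ?_
      calc C * |z.im| ^ (1 / 20 : ℝ) ≤ C * (2 * |w₀.im|) ^ (1 / 20 : ℝ) := by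
            gcongr; linarith
        _ ≤ C * (2 * τ) := by
            gcongr; exact two_mul_rpow_le _ (abs_nonneg _)
        _ = _ := by ring
  refine (convex_closedBall w₀ (1 / 80)).norm_image_sub_le_of_norm_deriv_le (𝕜 := ℂ)
    (f := riemannZeta) (fun z hz' => ?_) (fun z hz' => ?_) (Metric.mem_closedBall_self (by norm_num)) hw
  · rw [mem_closedBall_iff_norm] at hz'
    exact differentiableAt_riemannZeta (key z (by linarith)).1
  · rw [mem_closedBall_iff_norm] at hz'
    have near : ∀ y, ‖y - z‖ ≤ 1 / 80 → ‖y - w₀‖ ≤ 1 / 40 := by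
      intro y hy
      have := norm_sub_le_norm_sub_add_norm_sub y z w₀
      linarith
    refine (Complex.norm_deriv_le_of_forall_mem_sphere_norm_le (C := 2 * C * τ) (R := 1 / 80)
      (by norm_num) ?_ ?_).trans (le_of_eq (by ring))
    · refine DifferentiableOn.diffContOnCl (s := Metric.ball z (1 / 80)) fun y hy => ?_
      rw [closure_ball z (by norm_num)] at hy
      rw [mem_closedBall_iff_norm] at hy
      exact (differentiableAt_riemannZeta (key y (near y hy)).1).differentiableWithinAt
    · intro y hy
      rw [mem_sphere_iff_norm] at hy
      exact (key y (near y hy.le)).2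

/-- Let v = |w₀.im|^(-1/20). The 3-4-1 inequality gives |ζ| ≥ 2Dθv⁴ at distance at least θv⁵ to the
right of Re = 1. The Lipschitz constant D/v carries this back to the line at a cost of Dθv⁴, and
once more to a disk that crosses the line. -/
theorem le_norm_riemannZeta : ∃ c θ : ℝ, 0 < c ∧ 0 < θ ∧ θ ≤ 1 / 80 ∧
    ∀ w₀ : ℂ, 1 ≤ w₀.re → w₀.re ≤ 2 → 3 ≤ |w₀.im| →
    ∀ w ∈ Metric.closedBall w₀ (θ * (|w₀.im| ^ (1 / 20 : ℝ))⁻¹ ^ 5),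
      c * (|w₀.im| ^ (1 / 20 : ℝ))⁻¹ ^ 4 ≤ ‖riemannZeta w‖ := by
  obtain ⟨C, hC, hz⟩ := norm_riemannZeta_le
  obtain ⟨D, hD, hlip⟩ := riemannZeta_lipschitz
  obtain ⟨C₀, hC₀, hpole⟩ := norm_riemannZeta_one_add_le
  set A := 2 * C * C₀ ^ 3 with hA
  have hA0 : 0 < A := by positivity
  -- The 3-4-1 inequality will give |ζ|⁴ ≥ θ³v¹⁶/A; this is at least (2Dθv⁴)⁴ as soon as 16D⁴Aθ ≤ 1.
  set θ := min (1 / 80) (1 / (16 * D ^ 4 * A)) with hθ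
  have hθ0 : 0 < θ := by positivity
  have hθ1 : θ ≤ 1 / 80 := min_le_left _ _
  have hθ2 : θ * (16 * D ^ 4 * A) ≤ 1 := by
    rw [← le_div_iff₀ (by positivity)]; exact min_le_right _ _
  -- the lower bound on vertical lines to the right of `1`
  have low : ∀ w₀ : ℂ, 1 ≤ w₀.re → w₀.re ≤ 2 → 3 ≤ |w₀.im| →
      D * θ * (|w₀.im| ^ (1 / 20 : ℝ))⁻¹ ^ 4 ≤ ‖riemannZeta w₀‖ := by
    intro w₀ h1 h2 h3
    set τ := |w₀.im| ^ (1 / 20 : ℝ) with hτ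
    have hτ1 : 1 ≤ τ := Real.one_le_rpow (by linarith) (by norm_num)
    have hτ0 : 0 < τ := by linarith
    set v := τ⁻¹ with hv
    have hv0 : 0 < v := by positivity
    have hv1 : v ≤ 1 := inv_le_one_of_one_le₀ hτ1
    have hvτ : v * τ = 1 := inv_mul_cancel₀ hτ0.ne'
    have right : ∀ x : ℝ, θ * v ^ 5 ≤ x → x ≤ 1 →
        2 * D * θ * v ^ 4 ≤ ‖riemannZeta (1 + x + Complex.I * w₀.im)‖ := by
      intro x hx hx1
      have hx0 : 0 < x := lt_of_lt_of_le (by positivity) hx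
      have h := norm_riemannZeta_product_ge_one hx0 w₀.im
      have hb1 := hpole x hx0 hx1
      have hb2 : ‖riemannZeta (1 + x + 2 * Complex.I * w₀.im)‖ ≤ 2 * C * τ := by
        have hre : (1 + x + 2 * Complex.I * w₀.im : ℂ).re = 1 + x := by simp
        have him : (1 + x + 2 * Complex.I * w₀.im : ℂ).im = 2 * w₀.im := by simp
        refine (hz _ (by rw [hre]; linarith) (by rw [hre]; linarith) ?_).trans ?_
        · rw [him, abs_mul]; simp; linarith
        · rw [him, abs_mul, abs_two]
          calc C * (2 * |w₀.im|) ^ (1 / 20 : ℝ) ≤ C * (2 * τ) := by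
                gcongr; exact two_mul_rpow_le _ (abs_nonneg _)
            _ = _ := by ring
      set Z := ‖riemannZeta (1 + x + Complex.I * w₀.im)‖ with hZ
      have h4 : 1 ≤ (C₀ / x) ^ 3 * Z ^ 4 * (2 * C * τ) :=
        h.trans (by gcongr)
      have h5 : x ^ 3 ≤ A * τ * Z ^ 4 := by
        have e : (C₀ / x) ^ 3 * Z ^ 4 * (2 * C * τ) = (A * τ * Z ^ 4) / x ^ 3 := by
          rw [hA]; field_simp
        rwa [e, one_le_div (by positivity)] at h4
      have h6 : (θ * v ^ 5) ^ 3 ≤ A * τ * Z ^ 4 := (by gcongr : (θ * v ^ 5) ^ 3 ≤ x ^ 3).trans h5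
      have h7 : (2 * D * θ * v ^ 4) ^ 4 ≤ Z ^ 4 := by
        have e1 : (2 * D * θ * v ^ 4) ^ 4 * A = θ ^ 3 * v ^ 16 * (θ * (16 * D ^ 4 * A)) := by ring
        have e2 : θ ^ 3 * v ^ 16 ≤ A * Z ^ 4 := by
          calc θ ^ 3 * v ^ 16 = (θ * v ^ 5) ^ 3 * v := by ring
            _ ≤ A * τ * Z ^ 4 * v := by gcongr
            _ = A * Z ^ 4 * (v * τ) := by ring
            _ = A * Z ^ 4 := by rw [hvτ, mul_one]
        have e3 : (2 * D * θ * v ^ 4) ^ 4 * A ≤ Z ^ 4 * A := by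
          rw [e1]
          calc _ ≤ θ ^ 3 * v ^ 16 * 1 := by gcongr
            _ ≤ _ := by linarith
        exact le_of_mul_le_mul_right e3 hA0
      exact le_of_pow_le_pow_left₀ (by norm_num) (norm_nonneg _) h7
    rcases le_or_gt (1 + θ * v ^ 5) w₀.re with hr | hr
    · have h := right (w₀.re - 1) (by linarith) (by linarith)
      have e : (1 + ((w₀.re - 1 : ℝ) : ℂ) + Complex.I * w₀.im : ℂ) = w₀ := by
        apply Complex.ext <;> simp
      rw [e] at h
      have : 0 ≤ D * θ * v ^ 4 := by positivity
      linarith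
    · have hv5 : v ^ 5 ≤ 1 := pow_le_one₀ hv0.le hv1
      have hκ : θ * v ^ 5 ≤ 1 / 80 := by nlinarith
      have h := right (θ * v ^ 5) le_rfl (by linarith)
      set w := (1 + ((θ * v ^ 5 : ℝ) : ℂ) + Complex.I * w₀.im : ℂ) with hw
      have hd : ‖w - w₀‖ ≤ θ * v ^ 5 := by
        have e : w - w₀ = ((1 + θ * v ^ 5 - w₀.re : ℝ) : ℂ) := by
          apply Complex.ext <;> simp [hw]
        rw [e, Complex.norm_real, Real.norm_eq_abs, abs_of_nonneg (by linarith)]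
        linarith
      have h8 := hlip w₀ h1 h2 h3 w (mem_closedBall_iff_norm.mpr (hd.trans hκ))
      have h9 : D * τ * ‖w - w₀‖ ≤ D * θ * v ^ 4 := by
        calc D * τ * ‖w - w₀‖ ≤ D * τ * (θ * v ^ 5) := by gcongr
          _ = D * θ * v ^ 4 * (v * τ) := by ring
          _ = _ := by rw [hvτ, mul_one]
      have h10 := norm_sub_norm_le (riemannZeta w) (riemannZeta w₀)
      have : 2 * D * θ * v ^ 4 = 2 * (D * θ * v ^ 4) := by ring
      linarith
  -- Halving θ makes the second Lipschitz step cost only half of the bound `low`.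
  refine ⟨D * θ / 2, θ / 2, by positivity, by positivity, by linarith, fun w₀ h1 h2 h3 w hw => ?_⟩
  have hl := low w₀ h1 h2 h3
  set τ := |w₀.im| ^ (1 / 20 : ℝ) with hτ
  have hτ1 : 1 ≤ τ := Real.one_le_rpow (by linarith) (by norm_num)
  have hτ0 : 0 < τ := by linarith
  set v := τ⁻¹ with hv
  have hv0 : 0 < v := by positivity
  have hv1 : v ≤ 1 := inv_le_one_of_one_le₀ hτ1
  have hvτ : v * τ = 1 := inv_mul_cancel₀ hτ0.ne'
  have hv5 : v ^ 5 ≤ 1 := pow_le_one₀ hv0.le hv1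
  rw [mem_closedBall_iff_norm] at hw
  have hκ : θ / 2 * v ^ 5 ≤ 1 / 80 := by nlinarith
  have h8 := hlip w₀ h1 h2 h3 w (mem_closedBall_iff_norm.mpr (hw.trans hκ))
  have h9 : D * τ * ‖w - w₀‖ ≤ D * θ / 2 * v ^ 4 := by
    calc D * τ * ‖w - w₀‖ ≤ D * τ * (θ / 2 * v ^ 5) := by gcongr
      _ = D * θ / 2 * v ^ 4 * (v * τ) := by ring
      _ = _ := by rw [hvτ, mul_one]
  have h10 := norm_sub_norm_le (riemannZeta w₀) (riemannZeta w)
  rw [norm_sub_rev] at h10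
  have : D * θ * v ^ 4 = 2 * (D * θ / 2 * v ^ 4) := by ring
  linarith

end

/-! ### Decay of 1/(s²ζ(1+s)) − 1/(s(s+1)) and of its derivatives up to Re s = 0. -/

section

open Filter Topology

theorem differentiableAt_invZetaReg {s : ℂ} (h : 1 + s * zetaReg s ≠ 0) (h1 : s + 1 ≠ 0) :
    DifferentiableAt ℂ invZetaReg s := by
  have hd : DifferentiableAt ℂ zetaReg s := differentiable_zetaReg s
  unfold invZetaReg
  exact DifferentiableAt.div (by fun_prop) (by fun_prop) (mul_ne_zero h h1)

theorem isOpen_invZetaReg_domain : IsOpen {s : ℂ | 1 + s * zetaReg s ≠ 0 ∧ s + 1 ≠ 0} := by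
  have hc : Continuous zetaReg := differentiable_zetaReg.continuous
  exact (isOpen_ne.preimage (by fun_prop : Continuous fun s : ℂ => 1 + s * zetaReg s)).inter
    (isOpen_ne.preimage (by fun_prop : Continuous fun s : ℂ => s + 1))

theorem mem_invZetaReg_domain {s : ℂ} (hs : 0 ≤ s.re) :
    s ∈ {s : ℂ | 1 + s * zetaReg s ≠ 0 ∧ s + 1 ≠ 0} := by
  refine ⟨one_add_mul_zetaReg_ne_zero hs, fun h => ?_⟩
  have := congrArg Complex.re h
  simp at this
  linarith

theorem analyticAt_invZetaReg {s : ℂ} (hs : 0 ≤ s.re) : AnalyticAt ℂ invZetaReg s := by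
  have : DifferentiableOn ℂ invZetaReg {s : ℂ | 1 + s * zetaReg s ≠ 0 ∧ s + 1 ≠ 0} :=
    fun z hz => (differentiableAt_invZetaReg hz.1 hz.2).differentiableWithinAt
  exact this.analyticAt (isOpen_invZetaReg_domain.mem_nhds (mem_invZetaReg_domain hs))

/-- Let τ = t^(1/20). On a disk of radius θτ⁻⁵ about s, which may reach beyond Re s = 0, the
function is O(τ⁴/t²). Each derivative costs τ⁵ by Cauchy, so two give τ¹⁴/t² = t^(-13/10), which is
integrable. -/
theorem norm_iteratedDeriv_invZetaReg_le_of_three_le : ∃ C : ℝ, 0 < C ∧ ∀ k ≤ 2, ∀ s : ℂ,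
    0 ≤ s.re → s.re ≤ 1 → 3 ≤ |s.im| →
    ‖iteratedDeriv k invZetaReg s‖ ≤ C * |s.im| ^ (-(13 / 10) : ℝ) := by
  obtain ⟨c, θ, hc, hθ, hθ1, hlow⟩ := le_norm_riemannZeta
  refine ⟨2 * (4 / c + 4) / θ ^ 2, by positivity, fun k hk s h0 h1 h3 => ?_⟩
  set t := |s.im| with ht
  have ht0 : 0 < t := by linarith
  set τ := t ^ (1 / 20 : ℝ) with hτ
  have hτ1 : 1 ≤ τ := Real.one_le_rpow (by linarith) (by norm_num)
  have hτ0 : 0 < τ := by linarith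
  have hv1 : τ⁻¹ ≤ 1 := inv_le_one_of_one_le₀ hτ1
  have hv5 : τ⁻¹ ^ 5 ≤ 1 := pow_le_one₀ (by positivity) hv1
  set r := θ * τ⁻¹ ^ 5 with hr
  have hr0 : 0 < r := by positivity
  have hr1 : r ≤ 1 / 80 := by
    exact (mul_le_of_le_one_right hθ.le hv5).trans hθ1
  have key : ∀ z ∈ Metric.closedBall s r, z ≠ 0 ∧ z + 1 ≠ 0 ∧ riemannZeta (1 + z) ≠ 0 ∧
      ‖invZetaReg z‖ ≤ (4 / c + 4) * (τ ^ 4 / t ^ 2) := by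
    intro z hz
    have hzn := mem_closedBall_iff_norm.mp hz
    have him : |z.im - s.im| ≤ 1 / 80 := (Complex.abs_im_le_norm (z - s)).trans (hzn.trans hr1)
    have i1 : t / 2 ≤ |z.im| := by
      have := abs_sub_abs_le_abs_sub s.im z.im
      rw [abs_sub_comm] at him
      linarith
    have n1 : t / 2 ≤ ‖z‖ := i1.trans (Complex.abs_im_le_norm z)
    have n2 : t / 2 ≤ ‖z + 1‖ := by
      have := Complex.abs_im_le_norm (z + 1)
      simp at this
      linarith
    have hz0 : z ≠ 0 := norm_pos_iff.mp (by linarith)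
    have hz1 : z + 1 ≠ 0 := norm_pos_iff.mp (by linarith)
    have hw := hlow (1 + s) (by simpa) (by simp; linarith) (by simpa [← ht]) (1 + z) (by
      rw [mem_closedBall_iff_norm]
      rw [show 1 + z - (1 + s) = z - s by ring, Complex.add_im, Complex.one_im, zero_add]
      exact hzn)
    simp only [Complex.add_im, Complex.one_im, zero_add, ← ht, ← hτ] at hw
    have hζ : 0 < ‖riemannZeta (1 + z)‖ := lt_of_lt_of_le (by positivity) hw
    have hζ0 := norm_pos_iff.mp hζ
    refine ⟨hz0, hz1, hζ0, ?_⟩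
    rw [invZetaReg_eq hz0 hz1 hζ0]
    have a1 : ‖1 / (z ^ 2 * riemannZeta (1 + z))‖ ≤ 4 / c * (τ ^ 4 / t ^ 2) := by
      rw [norm_div, norm_one, norm_mul, norm_pow]
      calc 1 / (‖z‖ ^ 2 * ‖riemannZeta (1 + z)‖) ≤ 1 / ((t / 2) ^ 2 * (c * τ⁻¹ ^ 4)) := by
            gcongr
        _ = _ := by field_simp; norm_num
    have a2 : ‖1 / (z * (z + 1))‖ ≤ 4 * (τ ^ 4 / t ^ 2) := by
      rw [norm_div, norm_one, norm_mul]
      calc 1 / (‖z‖ * ‖z + 1‖) ≤ 1 / ((t / 2) * (t / 2)) := by gcongr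
        _ = 4 * (1 / t ^ 2) := by field_simp; norm_num
        _ ≤ _ := by
          gcongr
          exact one_le_pow₀ hτ1
    calc _ ≤ _ := norm_sub_le _ _
      _ ≤ _ := add_le_add a1 a2
      _ = _ := by ring
  have hcauchy := Complex.norm_iteratedDeriv_le_of_forall_mem_sphere_norm_le (c := s) (R := r)
    (f := invZetaReg) (C := (4 / c + 4) * (τ ^ 4 / t ^ 2)) k hr0 (by
      refine DifferentiableOn.diffContOnCl (s := Metric.ball s r) fun y hy => ?_
      rw [closure_ball s hr0.ne'] at hy
      obtain ⟨y0, y1, y2, -⟩ := key y hy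
      refine (differentiableAt_invZetaReg ?_ y1).differentiableWithinAt
      rw [mul_zetaReg y0]
      exact mul_ne_zero y0 y2) fun z hz => (key z (Metric.sphere_subset_closedBall hz)).2.2.2
  refine hcauchy.trans ?_
  have hfac : (k.factorial : ℝ) ≤ 2 := by interval_cases k <;> norm_num [Nat.factorial]
  have hrk : r ^ 2 ≤ r ^ k := pow_le_pow_of_le_one hr0.le (by linarith) hk
  have hτ14 : τ ^ 14 / t ^ 2 = t ^ (-(13 / 10) : ℝ) := by
    rw [hτ, ← Real.rpow_natCast, ← Real.rpow_mul ht0.le, ← Real.rpow_natCast, ← Real.rpow_sub ht0]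
    norm_num
  calc k.factorial * ((4 / c + 4) * (τ ^ 4 / t ^ 2)) / r ^ k
      ≤ 2 * ((4 / c + 4) * (τ ^ 4 / t ^ 2)) / r ^ 2 := by gcongr
    _ = 2 * (4 / c + 4) / θ ^ 2 * (τ ^ 14 / t ^ 2) := by
      rw [hr]; field_simp
    _ = _ := by rw [hτ14]

theorem norm_iteratedDeriv_invZetaReg_le : ∃ C : ℝ, 0 < C ∧ ∀ k ≤ 2, ∀ s : ℂ,
    0 ≤ s.re → s.re ≤ 1 →
    ‖iteratedDeriv k invZetaReg s‖ ≤ C * (1 + |s.im|) ^ (-(13 / 10) : ℝ) := by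
  obtain ⟨C, hC, hlarge⟩ := norm_iteratedDeriv_invZetaReg_le_of_three_le
  have small : ∀ k : ℕ, ∃ B : ℝ, ∀ s ∈ Set.Icc (0 : ℝ) 1 ×ℂ Set.Icc (-3 : ℝ) 3,
      ‖iteratedDeriv k invZetaReg s‖ ≤ B := by
    intro k
    refine (isCompact_Icc.reProdIm isCompact_Icc).exists_bound_of_continuousOn fun s hs => ?_
    have : AnalyticAt ℂ (iteratedDeriv k invZetaReg) s := by
      rw [iteratedDeriv_eq_iterate]
      exact (analyticAt_invZetaReg hs.1.1).iterated_deriv k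
    exact this.continuousAt.continuousWithinAt
  choose B hB using small
  set B' := max (max (B 0) (B 1)) (max (B 2) 0) with hB'
  have hB'0 : 0 ≤ B' := (le_max_right _ _).trans (le_max_right _ _)
  have hBk : ∀ k ≤ 2, B k ≤ B' := by
    intro k hk
    interval_cases k
    · exact (le_max_left _ _).trans (le_max_left _ _)
    · exact (le_max_right _ _).trans (le_max_left _ _)
    · exact (le_max_left _ _).trans (le_max_right _ _)
  refine ⟨(B' + C) * 4 ^ (13 / 10 : ℝ), by positivity, fun k hk s h0 h1 => ?_⟩
  rcases le_or_gt |s.im| 3 with h | h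
  · have : ‖iteratedDeriv k invZetaReg s‖ ≤ B' := by
      refine (hB k s ?_).trans (hBk k hk)
      exact ⟨⟨h0, h1⟩, abs_le.mp h⟩
    have h4 : (4 : ℝ) ^ (-(13 / 10) : ℝ) ≤ (1 + |s.im|) ^ (-(13 / 10) : ℝ) :=
      Real.rpow_le_rpow_of_nonpos (by positivity) (by linarith) (by norm_num)
    calc _ ≤ B' * (4 ^ (13 / 10 : ℝ) * (4 : ℝ) ^ (-(13 / 10) : ℝ)) := by
          rw [← Real.rpow_add (by norm_num)]; simpa
      _ ≤ (B' + C) * (4 ^ (13 / 10 : ℝ) * (1 + |s.im|) ^ (-(13 / 10) : ℝ)) := by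
          gcongr; linarith
      _ = _ := by ring
  · have h2 := hlarge k hk s h0 h1 h.le
    have h3 : |s.im| ^ (-(13 / 10) : ℝ) ≤ 4 ^ (13 / 10 : ℝ) * (1 + |s.im|) ^ (-(13 / 10) : ℝ) := by
      have h4 : 1 + |s.im| ≤ 4 * |s.im| := by linarith
      rw [Real.rpow_neg (by positivity), Real.rpow_neg (by positivity), ← div_eq_mul_inv,
        le_div_iff₀ (by positivity), inv_mul_le_iff₀ (by positivity), mul_comm,
        ← Real.mul_rpow (by norm_num) (by positivity)]
      gcongr
    calc _ ≤ C * (4 ^ (13 / 10 : ℝ) * (1 + |s.im|) ^ (-(13 / 10) : ℝ)) := h2.trans (by gcongr)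
      _ ≤ (B' + C) * (4 ^ (13 / 10 : ℝ) * (1 + |s.im|) ^ (-(13 / 10) : ℝ)) := by
          gcongr; linarith
      _ = _ := by ring

end

/-! ### Laplace transform of the logarithmically weighted Möbius sum. -/

section

open Filter Topology MeasureTheory

theorem tendsto_mul_cexp_neg {s : ℂ} (hs : 0 < s.re) :
    Tendsto (fun u : ℝ => -((u : ℂ) / s + 1 / s ^ 2) * Complex.exp (-s * u)) atTop (𝓝 0) := by
  have h1 : Tendsto (fun u : ℝ => (u : ℂ) * Complex.exp (-s * u)) atTop (𝓝 0) := by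
    rw [tendsto_zero_iff_norm_tendsto_zero]
    have := (tendsto_rpow_mul_exp_neg_mul_atTop_nhds_zero 1 s.re hs)
    refine this.congr' ?_
    filter_upwards [eventually_ge_atTop 0] with u hu
    simp [Complex.norm_exp, abs_of_nonneg hu]
  have h2 : Tendsto (fun u : ℝ => Complex.exp (-s * u)) atTop (𝓝 0) := by
    rw [tendsto_zero_iff_norm_tendsto_zero]
    have := (tendsto_rpow_mul_exp_neg_mul_atTop_nhds_zero 0 s.re hs)
    refine this.congr fun u => ?_
    simp [Complex.norm_exp]
  have := ((h1.const_mul (1 / s)).add (h2.const_mul (1 / s ^ 2))).neg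
  simp only [mul_zero, add_zero, neg_zero] at this
  refine this.congr fun u => ?_
  ring

theorem integral_mul_cexp_neg_Ioi {s : ℂ} (hs : 0 < s.re) :
    IntegrableOn (fun u : ℝ => (u : ℂ) * Complex.exp (-s * u)) (Set.Ioi 0) ∧
      ∫ u in Set.Ioi (0 : ℝ), (u : ℂ) * Complex.exp (-s * u) = 1 / s ^ 2 := by
  have hint := integrableOn_rpow_mul_exp_neg_mul_rpow (p := 1) (s := 1) (b := s.re)
    (by norm_num) (by norm_num) hs
  have hs0 : s ≠ 0 := by rintro rfl; simp at hs
  have hI : IntegrableOn (fun u : ℝ => (u : ℂ) * Complex.exp (-s * u)) (Set.Ioi 0) := by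
    refine (integrable_norm_iff ?_).mp ?_
    · exact (by fun_prop : Continuous fun u : ℝ => (u : ℂ) * Complex.exp (-s * u)).aestronglyMeasurable
    · refine hint.congr_fun (fun u hu => ?_) measurableSet_Ioi
      have hu0 : 0 < u := hu
      simp [Complex.norm_exp, abs_of_pos hu0]
  refine ⟨hI, ?_⟩
  have hderiv : ∀ u ∈ Set.Ici (0 : ℝ), HasDerivAt
      (fun u : ℝ => -((u : ℂ) / s + 1 / s ^ 2) * Complex.exp (-s * u))
      ((u : ℂ) * Complex.exp (-s * u)) u := by
    intro u _
    have h0 := Complex.ofRealCLM.hasDerivAt (x := u)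
    have h1 := (((h0.div_const s).add_const (1 / s ^ 2)).neg).mul ((h0.const_mul (-s)).cexp)
    refine h1.congr_deriv ?_
    simp
    field_simp
    ring
  have := integral_Ioi_of_hasDerivAt_of_tendsto' hderiv hI (tendsto_mul_cexp_neg hs)
  rw [this]
  simp

theorem laplace_ramp {s : ℂ} (hs : 0 < s.re) (L : ℝ) :
    Integrable (fun u : ℝ => ((max (u - L) 0 : ℝ) : ℂ) * Complex.exp (-s * u)) ∧
      ∫ u : ℝ, ((max (u - L) 0 : ℝ) : ℂ) * Complex.exp (-s * u) = Complex.exp (-s * L) / s ^ 2 := by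
  obtain ⟨hI, hv⟩ := integral_mul_cexp_neg_Ioi hs
  set f : ℝ → ℂ := (Set.Ioi (0 : ℝ)).indicator fun u : ℝ => (u : ℂ) * Complex.exp (-s * u) with hf
  have hfi : Integrable f := (integrable_indicator_iff measurableSet_Ioi).mpr hI
  have hfv : ∫ u, f u = 1 / s ^ 2 := by rw [hf, integral_indicator measurableSet_Ioi, hv]
  have e : (fun u : ℝ => ((max (u - L) 0 : ℝ) : ℂ) * Complex.exp (-s * u)) =
      fun u => Complex.exp (-s * L) * f (u - L) := by
    ext u
    by_cases hu : 0 < u - L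
    · have hm : u - L ∈ Set.Ioi (0 : ℝ) := hu
      rw [hf, Set.indicator_of_mem hm, max_eq_left hu.le, mul_left_comm, ← Complex.exp_add]
      push_cast
      ring_nf
    · have hm : u - L ∉ Set.Ioi (0 : ℝ) := hu
      rw [hf, Set.indicator_of_notMem hm, max_eq_right (not_lt.mp hu)]
      simp
  rw [e]
  refine ⟨(hfi.comp_sub_right L).const_mul _, ?_⟩
  rw [integral_const_mul, integral_sub_right_eq_self f L, hfv]
  ring

/-- The comparison function is 1 − e^(-u) and not 1: its transform has the same pole at 0 as
1/(s²ζ(1+s)), but decays like s⁻² on vertical lines, whereas 1/s is not integrable there. -/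
theorem laplace_one_sub_exp {s : ℂ} (hs : 0 < s.re) :
    Integrable (fun u : ℝ => ((1 - Real.exp (-max u 0) : ℝ) : ℂ) * Complex.exp (-s * u)) ∧
      ∫ u : ℝ, ((1 - Real.exp (-max u 0) : ℝ) : ℂ) * Complex.exp (-s * u) = 1 / (s * (s + 1)) := by
  have hs0 : s ≠ 0 := by rintro rfl; simp at hs
  have hs1 : s + 1 ≠ 0 := by
    intro h
    have := congrArg Complex.re h
    simp at this
    linarith
  have i1 := integrableOn_exp_mul_complex_Ioi (a := -s) (by simpa) 0
  have i2 := integrableOn_exp_mul_complex_Ioi (a := -(s + 1)) (by simp; linarith) 0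
  have v1 := integral_exp_mul_complex_Ioi (a := -s) (by simpa) 0
  have v2 := integral_exp_mul_complex_Ioi (a := -(s + 1)) (by simp; linarith) 0
  have e : (fun u : ℝ => ((1 - Real.exp (-max u 0) : ℝ) : ℂ) * Complex.exp (-s * u)) =
      (Set.Ioi (0 : ℝ)).indicator fun u : ℝ =>
        Complex.exp (-s * u) - Complex.exp (-(s + 1) * u) := by
    ext u
    by_cases hu : 0 < u
    · have hm : u ∈ Set.Ioi (0 : ℝ) := hu
      rw [Set.indicator_of_mem hm, max_eq_left hu.le]
      push_cast
      rw [sub_mul, ← Complex.exp_add]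
      ring_nf
    · have hm : u ∉ Set.Ioi (0 : ℝ) := hu
      rw [Set.indicator_of_notMem hm, max_eq_right (not_lt.mp hu)]
      simp
  rw [e, integrable_indicator_iff measurableSet_Ioi, integral_indicator measurableSet_Ioi]
  refine ⟨i1.sub i2, ?_⟩
  rw [integral_sub i1 i2, v1, v2]
  simp only [Complex.ofReal_zero, mul_zero, Complex.exp_zero]
  field_simp
  ring

/-- The sum `∑ μ(m) / m * log⁺ (x / m)` as a function of `u = log x`. -/
noncomputable def moebiusLogSum (u : ℝ) : ℝ :=
  ∑' m : ℕ, (ArithmeticFunction.moebius m : ℝ) / m * max (u - Real.log m) 0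

theorem abs_moebius_le_one_real (m : ℕ) : |(ArithmeticFunction.moebius m : ℝ)| ≤ 1 := by
  exact_mod_cast ArithmeticFunction.abs_moebius_le_one (n := m)

/-- From 1 + y ≤ e^y with y = δ(u − log m) one gets log⁺(e^u/m) ≤ (e^u/m)^δ/δ. This dominates the
series by a convergent one and lets the sum grow no faster than any e^(δu). -/
theorem moebiusLogSum_term_le {δ : ℝ} (hδ : 0 < δ) (m : ℕ) (u : ℝ) :
    |(ArithmeticFunction.moebius m : ℝ) / m * max (u - Real.log m) 0| ≤
      Real.exp (δ * u) * (1 / δ * (m : ℝ) ^ (-1 - δ)) := by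
  rcases Nat.eq_zero_or_pos m with rfl | hm
  · simp
    positivity
  have hm0 : (0 : ℝ) < m := by exact_mod_cast hm
  rw [abs_mul, abs_div, Nat.abs_cast, abs_of_nonneg (le_max_right (u - Real.log m) 0)]
  have h1 : max (u - Real.log m) 0 ≤ 1 / δ * (Real.exp (δ * u) * (m : ℝ) ^ (-δ)) := by
    refine max_le ?_ (by positivity)
    rw [Real.rpow_def_of_pos hm0, ← Real.exp_add, one_div, ← div_eq_inv_mul, le_div_iff₀ hδ]
    have := Real.add_one_le_exp (δ * u + Real.log m * -δ)
    linarith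
  calc |(ArithmeticFunction.moebius m : ℝ)| / m * max (u - Real.log m) 0
      ≤ 1 / m * (1 / δ * (Real.exp (δ * u) * (m : ℝ) ^ (-δ))) := by
        gcongr
        exact abs_moebius_le_one_real m
    _ = Real.exp (δ * u) * (1 / δ * ((m : ℝ) ^ (-1 : ℝ) * (m : ℝ) ^ (-δ))) := by
        rw [Real.rpow_neg_one]; ring
    _ = _ := by rw [← Real.rpow_add hm0]; ring_nf

theorem summable_rpow_neg_one_sub {δ : ℝ} (hδ : 0 < δ) :
    Summable fun m : ℕ => 1 / δ * (m : ℝ) ^ (-1 - δ) :=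
  (Real.summable_nat_rpow.mpr (by linarith)).mul_left _

theorem abs_moebiusLogSum_le {δ : ℝ} (hδ : 0 < δ) (u : ℝ) :
    |moebiusLogSum u| ≤ Real.exp (δ * u) * ∑' m : ℕ, 1 / δ * (m : ℝ) ^ (-1 - δ) := by
  rw [← tsum_mul_left, ← Real.norm_eq_abs, moebiusLogSum]
  exact tsum_of_norm_bounded ((summable_rpow_neg_one_sub hδ).mul_left _).hasSum
    fun m => moebiusLogSum_term_le hδ m u

theorem continuous_moebiusLogSum : Continuous moebiusLogSum := by
  -- The factor e^(-u) makes the majorant independent of u, as the M-test requires.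
  have h : Continuous fun u : ℝ => ∑' m : ℕ, Real.exp (-(1 * u)) *
      ((ArithmeticFunction.moebius m : ℝ) / m * max (u - Real.log m) 0) := by
    refine continuous_tsum (fun m => by fun_prop) (summable_rpow_neg_one_sub one_pos) fun m u => ?_
    rw [norm_mul, Real.norm_eq_abs, Real.abs_exp, Real.exp_neg, inv_mul_le_iff₀ (Real.exp_pos _)]
    exact moebiusLogSum_term_le one_pos m u
  have e : moebiusLogSum = fun u => Real.exp (1 * u) * ∑' m : ℕ, Real.exp (-(1 * u)) *
      ((ArithmeticFunction.moebius m : ℝ) / m * max (u - Real.log m) 0) := by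
    ext u
    rw [tsum_mul_left, ← mul_assoc, ← Real.exp_add]
    simp [moebiusLogSum]
  rw [e]
  fun_prop

theorem moebiusLogSum_of_nonpos {u : ℝ} (hu : u ≤ 0) : moebiusLogSum u = 0 := by
  unfold moebiusLogSum
  convert tsum_zero with m
  have : 0 ≤ Real.log m := Real.log_natCast_nonneg m
  rw [max_eq_right (by linarith), mul_zero]

theorem integrable_moebiusLogSum {s : ℂ} (hs : 0 < s.re) :
    Integrable fun u : ℝ => (moebiusLogSum u : ℂ) * Complex.exp (-s * u) := by
  set δ := s.re / 2 with hδ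
  have hδ0 : 0 < δ := by positivity
  set S := ∑' m : ℕ, 1 / δ * (m : ℝ) ^ (-1 - δ) with hS
  have hi := (integrableOn_exp_mul_Ioi (a := -δ) (by linarith) 0).const_mul S
  have hi2 := (integrable_indicator_iff measurableSet_Ioi).mpr hi
  have hc := continuous_moebiusLogSum
  refine hi2.mono' (by fun_prop) (Eventually.of_forall fun u => ?_)
  by_cases hu : 0 < u
  · have hm : u ∈ Set.Ioi (0 : ℝ) := hu
    rw [Set.indicator_of_mem hm, norm_mul, Complex.norm_real, Complex.norm_exp, Real.norm_eq_abs]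
    have h1 := abs_moebiusLogSum_le hδ0 u
    have h2 : (-s * (u : ℂ)).re = -(2 * δ) * u := by
      simp only [hδ, Complex.mul_re, Complex.neg_re, Complex.ofReal_re, Complex.ofReal_im]
      ring
    rw [h2]
    calc |moebiusLogSum u| * Real.exp (-(2 * δ) * u)
        ≤ Real.exp (δ * u) * S * Real.exp (-(2 * δ) * u) := by gcongr
      _ = S * (Real.exp (δ * u) * Real.exp (-(2 * δ) * u)) := by ring
      _ = _ := by rw [← Real.exp_add]; ring_nf
  · have hm : u ∉ Set.Ioi (0 : ℝ) := hu
    rw [Set.indicator_of_notMem hm, moebiusLogSum_of_nonpos (not_lt.mp hu)]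
    simp

/-- Termwise integration, justified by ∫‖F m‖ ≤ m^(-1-σ)/σ² with σ = Re s. The m-th ramp has
transform m^(-s)/s², and ∑ μ(m) m^(-1-s) = 1/ζ(1+s). -/
theorem laplace_moebiusLogSum {s : ℂ} (hs : 0 < s.re) :
    ∫ u : ℝ, (moebiusLogSum u : ℂ) * Complex.exp (-s * u) = 1 / (s ^ 2 * riemannZeta (1 + s)) := by
  set F : ℕ → ℝ → ℂ := fun m u => ((ArithmeticFunction.moebius m : ℂ) / m) *
    (((max (u - Real.log m) 0 : ℝ) : ℂ) * Complex.exp (-s * u)) with hF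
  have hσ : 0 < (s.re : ℂ).re := by simpa
  have hFi : ∀ m, Integrable (F m) := fun m => (laplace_ramp hs (Real.log m)).1.const_mul _
  have hFv : ∀ m, ∫ u, F m u = ((ArithmeticFunction.moebius m : ℂ) / m) *
      (Complex.exp (-s * Real.log m) / s ^ 2) := by
    intro m
    rw [hF, integral_const_mul, (laplace_ramp hs (Real.log m)).2]
  have hnorm : ∀ m, ∫ u, ‖F m u‖ ≤ (m : ℝ) ^ (-1 - s.re) / s.re ^ 2 := by
    intro m
    rcases Nat.eq_zero_or_pos m with rfl | hm
    · simp [hF]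
      positivity
    have hm0 : (0 : ℝ) < m := by exact_mod_cast hm
    have e1 : ∀ u : ℝ, ‖((max (u - Real.log m) 0 : ℝ) : ℂ) * Complex.exp (-s * u)‖ =
        max (u - Real.log m) 0 * Real.exp (-s.re * u) := by
      intro u
      rw [norm_mul, Complex.norm_real, Complex.norm_exp, Real.norm_of_nonneg (le_max_right _ _)]
      simp
    have e2 : ∫ u : ℝ, max (u - Real.log m) 0 * Real.exp (-s.re * u) =
        (m : ℝ) ^ (-s.re) / s.re ^ 2 := by
      have := (laplace_ramp hσ (Real.log m)).2
      have e3 : ∀ u : ℝ, ((max (u - Real.log m) 0 : ℝ) : ℂ) * Complex.exp (-(s.re : ℂ) * u) =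
          ((max (u - Real.log m) 0 * Real.exp (-s.re * u) : ℝ) : ℂ) := by
        intro u; push_cast; rfl
      simp_rw [e3] at this
      rw [integral_complex_ofReal] at this
      have h4 : Complex.exp (-(s.re : ℂ) * Real.log m) / (s.re : ℂ) ^ 2 =
          ((Real.exp (-s.re * Real.log m) / s.re ^ 2 : ℝ) : ℂ) := by push_cast; rfl
      rw [h4] at this
      rw [Complex.ofReal_injective this, Real.rpow_def_of_pos hm0, mul_comm]
    simp only [hF, norm_mul (_ / _ : ℂ)]
    rw [integral_const_mul]
    simp_rw [e1]
    rw [e2, Real.rpow_sub hm0, Real.rpow_neg hm0.le, Real.rpow_neg hm0.le, Real.rpow_one]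
    have : ‖(ArithmeticFunction.moebius m : ℂ) / m‖ ≤ (m : ℝ)⁻¹ := by
      rw [norm_div, Complex.norm_natCast, Complex.norm_intCast, inv_eq_one_div]
      gcongr
      exact abs_moebius_le_one_real m
    calc _ ≤ (m : ℝ)⁻¹ * (((m : ℝ) ^ s.re)⁻¹ / s.re ^ 2) := by gcongr
      _ = _ := by field_simp
  have hsum : Summable fun m => ∫ u, ‖F m u‖ :=
    Summable.of_nonneg_of_le (fun m => integral_nonneg fun u => norm_nonneg _) hnorm
      ((Real.summable_nat_rpow.mpr (by linarith)).div_const _)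
  have key := (hasSum_integral_of_summable_integral_norm hFi hsum).tsum_eq
  have e : ∀ u : ℝ, ∑' m, F m u = (moebiusLogSum u : ℂ) * Complex.exp (-s * u) := by
    intro u
    rw [moebiusLogSum, Complex.ofReal_tsum, ← tsum_mul_right]
    refine tsum_congr fun m => ?_
    simp only [hF]
    push_cast
    ring
  simp_rw [e] at key
  rw [← key]
  simp_rw [hFv]
  have hs1 : 1 < (1 + s).re := by simpa
  have hL := LSeries_one_mul_Lseries_moebius hs1
  rw [LSeries_one_eq_riemannZeta hs1] at hL
  have hζ : riemannZeta (1 + s) ≠ 0 := left_ne_zero_of_mul_eq_one hL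
  have hs0 : s ≠ 0 := by rintro rfl; simp at hs
  have : ∀ m : ℕ, ((ArithmeticFunction.moebius m : ℂ) / m) * (Complex.exp (-s * Real.log m) / s ^ 2) =
      LSeries.term (fun n => (ArithmeticFunction.moebius n : ℂ)) (1 + s) m * (1 / s ^ 2) := by
    intro m
    rcases Nat.eq_zero_or_pos m with rfl | hm
    · simp
    have hm0 : (m : ℂ) ≠ 0 := by exact_mod_cast hm.ne'
    rw [LSeries.term_of_ne_zero hm.ne', Complex.cpow_add _ _ hm0, Complex.cpow_one,
      Complex.cpow_def_of_ne_zero hm0, Complex.natCast_log, neg_mul, Complex.exp_neg, mul_comm s]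
    field_simp
  simp_rw [this]
  rw [tsum_mul_right]
  change LSeries _ (1 + s) * _ = _
  rw [eq_div_iff (mul_ne_zero (pow_ne_zero 2 hs0) hζ)]
  calc _ = (riemannZeta (1 + s) * LSeries (fun n => (ArithmeticFunction.moebius n : ℂ)) (1 + s)) *
        (1 / s ^ 2 * s ^ 2) := by ring
    _ = 1 := by rw [hL, one_mul]; field_simp

/-- The difference of `∑ μ(m) / m * log⁺ (x / m)` and `1 - 1 / x`, as a function of `u = log x`. -/
noncomputable def moebiusLogErr (u : ℝ) : ℝ := moebiusLogSum u - (1 - Real.exp (-max u 0))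

theorem continuous_moebiusLogErr : Continuous moebiusLogErr := by
  have := continuous_moebiusLogSum
  unfold moebiusLogErr
  fun_prop

theorem laplace_moebiusLogErr {s : ℂ} (hs : 0 < s.re) :
    Integrable (fun u : ℝ => (moebiusLogErr u : ℂ) * Complex.exp (-s * u)) ∧
      ∫ u : ℝ, (moebiusLogErr u : ℂ) * Complex.exp (-s * u) = invZetaReg s := by
  have i1 := integrable_moebiusLogSum hs
  obtain ⟨i2, v2⟩ := laplace_one_sub_exp hs
  have e : ∀ u : ℝ, (moebiusLogErr u : ℂ) * Complex.exp (-s * u) =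
    (moebiusLogSum u : ℂ) * Complex.exp (-s * u) -
      ((1 - Real.exp (-max u 0) : ℝ) : ℂ) * Complex.exp (-s * u) := by
    intro u
    rw [moebiusLogErr, Complex.ofReal_sub, sub_mul]
  simp_rw [e]
  refine ⟨i1.sub i2, ?_⟩
  have hs0 : s ≠ 0 := by rintro rfl; simp at hs
  rw [integral_sub i1 i2, laplace_moebiusLogSum hs, v2, invZetaReg_eq hs0]
  · exact (mem_invZetaReg_domain hs.le).2
  · exact riemannZeta_ne_zero_of_one_le_re (by simpa using hs.le)

end

/-! ### Fourier inversion: the Möbius sum is 1 + O((1 + u)⁻²). -/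

section

open Filter Topology MeasureTheory FourierTransform

theorem hasDerivAt_comp_vertical {f : ℂ → ℂ} {f' : ℂ} (σ ξ : ℝ)
    (hf : HasDerivAt f f' (σ + 2 * Real.pi * ξ * Complex.I)) :
    HasDerivAt (fun ξ : ℝ => f (σ + 2 * Real.pi * ξ * Complex.I)) (2 * Real.pi * Complex.I * f') ξ := by
  have h : HasDerivAt (fun ξ : ℝ => ((σ : ℂ) + 2 * Real.pi * ξ * Complex.I))
      (2 * Real.pi * Complex.I) ξ := by
    have h0 := Complex.ofRealCLM.hasDerivAt (x := ξ)
    refine (((h0.const_mul (2 * Real.pi : ℂ)).mul_const Complex.I).const_add (σ : ℂ)).congr_deriv ?_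
    simp
  exact (hf.comp ξ h).congr_deriv (by ring)

/-- On Re s = σ the Laplace transform is the Fourier transform of the error damped by e^(-σu). Two
integrable derivatives of the transform give decay u⁻². The bound does not depend on σ, so σ → 0⁺
can be taken afterwards. -/
theorem exists_bound_sq_mul_moebiusLogErr_mul_exp : ∃ B : ℝ, ∀ σ : ℝ, 0 < σ → σ ≤ 1 → ∀ u : ℝ,
    u ^ 2 * (|moebiusLogErr u| * Real.exp (-σ * u)) ≤ B := by
  obtain ⟨C, hC, hbound⟩ := norm_iteratedDeriv_invZetaReg_le
  have hJ : Integrable fun ξ : ℝ => (1 + ‖ξ‖) ^ (-(13 / 10) : ℝ) :=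
    integrable_one_add_norm (by simp; norm_num)
  set J := ∫ ξ : ℝ, (1 + ‖ξ‖) ^ (-(13 / 10) : ℝ) with hJdef
  refine ⟨C * J, fun σ hσ hσ1 u => ?_⟩
  set line : ℝ → ℂ := fun ξ => σ + 2 * Real.pi * ξ * Complex.I with hline
  have hre : ∀ ξ, (line ξ).re = σ := fun ξ => by simp [hline]
  have him : ∀ ξ, (line ξ).im = 2 * Real.pi * ξ := fun ξ => by simp [hline]
  have hbd : ∀ k ≤ 2, ∀ ξ, ‖iteratedDeriv k invZetaReg (line ξ)‖ ≤
      C * (1 + ‖ξ‖) ^ (-(13 / 10) : ℝ) := by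
    intro k hk ξ
    refine (hbound k hk (line ξ) (by rw [hre]; exact hσ.le) (by rw [hre]; exact hσ1)).trans ?_
    gcongr C * ?_
    refine Real.rpow_le_rpow_of_nonpos (by positivity) ?_ (by norm_num)
    rw [him, abs_mul, Real.norm_eq_abs, abs_of_pos (by positivity : 0 < 2 * Real.pi)]
    have : 1 ≤ 2 * Real.pi := by linarith [Real.pi_gt_three]
    nlinarith [abs_nonneg ξ]
  have hder : ∀ k, ∀ ξ : ℝ, HasDerivAt (fun ξ => iteratedDeriv k invZetaReg (line ξ))
      (2 * Real.pi * Complex.I * iteratedDeriv (k + 1) invZetaReg (line ξ)) ξ := by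
    intro k ξ
    refine hasDerivAt_comp_vertical σ ξ ?_
    rw [iteratedDeriv_succ]
    refine DifferentiableAt.hasDerivAt ?_
    rw [iteratedDeriv_eq_iterate]
    exact ((analyticAt_invZetaReg (s := line ξ) (by rw [hre]; exact hσ.le)).iterated_deriv
      k).differentiableAt
  have hcont : ∀ k, Continuous fun ξ => iteratedDeriv k invZetaReg (line ξ) := fun k =>
    continuous_iff_continuousAt.mpr fun ξ => (hder k ξ).continuousAt
  have hint : ∀ k ≤ 2, Integrable fun ξ => iteratedDeriv k invZetaReg (line ξ) := fun k hk =>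
    (hJ.const_mul C).mono' (hcont k).aestronglyMeasurable (Eventually.of_forall (hbd k hk))
  set F : ℝ → ℂ := fun u => (moebiusLogErr u : ℂ) * Complex.exp (-(σ : ℂ) * u) with hF
  have hFi : Integrable F := (laplace_moebiusLogErr (s := σ) (by simpa)).1
  have hFc : Continuous F := by
    have := continuous_moebiusLogErr
    fun_prop
  have hFF : 𝓕 F = fun ξ => iteratedDeriv 0 invZetaReg (line ξ) := by
    ext ξ
    rw [iteratedDeriv_zero, ← (laplace_moebiusLogErr (s := line ξ) (by rw [hre]; exact hσ)).2,
      Real.fourier_real_eq_integral_exp_smul]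
    refine integral_congr_ae (Eventually.of_forall fun v => ?_)
    simp only [hF, hline, smul_eq_mul]
    rw [mul_left_comm, ← Complex.exp_add]
    congr 2
    push_cast
    ring
  have hinv : F u = 𝓕 (𝓕 F) (-u) := by
    rw [← Real.fourierInv_eq_fourier_neg,
      hFc.fourierInv_fourier_eq hFi (by rw [hFF]; exact hint 0 (by norm_num))]
  have d0 : deriv (fun ξ => iteratedDeriv 0 invZetaReg (line ξ)) =
      fun ξ => 2 * Real.pi * Complex.I * iteratedDeriv 1 invZetaReg (line ξ) :=
    funext fun ξ => (hder 0 ξ).deriv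
  have d1 : deriv (fun ξ => 2 * Real.pi * Complex.I * iteratedDeriv 1 invZetaReg (line ξ)) =
      fun ξ => 2 * Real.pi * Complex.I * (2 * Real.pi * Complex.I *
        iteratedDeriv 2 invZetaReg (line ξ)) :=
    funext fun ξ => ((hder 1 ξ).const_mul _).deriv
  -- Each differentiation in ξ multiplies the transform at −u by −2πiu; two of them produce the
  -- weight (2π)²u² in modulus.
  have f0 := congrFun (Real.fourier_deriv (hint 0 (by norm_num))
    (fun ξ => (hder 0 ξ).differentiableAt)
    (by rw [d0]; exact (hint 1 (by norm_num)).const_mul _)) (-u)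
  have f1 := congrFun (Real.fourier_deriv ((hint 1 (by norm_num)).const_mul _)
    (fun ξ => ((hder 1 ξ).const_mul (2 * Real.pi * Complex.I)).differentiableAt)
    (by rw [d1]; exact ((hint 2 le_rfl).const_mul _).const_mul _)) (-u)
  rw [d0] at f0
  rw [d1, f0, ← hFF, ← hinv] at f1
  have hn : ‖𝓕 (fun ξ => 2 * Real.pi * Complex.I * (2 * Real.pi * Complex.I *
        iteratedDeriv 2 invZetaReg (line ξ))) (-u)‖ ≤ (2 * Real.pi) ^ 2 * (C * J) := by
    refine (VectorFourier.norm_fourierIntegral_le_integral_norm _ _ _ _ _).trans ?_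
    rw [hJdef, ← integral_const_mul, ← integral_const_mul]
    refine integral_mono (((hint 2 le_rfl).const_mul _).const_mul _).norm
      ((hJ.const_mul C).const_mul _) fun ξ => ?_
    have h := hbd 2 le_rfl ξ
    simp only [norm_mul, Complex.norm_I, Complex.norm_real, Complex.norm_ofNat,
      Real.norm_of_nonneg Real.pi_pos.le, mul_one]
    calc _ = (2 * Real.pi) ^ 2 * ‖iteratedDeriv 2 invZetaReg (line ξ)‖ := by ring
      _ ≤ _ := by gcongr
  rw [f1] at hn
  simp only [norm_smul, norm_mul, Complex.norm_I, Complex.norm_real, Complex.norm_ofNat, hF,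
      Real.norm_of_nonneg Real.pi_pos.le, mul_one, Complex.norm_exp, Real.norm_eq_abs, abs_neg] at hn
  have h2 : (-(σ : ℂ) * (u : ℂ)).re = -σ * u := by simp
  rw [h2] at hn
  have h3 : (2 * Real.pi) ^ 2 * (u ^ 2 * (|moebiusLogErr u| * Real.exp (-σ * u))) ≤
      (2 * Real.pi) ^ 2 * (C * J) := by
    refine le_trans (le_of_eq ?_) hn
    rw [← sq_abs u]
    ring
  exact le_of_mul_le_mul_left h3 (by positivity)

theorem exists_bound_sq_mul_moebiusLogErr : ∃ B : ℝ, 0 ≤ B ∧ ∀ u : ℝ,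
    u ^ 2 * |moebiusLogErr u| ≤ B := by
  obtain ⟨B, hB⟩ := exists_bound_sq_mul_moebiusLogErr_mul_exp
  have h : ∀ u : ℝ, u ^ 2 * |moebiusLogErr u| ≤ B := by
    intro u
    have hc : Continuous fun σ : ℝ => u ^ 2 * (|moebiusLogErr u| * Real.exp (-σ * u)) := by fun_prop
    have ht : Tendsto (fun σ : ℝ => u ^ 2 * (|moebiusLogErr u| * Real.exp (-σ * u))) (𝓝[>] 0)
        (𝓝 (u ^ 2 * |moebiusLogErr u|)) := by
      have := (hc.tendsto 0).mono_left (nhdsWithin_le_nhds (s := Set.Ioi 0))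
      simpa using this
    refine le_of_tendsto ht ?_
    filter_upwards [Ioc_mem_nhdsGT (zero_lt_one' ℝ)] with σ hσ
    exact hB σ hσ.1 hσ.2 u
  exact ⟨B, le_trans (by positivity) (h 0), h⟩

theorem exists_abs_moebiusLogSum_sub_one_le : ∃ C : ℝ, 0 < C ∧ ∀ u : ℝ, 0 ≤ u →
    |moebiusLogSum u - 1| ≤ C / (1 + u) ^ 2 := by
  obtain ⟨B, hB0, hB⟩ := exists_bound_sq_mul_moebiusLogErr
  obtain ⟨D, hD⟩ := (isCompact_Icc (a := (0 : ℝ)) (b := 1)).exists_bound_of_continuousOn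
    continuous_moebiusLogErr.continuousOn
  have hD0 : 0 ≤ D := (norm_nonneg _).trans (hD 0 (by simp))
  refine ⟨4 * (B + D + 2), by positivity, fun u hu => ?_⟩
  have e : moebiusLogSum u - 1 = moebiusLogErr u - Real.exp (-u) := by
    rw [moebiusLogErr, max_eq_left hu]; ring
  have hexp : Real.exp (-u) * (1 + u) ^ 2 ≤ 4 := by
    rw [Real.exp_neg, inv_mul_le_iff₀ (Real.exp_pos u)]
    nlinarith [Real.quadratic_le_exp_of_nonneg hu]
  rw [le_div_iff₀ (by positivity), e]
  have h1 : |moebiusLogErr u| * (1 + u) ^ 2 ≤ 4 * (B + D) := by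
    rcases le_or_gt u 1 with h | h
    · have := hD u ⟨hu, h⟩
      rw [Real.norm_eq_abs] at this
      have h2 : (1 + u) ^ 2 ≤ 4 := by nlinarith
      nlinarith [abs_nonneg (moebiusLogErr u)]
    · have := hB u
      have h2 : (1 + u) ^ 2 ≤ 4 * u ^ 2 := by nlinarith
      nlinarith [abs_nonneg (moebiusLogErr u)]
  have h2 := abs_sub (moebiusLogErr u) (Real.exp (-u))
  rw [Real.abs_exp] at h2
  have h3 : 0 ≤ (1 + u) ^ 2 := by positivity
  nlinarith

end

/-! ### Removing the coprimality condition from the Möbius sum. -/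

section

open Finset

/-- The indicator function of the positive integers composed of the primes dividing `a`. -/
def radicalIndicator (a : ℕ) : ArithmeticFunction ℤ :=
  ⟨fun n => if n ≠ 0 ∧ n.primeFactors ⊆ a.primeFactors then 1 else 0, by simp⟩

/-- The Möbius function restricted to the integers coprime to `a`. -/
def moebiusCoprime (a : ℕ) : ArithmeticFunction ℤ :=
  ⟨fun n => if n.Coprime a then ArithmeticFunction.moebius n else 0, by simp⟩

theorem radicalIndicator_apply (a n : ℕ) :
    radicalIndicator a n = if n ≠ 0 ∧ n.primeFactors ⊆ a.primeFactors then 1 else 0 := rfl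

theorem moebiusCoprime_apply (a n : ℕ) :
    moebiusCoprime a n = if n.Coprime a then ArithmeticFunction.moebius n else 0 := rfl

theorem isMultiplicative_radicalIndicator (a : ℕ) : (radicalIndicator a).IsMultiplicative := by
  refine ArithmeticFunction.IsMultiplicative.iff_ne_zero.mpr ⟨by simp [radicalIndicator_apply], ?_⟩
  intro m n hm hn _
  simp only [radicalIndicator_apply, Nat.primeFactors_mul hm hn, Finset.union_subset_iff]
  split_ifs <;> simp_all

theorem isMultiplicative_moebiusCoprime (a : ℕ) : (moebiusCoprime a).IsMultiplicative := by
  refine ArithmeticFunction.IsMultiplicative.iff_ne_zero.mpr ⟨by simp [moebiusCoprime_apply], ?_⟩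
  intro m n hm hn h
  simp only [moebiusCoprime_apply, Nat.coprime_mul_iff_left,
    ArithmeticFunction.isMultiplicative_moebius.map_mul_of_coprime h]
  split_ifs <;> simp_all

/-- In Euler factors: the product of 1 − p^(-s) over p ∤ a, times ζ(s), leaves exactly the factors
of ζ at p ∣ a. Both sides are multiplicative, so prime powers suffice. -/
theorem moebiusCoprime_mul_zeta {a : ℕ} (ha : a ≠ 0) :
    moebiusCoprime a * (ArithmeticFunction.zeta : ArithmeticFunction ℤ) = radicalIndicator a := by
  refine ((ArithmeticFunction.IsMultiplicative.eq_iff_eq_on_prime_powers _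
    ((isMultiplicative_moebiusCoprime a).mul
      ArithmeticFunction.isMultiplicative_zeta.natCast) _
    (isMultiplicative_radicalIndicator a)).mpr ?_)
  intro p k hp
  rw [ArithmeticFunction.coe_mul_zeta_apply, Nat.sum_divisors_prime_pow hp]
  rcases k with _ | k
  · simp [radicalIndicator_apply, moebiusCoprime_apply]
  rw [Finset.sum_range_succ', Finset.sum_range_succ']
  have hz : ∑ i ∈ Finset.range k, moebiusCoprime a (p ^ (i + 1 + 1)) = 0 := by
    refine Finset.sum_eq_zero fun i _ => ?_
    rw [moebiusCoprime_apply, ArithmeticFunction.moebius_apply_prime_pow hp (by omega)]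
    simp
  rw [hz]
  simp only [radicalIndicator_apply, moebiusCoprime_apply, Nat.primeFactors_prime_pow (Nat.succ_ne_zero k) hp,
    zero_add, pow_one, pow_zero, ArithmeticFunction.moebius_apply_prime hp]
  by_cases hpa : p ∣ a
  · have h1 : ¬ p.Coprime a := by rwa [hp.coprime_iff_not_dvd, not_not]
    have h2 : p ∈ a.primeFactors := by simp [hp, hpa, ha]
    simp [h1, h2, hp.ne_zero]
  · have h1 : p.Coprime a := by rwa [hp.coprime_iff_not_dvd]
    have h2 : p ∉ a.primeFactors := by simp [hpa]
    simp only [Nat.coprime_one_left_eq_true, if_true, if_pos h1]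
    simp [h2]

theorem radicalIndicator_mul_moebius {a : ℕ} (ha : a ≠ 0) :
    radicalIndicator a * ArithmeticFunction.moebius = moebiusCoprime a := by
  rw [← moebiusCoprime_mul_zeta ha, mul_assoc, ArithmeticFunction.coe_zeta_mul_moebius, mul_one]

theorem sum_Ioc_divisorsAntidiagonal {M : Type*} [AddCommMonoid M] (f : ℕ → ℕ → M) (N : ℕ) :
    ∑ n ∈ Ioc 0 N, ∑ x ∈ n.divisorsAntidiagonal, f x.1 x.2 =
      ∑ b ∈ Ioc 0 N, ∑ m ∈ Ioc 0 (N / b), f b m := by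
  rw [Finset.sum_sigma', Finset.sum_sigma']
  refine Finset.sum_bij' (fun x _ => ⟨x.2.1, x.2.2⟩) (fun y _ => ⟨y.1 * y.2, (y.1, y.2)⟩) ?_ ?_ ?_ ?_ ?_
  · rintro ⟨n, b, m⟩ h
    simp only [mem_sigma, mem_Ioc, Nat.mem_divisorsAntidiagonal] at h ⊢
    obtain ⟨⟨h0, hN⟩, rfl, -⟩ := h
    have hb : 0 < b := Nat.pos_of_mul_pos_right h0
    have hm : 0 < m := Nat.pos_of_mul_pos_left h0
    refine ⟨⟨hb, (Nat.le_mul_of_pos_right b hm).trans hN⟩, hm, ?_⟩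
    rw [Nat.le_div_iff_mul_le hb, mul_comm]
    exact hN
  · rintro ⟨b, m⟩ h
    simp only [mem_sigma, mem_Ioc, Nat.mem_divisorsAntidiagonal] at h ⊢
    obtain ⟨⟨hb, -⟩, hm, hle⟩ := h
    rw [Nat.le_div_iff_mul_le hb, mul_comm] at hle
    exact ⟨⟨Nat.mul_pos hb hm, hle⟩, trivial, (Nat.mul_pos hb hm).ne'⟩
  · rintro ⟨n, b, m⟩ h
    simp only [mem_sigma, mem_Ioc, Nat.mem_divisorsAntidiagonal] at h
    obtain ⟨-, rfl, -⟩ := h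
    rfl
  · rintro ⟨b, m⟩ _
    rfl
  · rintro ⟨n, b, m⟩ _
    rfl

/-- The sum of `μ(m) / m * log (x / m)` over the integers `m ≤ x` coprime to `a`. -/
noncomputable def moebiusLogSumCoprime (a : ℕ) (x : ℝ) : ℝ :=
  ∑ m ∈ Ioc 0 ⌊x⌋₊, (moebiusCoprime a m : ℝ) / m * Real.log (x / m)

theorem moebiusCoprime_one : moebiusCoprime 1 = ArithmeticFunction.moebius := by
  ext n
  simp [moebiusCoprime_apply]

theorem moebiusLogSumCoprime_eq (a : ℕ) {x : ℝ} (hx : 0 < x) {N : ℕ} (hN : ⌊x⌋₊ ≤ N) :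
    moebiusLogSumCoprime a x =
      ∑ m ∈ Ioc 0 N, (moebiusCoprime a m : ℝ) / m * max (Real.log (x / m)) 0 := by
  rw [moebiusLogSumCoprime]
  have e : ∀ m ∈ Ioc 0 ⌊x⌋₊, (moebiusCoprime a m : ℝ) / m * Real.log (x / m) =
      (moebiusCoprime a m : ℝ) / m * max (Real.log (x / m)) 0 := by
    intro m hm
    rw [mem_Ioc] at hm
    have hm0 : (0 : ℝ) < m := by exact_mod_cast hm.1
    have hmx : (m : ℝ) ≤ x := (Nat.le_floor_iff hx.le).mp hm.2
    rw [max_eq_left (Real.log_nonneg ((one_le_div hm0).mpr hmx))]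
  rw [Finset.sum_congr rfl e]
  refine Finset.sum_subset (Finset.Ioc_subset_Ioc_right hN) fun m hm hm' => ?_
  rw [mem_Ioc] at hm hm'
  have hm0 : (0 : ℝ) < m := by exact_mod_cast hm.1
  have hmx : x < m := (Nat.floor_lt hx.le).mp (by omega)
  rw [max_eq_right (Real.log_nonpos (by positivity) ((div_le_one hm0).mpr hmx.le)), mul_zero]

theorem moebiusLogSumCoprime_one {x : ℝ} (hx : 0 < x) :
    moebiusLogSumCoprime 1 x = moebiusLogSum (Real.log x) := by
  have h : ∀ m ∉ Ioc 0 ⌊x⌋₊,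
      (ArithmeticFunction.moebius m : ℝ) / m * max (Real.log x - Real.log m) 0 = 0 := by
    intro m hm
    rcases Nat.eq_zero_or_pos m with rfl | hm0
    · simp
    · have hmx : x < m := (Nat.floor_lt hx.le).mp (by rw [mem_Ioc] at hm; omega)
      rw [max_eq_right (by linarith [Real.log_le_log hx hmx.le]), mul_zero]
  rw [moebiusLogSum, tsum_eq_sum h, moebiusLogSumCoprime_eq 1 hx le_rfl, moebiusCoprime_one]
  refine Finset.sum_congr rfl fun m hm => ?_
  have hm0 : (m : ℝ) ≠ 0 := by
    rw [mem_Ioc] at hm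
    exact_mod_cast hm.1.ne'
  rw [Real.log_div hx.ne' hm0]

/-- The coprime Möbius function is the Dirichlet convolution of `radicalIndicator a` with μ;
grouping by the first factor b leaves the unrestricted sum at x/b. -/
theorem moebiusLogSumCoprime_eq_sum {a : ℕ} (ha : a ≠ 0) (x : ℝ) :
    moebiusLogSumCoprime a x = ∑ b ∈ Ioc 0 ⌊x⌋₊ with b.primeFactors ⊆ a.primeFactors,
      1 / (b : ℝ) * moebiusLogSumCoprime 1 (x / b) := by
  have h1 : ∀ n ∈ Ioc 0 ⌊x⌋₊, (moebiusCoprime a n : ℝ) / n * Real.log (x / n) =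
      ∑ y ∈ n.divisorsAntidiagonal, (radicalIndicator a y.1 : ℝ) / y.1 *
        ((ArithmeticFunction.moebius y.2 : ℝ) / y.2 * Real.log (x / y.1 / y.2)) := by
    intro n _
    rw [← radicalIndicator_mul_moebius ha, ArithmeticFunction.mul_apply, Int.cast_sum, Finset.sum_div,
      Finset.sum_mul]
    refine Finset.sum_congr rfl fun y hy => ?_
    obtain ⟨rfl, -⟩ := Nat.mem_divisorsAntidiagonal.mp hy
    push_cast
    rw [div_div]
    ring
  rw [moebiusLogSumCoprime, Finset.sum_congr rfl h1,
    sum_Ioc_divisorsAntidiagonal (fun b m => (radicalIndicator a b : ℝ) / b *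
        ((ArithmeticFunction.moebius m : ℝ) / m * Real.log (x / b / m))), Finset.sum_filter]
  refine Finset.sum_congr rfl fun b hb => ?_
  have hb0 : b ≠ 0 := by rw [mem_Ioc] at hb; omega
  rw [← Finset.mul_sum, radicalIndicator_apply, moebiusLogSumCoprime, moebiusCoprime_one,
    Nat.floor_div_natCast]
  split_ifs <;> simp_all

/-- The sum of `1 / b` over the integers `b ≤ x` composed of the primes dividing `a`, with
weights `g`. -/
noncomputable def radicalSum (a : ℕ) (g : ℕ → ℝ) (x : ℝ) : ℝ :=
  ∑ b ∈ Ioc 0 ⌊x⌋₊ with b.primeFactors ⊆ a.primeFactors, 1 / (b : ℝ) * g b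

theorem exists_abs_moebiusLogSumCoprime_sub_le : ∃ C : ℝ, 0 < C ∧ ∀ a : ℕ, a ≠ 0 → ∀ x : ℝ, 0 < x →
    |moebiusLogSumCoprime a x - radicalSum a 1 x| ≤
      radicalSum a (fun b => C / (1 + Real.log (x / b)) ^ 2) x := by
  obtain ⟨C, hC, h⟩ := exists_abs_moebiusLogSum_sub_one_le
  refine ⟨C, hC, fun a ha x hx => ?_⟩
  rw [moebiusLogSumCoprime_eq_sum ha x, radicalSum, radicalSum, ← Finset.sum_sub_distrib]
  refine (Finset.abs_sum_le_sum_abs _ _).trans (Finset.sum_le_sum fun b hb => ?_)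
  rw [mem_filter, mem_Ioc] at hb
  have hb0 : (0 : ℝ) < b := by exact_mod_cast hb.1.1
  have hbx : (b : ℝ) ≤ x := (Nat.le_floor_iff hx.le).mp hb.1.2
  rw [Pi.one_apply, ← mul_sub, abs_mul, abs_of_pos (by positivity : 0 < 1 / (b : ℝ)),
    moebiusLogSumCoprime_one (by positivity)]
  gcongr
  exact h _ (Real.log_nonneg ((one_le_div hb0).mpr hbx))

theorem radicalSum_mono {a : ℕ} {f g : ℕ → ℝ} {x : ℝ} (hx : 0 ≤ x)
    (h : ∀ b : ℕ, 0 < b → (b : ℝ) ≤ x → f b ≤ g b) : radicalSum a f x ≤ radicalSum a g x := by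
  refine Finset.sum_le_sum fun b hb => ?_
  rw [mem_filter, mem_Ioc] at hb
  gcongr
  exact h b hb.1.1 ((Nat.le_floor_iff hx).mp hb.1.2)

theorem radicalSum_nonneg {a : ℕ} {g : ℕ → ℝ} {x : ℝ} (hx : 0 ≤ x)
    (h : ∀ b : ℕ, 0 < b → (b : ℝ) ≤ x → 0 ≤ g b) : 0 ≤ radicalSum a g x := by
  have := radicalSum_mono (a := a) (f := 0) hx h
  simpa [radicalSum] using this

/-- The Euler product over p ∣ a of (1 − 1/p)⁻¹. -/
theorem hasSum_radical_inv {a : ℕ} (ha : a ≠ 0) :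
    HasSum (fun b : Nat.factoredNumbers a.primeFactors => ((b : ℕ) : ℝ)⁻¹)
      ((a : ℝ) / Nat.totient a) := by
  let f : ℕ →* ℝ := { toFun := fun n => (n : ℝ)⁻¹, map_one' := by simp, map_mul' := fun m n => (by
    push_cast; exact mul_inv _ _) }
  have h := (EulerProduct.summable_and_hasSum_factoredNumbers_prod_filter_prime_geometric (f := f)
    (fun {p} hp => by
      have : (1 : ℝ) < p := by exact_mod_cast hp.one_lt
      change ‖(p : ℝ)⁻¹‖ < 1
      rw [Real.norm_of_nonneg (by positivity)]
      exact inv_lt_one_of_one_lt₀ this) a.primeFactors).2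
  have ht : (Nat.totient a : ℝ) = a * ∏ p ∈ a.primeFactors, (1 - (p : ℝ)⁻¹) := by
    have := congrArg (fun q : ℚ => (q : ℝ)) (Nat.totient_eq_mul_prod_factors a)
    push_cast at this
    exact this
  have hval : ∏ p ∈ a.primeFactors with p.Prime, (1 - f p)⁻¹ = (a : ℝ) / Nat.totient a := by
    rw [Finset.filter_true_of_mem fun p hp => Nat.prime_of_mem_primeFactors hp, ht,
      Finset.prod_inv_distrib]
    change (∏ p ∈ a.primeFactors, (1 - (p : ℝ)⁻¹))⁻¹ = _
    have ha' : (a : ℝ) ≠ 0 := by exact_mod_cast ha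
    rw [div_mul_eq_div_div, div_self ha', one_div]
  rw [hval] at h
  exact h

theorem radicalSum_one_le {a : ℕ} (ha : a ≠ 0) (x : ℝ) :
    radicalSum a 1 x ≤ (a : ℝ) / Nat.totient a := by
  have h := hasSum_radical_inv ha
  set s := (Ioc 0 ⌊x⌋₊).filter fun b => b.primeFactors ⊆ a.primeFactors with hs
  have hmem : ∀ b ∈ s, b ∈ Nat.factoredNumbers a.primeFactors := by
    intro b hb
    rw [hs, mem_filter, mem_Ioc] at hb
    exact Nat.mem_factoredNumbers_of_primeFactors_subset hb.1.1.ne' hb.2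
  let e : s ↪ Nat.factoredNumbers a.primeFactors := ⟨fun b => ⟨b.1, hmem b.1 b.2⟩,
    fun b c hbc => Subtype.ext (congrArg
      (fun y : Nat.factoredNumbers a.primeFactors => (y : ℕ)) hbc)⟩
  have h2 := sum_le_hasSum (s.attach.map e) (fun b _ => by positivity) h
  rw [Finset.sum_map] at h2
  change ∑ b ∈ s.attach, ((b : ℕ) : ℝ)⁻¹ ≤ _ at h2
  rw [Finset.sum_attach s (fun b => (b : ℝ)⁻¹)] at h2
  simpa [radicalSum, hs] using h2

end

/-! ### Harmonic sums over products d·b with d squarefree and b composed of primes of d. -/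

section

open Finset

/-- The squarefree factor is the radical of the product, so the product determines both factors. -/
theorem eq_of_mul_eq_mul_of_primeFactors_subset {d d' b b' : ℕ} (hd : Squarefree d)
    (hd' : Squarefree d') (hb : b ≠ 0) (hb' : b' ≠ 0) (h : b.primeFactors ⊆ d.primeFactors)
    (h' : b'.primeFactors ⊆ d'.primeFactors) (e : d * b = d' * b') : d = d' ∧ b = b' := by
  have e1 := congrArg Nat.primeFactors e
  rw [Nat.primeFactors_mul hd.ne_zero hb, Nat.primeFactors_mul hd'.ne_zero hb',
    Finset.union_eq_left.mpr h, Finset.union_eq_left.mpr h'] at e1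
  have e2 : d = d' := by
    rw [← Nat.prod_primeFactors_of_squarefree hd, ← Nat.prod_primeFactors_of_squarefree hd', e1]
  subst e2
  exact ⟨rfl, Nat.eq_of_mul_eq_mul_left (Nat.pos_of_ne_zero hd.ne_zero) e⟩

theorem sum_squarefree_radicalSum_le {R : ℝ} {g : ℕ → ℝ} (hg : ∀ n : ℕ, 0 < n → (n : ℝ) ≤ R → 0 ≤ g n)
    (hR : 0 ≤ R) :
    ∑ d ∈ Ioc 0 ⌊R⌋₊ with Squarefree d, 1 / (d : ℝ) * radicalSum d (fun b => g (d * b)) (R / d) ≤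
      ∑ n ∈ Ioc 0 ⌊R⌋₊, 1 / (n : ℝ) * g n := by
  set N := ⌊R⌋₊ with hN
  set S : Finset (Σ _ : ℕ, ℕ) := ((Ioc 0 N).filter Squarefree).sigma fun d =>
    (Ioc 0 (N / d)).filter fun b => b.primeFactors ⊆ d.primeFactors with hS
  have e : ∑ d ∈ Ioc 0 N with Squarefree d, 1 / (d : ℝ) * radicalSum d (fun b => g (d * b)) (R / d) =
      ∑ x ∈ S, 1 / ((x.1 * x.2 : ℕ) : ℝ) * g (x.1 * x.2) := by
    rw [hS, Finset.sum_sigma]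
    refine Finset.sum_congr rfl fun d _ => ?_
    rw [radicalSum, Nat.floor_div_natCast, Finset.mul_sum]
    refine Finset.sum_congr rfl fun b _ => ?_
    push_cast
    rw [← one_div_mul_one_div]
    ring
  have hinj : Set.InjOn (fun x : Σ _ : ℕ, ℕ => x.1 * x.2) S := by
    rintro ⟨d, b⟩ h ⟨d', b'⟩ h' hxy
    simp only [hS, coe_sigma, Set.mem_sigma_iff, mem_coe, mem_filter, mem_Ioc] at h h'
    obtain ⟨rfl, rfl⟩ := eq_of_mul_eq_mul_of_primeFactors_subset h.1.2 h'.1.2 (by omega) (by omega)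
      h.2.2 h'.2.2 hxy
    rfl
  rw [e, ← Finset.sum_image (f := fun n : ℕ => 1 / (n : ℝ) * g n) hinj]
  refine Finset.sum_le_sum_of_subset_of_nonneg ?_ fun n hn _ => ?_
  · intro n hn
    obtain ⟨⟨d, b⟩, h, rfl⟩ := mem_image.mp hn
    simp only [hS, mem_sigma, mem_filter, mem_Ioc] at h
    obtain ⟨⟨⟨hd, -⟩, -⟩, ⟨hb, hle⟩, -⟩ := h
    rw [Nat.le_div_iff_mul_le hd, mul_comm] at hle
    exact mem_Ioc.mpr ⟨Nat.mul_pos hd hb, hle⟩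
  · rw [mem_Ioc] at hn
    exact mul_nonneg (by positivity) (hg n hn.1 ((Nat.le_floor_iff hR).mp hn.2))

theorem sum_Ioc_one_div_le (N : ℕ) : ∑ n ∈ Ioc 0 N, 1 / (n : ℝ) ≤ 1 + Real.log N := by
  have := harmonic_le_one_add_log N
  rw [harmonic_eq_sum_Icc] at this
  push_cast at this
  simpa [← Finset.Icc_add_one_left_eq_Ioc] using this

theorem sum_Ioc_one_div_le_one_add_log {R : ℝ} (hR : 1 ≤ R) :
    ∑ n ∈ Ioc 0 ⌊R⌋₊, 1 / (n : ℝ) ≤ 1 + Real.log R := by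
  refine (sum_Ioc_one_div_le _).trans ?_
  gcongr
  · exact_mod_cast Nat.floor_pos.mpr hR
  · exact Nat.floor_le (by linarith)

theorem sum_Ioc_one_div_le_log_sub_log {a b : ℕ} (ha : 0 < a) (hab : a ≤ b) :
    ∑ n ∈ Ioc a b, 1 / (n : ℝ) ≤ Real.log b - Real.log a := by
  induction b, hab using Nat.le_induction with
  | base => simp
  | succ b hb ih =>
    rw [← Finset.insert_Ioc_right_eq_Ioc_add_one hb, Finset.sum_insert (by simp)]
    have hb0 : (0 : ℝ) < b := by exact_mod_cast lt_of_lt_of_le ha hb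
    have h := Real.one_sub_inv_le_log_of_pos (x := ((b : ℝ) + 1) / b) (by positivity)
    rw [Real.log_div (by positivity) hb0.ne', inv_div] at h
    have e : 1 - (b : ℝ) / (b + 1) = 1 / (b + 1) := by field_simp; ring
    push_cast
    rw [e] at h
    linarith

/-- Uniform in N: if ⌊N/k⌋ > 0 then N ≤ 2k⌊N/k⌋, and the 1 absorbs log 2; otherwise N < k and the
whole harmonic sum is at most 1 + log k. -/
theorem sum_Ioc_div_one_div_le (N : ℕ) {k : ℕ} (hk : 0 < k) :
    ∑ n ∈ Ioc (N / k) N, 1 / (n : ℝ) ≤ 1 + Real.log k := by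
  have hk0 : (0 : ℝ) < k := by exact_mod_cast hk
  rcases Nat.eq_zero_or_pos (N / k) with h | h
  · rw [h]
    rcases Nat.eq_zero_or_pos N with rfl | hN
    · simp
      linarith [Real.log_natCast_nonneg k]
    refine (sum_Ioc_one_div_le N).trans ?_
    have hNk : N < k := (Nat.div_eq_zero_iff.mp h).resolve_left (by omega)
    gcongr
  · have hN : 0 < N := Nat.pos_of_ne_zero fun h0 => by simp [h0] at h
    have hM0 : (0 : ℝ) < ((N / k : ℕ) : ℝ) := by exact_mod_cast h
    refine (sum_Ioc_one_div_le_log_sub_log h (Nat.div_le_self N k)).trans ?_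
    have h1 : (N : ℝ) ≤ k * 2 * ((N / k : ℕ) : ℝ) := by
      have : N ≤ k * 2 * (N / k) := by
        have := Nat.lt_mul_div_succ N hk
        nlinarith
      exact_mod_cast this
    have h2 := Real.log_le_log (by exact_mod_cast hN) h1
    rw [Real.log_mul (by positivity) (by positivity), Real.log_mul (by positivity) (by norm_num)] at h2
    linarith [Real.log_two_lt_d9]

/-- A discrete form of d/dx (1 + log(R/x))⁻¹ = x⁻¹(1 + log(R/x))⁻², prepared for telescoping. The
factor 2 comes from 1/n ≤ 2/(n+1). -/
theorem one_div_mul_inv_one_add_log_sq_le {n : ℕ} (hn : 0 < n) {R : ℝ} (h : (n : ℝ) + 1 ≤ R) :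
    1 / (n : ℝ) * (1 / (1 + Real.log (R / n)) ^ 2) ≤
      2 * (1 / (1 + Real.log (R / (n + 1))) - 1 / (1 + Real.log (R / n))) := by
  have hn0 : (0 : ℝ) < n := by exact_mod_cast hn
  have hn1 : (1 : ℝ) ≤ n := by exact_mod_cast hn
  have hR : 0 < R := by linarith
  have hl := Real.one_sub_inv_le_log_of_pos (x := ((n : ℝ) + 1) / n) (by positivity)
  have e : 1 - (((n : ℝ) + 1) / n)⁻¹ = 1 / (n + 1) := by field_simp; ring
  rw [Real.log_div (by positivity) hn0.ne', e] at hl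
  rw [Real.log_div hR.ne' hn0.ne', Real.log_div hR.ne' (by positivity)]
  set L := Real.log R - Real.log n
  set L' := Real.log R - Real.log (n + 1)
  have hL' : 0 ≤ L' := sub_nonneg.mpr (Real.log_le_log (by positivity) h)
  have hLL : 1 / ((n : ℝ) + 1) ≤ L - L' := by simp only [L, L']; linarith
  have hpos : 0 < 1 / ((n : ℝ) + 1) := by positivity
  have hL : L' ≤ L := by linarith
  have e2 : 2 * (1 / (1 + L') - 1 / (1 + L)) = 2 * (L - L') * (1 / ((1 + L') * (1 + L))) := by
    have h1 : (1 + L') ≠ 0 := by positivity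
    have h2 : (1 + L) ≠ 0 := by linarith
    field_simp
    ring
  rw [e2]
  have h3 : 1 / (n : ℝ) ≤ 2 * (L - L') := by
    refine le_trans ?_ (mul_le_mul_of_nonneg_left hLL (by norm_num : (0 : ℝ) ≤ 2))
    rw [mul_one_div, div_le_div_iff₀ hn0 (by positivity)]
    linarith
  have h4 : 1 / (1 + L) ^ 2 ≤ 1 / ((1 + L') * (1 + L)) := by
    refine one_div_le_one_div_of_le (by nlinarith) ?_
    rw [sq]
    nlinarith
  have : 0 ≤ L - L' := by linarith
  gcongr

/-- The terms below ⌊R⌋ telescope to at most 2, and the last one is at most 1. This is where the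
square of the logarithm in the error for m_1 is needed: the total stays bounded. -/
theorem sum_Ioc_one_div_mul_inv_log_sq_le {R : ℝ} (hR : 1 ≤ R) :
    ∑ n ∈ Ioc 0 ⌊R⌋₊, 1 / (n : ℝ) * (1 / (1 + Real.log (R / n)) ^ 2) ≤ 3 := by
  have key : ∀ N : ℕ, 0 < N → (N : ℝ) ≤ R →
      ∑ n ∈ Ico 1 N, 1 / (n : ℝ) * (1 / (1 + Real.log (R / n)) ^ 2) ≤
        2 * (1 / (1 + Real.log (R / N))) := by
    intro N hN
    induction N, hN using Nat.le_induction with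
    | base =>
      intro _
      simp
      linarith [Real.log_nonneg hR]
    | succ N hN ih =>
      intro h
      push_cast at h
      rw [Finset.sum_Ico_succ_top hN]
      have h1 := ih (by linarith)
      have h2 := one_div_mul_inv_one_add_log_sq_le hN h
      push_cast
      linarith
  have hN : 0 < ⌊R⌋₊ := Nat.floor_pos.mpr hR
  have hNR : (⌊R⌋₊ : ℝ) ≤ R := Nat.floor_le (by linarith)
  have hN0 : (1 : ℝ) ≤ (⌊R⌋₊ : ℝ) := by exact_mod_cast hN
  have h := key _ hN hNR
  have hl : 0 ≤ Real.log (R / ⌊R⌋₊) := Real.log_nonneg ((one_le_div (by linarith)).mpr hNR)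
  have e : Ioc 0 ⌊R⌋₊ = insert ⌊R⌋₊ (Ico 1 ⌊R⌋₊) := by
    ext n; simp; omega
  rw [e, Finset.sum_insert (by simp)]
  have h1 : 1 / (1 + Real.log (R / ⌊R⌋₊)) ≤ 1 := by
    rw [div_le_one (by linarith)]; linarith
  have h2 : 1 / (⌊R⌋₊ : ℝ) * (1 / (1 + Real.log (R / ⌊R⌋₊)) ^ 2) ≤ 1 := by
    rw [one_div_mul_one_div]
    rw [div_le_one (by positivity)]
    have : 1 ≤ (1 + Real.log (R / ⌊R⌋₊)) ^ 2 := one_le_pow₀ (by linarith)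
    nlinarith
  linarith

theorem exists_sum_sq_mul_one_div_le : ∃ C : ℝ, 0 < C ∧ ∀ N E : ℕ,
    ∑ e ∈ Ioc 0 E, 1 / (e : ℝ) ^ 2 * ∑ a ∈ Ioc (N / e ^ 2) N, 1 / (a : ℝ) ≤ C := by
  have h1 : Summable fun e : ℕ => (e : ℝ) ^ (-2 : ℝ) := Real.summable_nat_rpow.mpr (by norm_num)
  have h2 : Summable fun e : ℕ => 4 * (e : ℝ) ^ (-(3 / 2) : ℝ) :=
    (Real.summable_nat_rpow.mpr (by norm_num)).mul_left 4
  refine ⟨∑' e : ℕ, ((e : ℝ) ^ (-2 : ℝ) + 4 * (e : ℝ) ^ (-(3 / 2) : ℝ)) + 1, ?_, fun N E => ?_⟩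
  · have : 0 ≤ ∑' e : ℕ, ((e : ℝ) ^ (-2 : ℝ) + 4 * (e : ℝ) ^ (-(3 / 2) : ℝ)) :=
      tsum_nonneg fun e => by positivity
    linarith
  refine le_trans ?_ (le_add_of_nonneg_right zero_le_one)
  refine le_trans (Finset.sum_le_sum fun e he => ?_)
    ((h1.add h2).sum_le_tsum (Ioc 0 E) fun e _ => by positivity)
  rw [mem_Ioc] at he
  have he0 : (0 : ℝ) < e := by exact_mod_cast he.1
  have h3 := sum_Ioc_div_one_div_le N (k := e ^ 2) (by positivity [he.1])
  have h4 := Real.log_le_rpow_div he0.le (ε := 1 / 2) (by norm_num)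
  push_cast at h3
  rw [Real.log_pow] at h3
  have e1 : (e : ℝ) ^ (-2 : ℝ) = 1 / (e : ℝ) ^ 2 := by
    rw [Real.rpow_neg he0.le, one_div]; norm_cast
  have e2 : (e : ℝ) ^ (-(3 / 2) : ℝ) = 1 / (e : ℝ) ^ 2 * (e : ℝ) ^ (1 / 2 : ℝ) := by
    rw [← e1, ← Real.rpow_add he0]; norm_num
  rw [e1, e2]
  calc 1 / (e : ℝ) ^ 2 * ∑ a ∈ Ioc (N / e ^ 2) N, 1 / (a : ℝ)
      ≤ 1 / (e : ℝ) ^ 2 * (1 + 4 * (e : ℝ) ^ (1 / 2 : ℝ)) := by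
        gcongr
        refine h3.trans ?_
        push_cast
        linarith
    _ = _ := by ring

/-- Since 1/φ(d) = (1/d)∑ 1/b over b composed of primes of d, the sum equals ∑ 1/n over all n whose
radical is at most N. Those n ≤ N give the logarithm; the others contribute O(1). -/
theorem exists_sum_squarefree_inv_totient_le : ∃ C : ℝ, 0 < C ∧ ∀ N : ℕ,
    ∑ d ∈ Ioc 0 N with Squarefree d, 1 / (Nat.totient d : ℝ) ≤ 1 + Real.log N + C := by
  obtain ⟨C, hC, hC'⟩ := exists_sum_sq_mul_one_div_le
  refine ⟨C, hC, fun N => ?_⟩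
  set D := (Ioc 0 N).filter Squarefree with hD
  have hs : HasSum (fun b : ℕ => ∑ d ∈ D, 1 / (d : ℝ) *
      (Nat.factoredNumbers d.primeFactors).indicator (fun b : ℕ => (b : ℝ)⁻¹) b)
      (∑ d ∈ D, 1 / (Nat.totient d : ℝ)) := by
    refine hasSum_sum fun d hd => ?_
    have hd0 : d ≠ 0 := by
      rw [hD, mem_filter, mem_Ioc] at hd; omega
    have h := (hasSum_subtype_iff_indicator (f := fun b : ℕ => (b : ℝ)⁻¹)).mp (hasSum_radical_inv hd0)
    have hd' : (d : ℝ) ≠ 0 := by exact_mod_cast hd0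
    have e : 1 / (Nat.totient d : ℝ) = 1 / (d : ℝ) * (d / Nat.totient d) := by
      rw [← mul_div_assoc, one_div_mul_cancel hd']
    rw [e]
    exact h.mul_left (1 / (d : ℝ))
  refine hasSum_le_of_sum_le hs fun s => ?_
  -- rewrite as a sum over pairs
  set S : Finset (ℕ × ℕ) := (D ×ˢ s).filter fun x => x.2 ∈ Nat.factoredNumbers x.1.primeFactors with hS
  have e : ∑ b ∈ s, ∑ d ∈ D, 1 / (d : ℝ) *
      (Nat.factoredNumbers d.primeFactors).indicator (fun b : ℕ => (b : ℝ)⁻¹) b =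
      ∑ x ∈ S, 1 / ((x.1 * x.2 : ℕ) : ℝ) := by
    rw [hS, Finset.sum_filter, Finset.sum_product, Finset.sum_comm]
    refine Finset.sum_congr rfl fun d _ => Finset.sum_congr rfl fun b _ => ?_
    rw [Set.indicator_apply]
    split_ifs
    · push_cast; rw [← one_div_mul_one_div, one_div (b : ℝ)]
    · simp
  have hprop : ∀ x ∈ S, 0 < x.1 ∧ x.1 ≤ N ∧ Squarefree x.1 ∧ x.2 ≠ 0 ∧
      x.2.primeFactors ⊆ x.1.primeFactors := by
    intro x hx
    rw [hS, mem_filter, mem_product, hD, mem_filter, mem_Ioc,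
      Nat.mem_factoredNumbers_iff_primeFactors_subset] at hx
    exact ⟨hx.1.1.1.1, hx.1.1.1.2, hx.1.1.2, hx.2.1, hx.2.2⟩
  have hinj : Set.InjOn (fun x : ℕ × ℕ => x.1 * x.2) S := by
    intro x hx y hy hxy
    obtain ⟨-, -, h1, h2, h3⟩ := hprop x hx
    obtain ⟨-, -, h1', h2', h3'⟩ := hprop y hy
    obtain ⟨ha, hb⟩ := eq_of_mul_eq_mul_of_primeFactors_subset h1 h1' h2 h2' h3 h3' hxy
    exact Prod.ext ha hb
  rw [e, ← Finset.sum_image (f := fun n : ℕ => 1 / (n : ℝ)) hinj]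
  set T := S.image fun x : ℕ × ℕ => x.1 * x.2 with hT
  rw [← Finset.sum_filter_add_sum_filter_not T (fun n => n ≤ N)]
  have hTpos : ∀ n ∈ T, 0 < n := by
    intro n hn
    obtain ⟨x, hx, rfl⟩ := mem_image.mp hn
    obtain ⟨h0, -, -, h2, -⟩ := hprop x hx
    exact Nat.mul_pos h0 (Nat.pos_of_ne_zero h2)
  refine add_le_add ?_ ?_
  · refine le_trans (Finset.sum_le_sum_of_subset_of_nonneg ?_ fun _ _ _ => by positivity)
      (sum_Ioc_one_div_le N)
    intro n hn
    rw [mem_filter] at hn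
    exact mem_Ioc.mpr ⟨hTpos n hn.1, hn.2⟩
  -- For n > N write n = e²a with a squarefree. Then a divides the radical of n, so a ≤ N, while a >
  -- N/e². The harmonic mass of such a is O(1 + log e), which is summable against 1/e².
  · have hdec : ∀ n : ℕ, ∃ y : ℕ × ℕ, y.1 ^ 2 * y.2 = n ∧ Squarefree y.2 := by
      intro n
      obtain ⟨a, b, h1, h2⟩ := Nat.sq_mul_squarefree n
      exact ⟨(b, a), h1, h2⟩
    choose y hy1 hy2 using hdec
    set T' := T.filter fun n => ¬ n ≤ N with hT'
    have hyinj : Set.InjOn y T' := by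
      intro m _ n _ hmn
      rw [← hy1 m, ← hy1 n, hmn]
    set E := T'.sup id with hE
    have e2 : ∑ n ∈ T', 1 / (n : ℝ) =
        ∑ z ∈ T'.image y, 1 / (z.1 : ℝ) ^ 2 * (1 / (z.2 : ℝ)) := by
      rw [Finset.sum_image hyinj]
      refine Finset.sum_congr rfl fun n _ => ?_
      rw [one_div_mul_one_div]
      congr 1
      exact_mod_cast (hy1 n).symm
    have e3 : ∑ e ∈ Ioc 0 E, 1 / (e : ℝ) ^ 2 * ∑ a ∈ Ioc (N / e ^ 2) N, 1 / (a : ℝ) =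
        ∑ z ∈ (Ioc 0 E).sigma fun e => Ioc (N / e ^ 2) N, 1 / (z.1 : ℝ) ^ 2 * (1 / (z.2 : ℝ)) := by
      rw [Finset.sum_sigma]
      exact Finset.sum_congr rfl fun e _ => Finset.mul_sum _ _ _
    rw [e2]
    refine le_trans ?_ (hC' N E)
    rw [e3]
    have e4 : ∑ z ∈ T'.image y, 1 / (z.1 : ℝ) ^ 2 * (1 / (z.2 : ℝ)) =
        ∑ z ∈ (T'.image y).map (Equiv.sigmaEquivProd ℕ ℕ).symm.toEmbedding,
          1 / (z.1 : ℝ) ^ 2 * (1 / (z.2 : ℝ)) := by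
      rw [Finset.sum_map]; rfl
    rw [e4]
    refine Finset.sum_le_sum_of_subset_of_nonneg ?_ fun _ _ _ => by positivity
    intro z hz
    rw [Finset.mem_map] at hz
    obtain ⟨w, hw, rfl⟩ := hz
    obtain ⟨n, hn, rfl⟩ := mem_image.mp hw
    have hnT : n ∈ T ∧ ¬ n ≤ N := by rwa [hT', mem_filter] at hn
    have hn0 := hTpos n hnT.1
    have hyn := hy1 n
    have hsq := hy2 n
    have hle : (y n).1 ^ 2 * (y n).2 ≤ E := by
      rw [hyn]; exact Finset.le_sup (f := id) hn
    have hp1 : 0 < (y n).1 := by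
      rcases Nat.eq_zero_or_pos (y n).1 with h | h
      · rw [h] at hyn; simp at hyn; omega
      · exact h
    have hp2 : 0 < (y n).2 := Nat.pos_of_ne_zero hsq.ne_zero
    simp only [mem_sigma, mem_Ioc, Equiv.toEmbedding_apply, Equiv.sigmaEquivProd_symm_apply]
    refine ⟨⟨hp1, ?_⟩, ?_, ?_⟩
    · nlinarith
    · rw [Nat.div_lt_iff_lt_mul (by positivity), mul_comm, hyn]
      omega
    · obtain ⟨x, hx, hxn⟩ := mem_image.mp hnT.1
      obtain ⟨h0, hN, h1, h2, h3⟩ := hprop x hx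
      have hpf : (y n).2.primeFactors ⊆ x.1.primeFactors := by
        have : (y n).2.primeFactors ⊆ n.primeFactors :=
          Nat.primeFactors_mono ⟨_, by rw [mul_comm]; exact hyn.symm⟩ hn0.ne'
        refine this.trans (le_of_eq ?_)
        rw [← hxn, Nat.primeFactors_mul h0.ne' h2, Finset.union_eq_left.mpr h3]
      have hdvd : (y n).2 ∣ x.1 := by
        rw [← Nat.prod_primeFactors_of_squarefree hsq, ← Nat.prod_primeFactors_of_squarefree h1]
        exact Finset.prod_dvd_prod_of_subset _ _ _ hpf
      exact (Nat.le_of_dvd h0 hdvd).trans hN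

end

/-! ### Asymptotics of Selberg's diagonalised quadratic form. -/

section

open Finset

theorem moebius_mul_eq (d m : ℕ) :
    ArithmeticFunction.moebius (d * m) = ArithmeticFunction.moebius d * moebiusCoprime d m := by
  rw [moebiusCoprime_apply]
  split_ifs with h
  · exact ArithmeticFunction.isMultiplicative_moebius.map_mul_of_coprime h.symm
  · rw [mul_zero]
    refine ArithmeticFunction.moebius_eq_zero_of_not_squarefree fun hs => h ?_
    exact (Nat.coprime_of_squarefree_mul hs).symm

theorem moebius_sq_eq (d : ℕ) : (ArithmeticFunction.moebius d : ℝ) ^ 2 = if Squarefree d then 1 else 0 := by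
  have := ArithmeticFunction.moebius_sq (n := d)
  split_ifs with h
  · rw [if_pos h] at this; exact_mod_cast this
  · rw [if_neg h] at this; exact_mod_cast this

/-- The sum over squarefree `d ≤ R` that arises on diagonalising Selberg's quadratic form. -/
noncomputable def diagonalForm (R : ℝ) (f : ℕ → ℝ) : ℝ :=
  ∑ d ∈ Ioc 0 ⌊R⌋₊ with Squarefree d, (Nat.totient d : ℝ) / (d : ℝ) ^ 2 * f d ^ 2

theorem totient_div_sq_mul_le {d : ℕ} (hd : 0 < d) {A : ℝ} (hA : A ≤ d / Nat.totient d) :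
    (Nat.totient d : ℝ) / (d : ℝ) ^ 2 * A ≤ 1 / d := by
  have hd0 : (0 : ℝ) < d := by exact_mod_cast hd
  have hφ : (0 : ℝ) < Nat.totient d := by exact_mod_cast Nat.totient_pos.mpr hd
  calc (Nat.totient d : ℝ) / (d : ℝ) ^ 2 * A
      ≤ (Nat.totient d : ℝ) / (d : ℝ) ^ 2 * (d / Nat.totient d) := by gcongr
    _ = 1 / (d : ℝ) := by field_simp

/-- With n = dm the summand is μ(d)·μ(n)/n·log(R/n), because μ(d)μ(dm) is μ(d)² times the coprime
Möbius function at m. The sum of μ(d) over d ∣ n leaves n = 1 only. -/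
theorem sum_squarefree_mul_moebiusLogSumCoprime {R : ℝ} (hR : 1 ≤ R) :
    ∑ d ∈ Ioc 0 ⌊R⌋₊ with Squarefree d, 1 / (d : ℝ) * moebiusLogSumCoprime d (R / d) =
      Real.log R := by
  have h1 : ∀ d ∈ Ioc 0 ⌊R⌋₊, (if Squarefree d then
      1 / (d : ℝ) * moebiusLogSumCoprime d (R / d) else 0) = ∑ m ∈ Ioc 0 (⌊R⌋₊ / d),
        (ArithmeticFunction.moebius d : ℝ) * ((ArithmeticFunction.moebius (d * m) : ℝ) / (d * m : ℕ) *
          Real.log (R / (d * m : ℕ))) := by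
    intro d _
    have h2 : (if Squarefree d then 1 / (d : ℝ) * moebiusLogSumCoprime d (R / d) else 0) =
        (ArithmeticFunction.moebius d : ℝ) ^ 2 * (1 / (d : ℝ) * moebiusLogSumCoprime d (R / d)) := by
      rw [moebius_sq_eq]; split_ifs <;> simp
    rw [h2, moebiusLogSumCoprime, Nat.floor_div_natCast, Finset.mul_sum, Finset.mul_sum]
    refine Finset.sum_congr rfl fun m _ => ?_
    rw [moebius_mul_eq, div_div]
    push_cast
    rw [div_mul_eq_div_div]
    ring
  rw [Finset.sum_filter, Finset.sum_congr rfl h1,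
    ← sum_Ioc_divisorsAntidiagonal (fun d m => (ArithmeticFunction.moebius d : ℝ) *
      ((ArithmeticFunction.moebius (d * m) : ℝ) / (d * m : ℕ) * Real.log (R / (d * m : ℕ))))]
  have h3 : ∀ n ∈ Ioc 0 ⌊R⌋₊, ∑ x ∈ n.divisorsAntidiagonal, (ArithmeticFunction.moebius x.1 : ℝ) *
      ((ArithmeticFunction.moebius (x.1 * x.2) : ℝ) / (x.1 * x.2 : ℕ) * Real.log (R / (x.1 * x.2 : ℕ))) =
      if n = 1 then Real.log R else 0 := by
    intro n hn
    rw [mem_Ioc] at hn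
    have e : ∀ x ∈ n.divisorsAntidiagonal, (ArithmeticFunction.moebius x.1 : ℝ) *
      ((ArithmeticFunction.moebius (x.1 * x.2) : ℝ) / (x.1 * x.2 : ℕ) * Real.log (R / (x.1 * x.2 : ℕ))) =
      (ArithmeticFunction.moebius x.1 : ℝ) *
        ((ArithmeticFunction.moebius n : ℝ) / n * Real.log (R / n)) := by
      intro x hx
      rw [(Nat.mem_divisorsAntidiagonal.mp hx).1]
    rw [Finset.sum_congr rfl e, ← Finset.sum_mul]
    have hμ : ∑ x ∈ n.divisorsAntidiagonal, (ArithmeticFunction.moebius x.1 : ℝ) =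
        if n = 1 then 1 else 0 := by
      have h := congrArg (fun f : ArithmeticFunction ℤ => f n) ArithmeticFunction.moebius_mul_coe_zeta
      simp only [ArithmeticFunction.mul_apply, ArithmeticFunction.one_apply] at h
      have h' := congrArg (fun z : ℤ => (z : ℝ)) h
      push_cast at h'
      rw [← h']
      refine Finset.sum_congr rfl fun x hx => ?_
      have hx2 : x.2 ≠ 0 := by
        rintro h0
        have := (Nat.mem_divisorsAntidiagonal.mp hx).1
        rw [h0, mul_zero] at this
        omega
      simp [ArithmeticFunction.zeta_apply, hx2]
    rw [hμ]
    split_ifs with h1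
    · subst h1; simp
    · simp
  rw [Finset.sum_congr rfl h3, Finset.sum_ite_eq']
  rw [if_pos]
  rw [mem_Ioc]
  exact ⟨one_pos, Nat.floor_pos.mpr hR⟩

theorem radicalSum_const_mul (a : ℕ) (c : ℝ) (g : ℕ → ℝ) (x : ℝ) :
    radicalSum a (fun b => c * g b) x = c * radicalSum a g x := by
  rw [radicalSum, radicalSum, Finset.mul_sum]
  exact Finset.sum_congr rfl fun b _ => by ring

theorem radicalSum_inv_log_sq_bounds {C : ℝ} (hC : 0 < C) {d : ℕ} {x : ℝ} (hx : 0 ≤ x) :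
    0 ≤ radicalSum d (fun b => C / (1 + Real.log (x / b)) ^ 2) x ∧
      radicalSum d (fun b => C / (1 + Real.log (x / b)) ^ 2) x ≤ C * radicalSum d 1 x := by
  constructor
  · exact radicalSum_nonneg hx fun b hb hbx => by positivity
  · rw [← radicalSum_const_mul]
    refine radicalSum_mono hx fun b hb hbx => ?_
    have hb0 : (0 : ℝ) < b := by exact_mod_cast hb
    have hl : 0 ≤ Real.log (x / b) := Real.log_nonneg ((one_le_div hb0).mpr hbx)
    rw [Pi.one_apply, mul_one]
    exact div_le_self hC.le (one_le_pow₀ (by linarith))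

theorem sum_squarefree_radicalSum_inv_log_sq_le {C : ℝ} (hC : 0 < C) {R : ℝ} (hR : 1 ≤ R) :
    ∑ d ∈ Ioc 0 ⌊R⌋₊ with Squarefree d, 1 / (d : ℝ) *
      radicalSum d (fun b => C / (1 + Real.log (R / d / b)) ^ 2) (R / d) ≤ 3 * C := by
  have h := sum_squarefree_radicalSum_le (R := R) (g := fun n => C / (1 + Real.log (R / n)) ^ 2)
    (fun n hn hnR => by positivity) (by linarith)
  have e : ∀ n ∈ Ioc 0 ⌊R⌋₊, 1 / (n : ℝ) * (C / (1 + Real.log (R / n)) ^ 2) =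
      C * (1 / (n : ℝ) * (1 / (1 + Real.log (R / n)) ^ 2)) := fun n _ => by ring
  rw [Finset.sum_congr rfl e, ← Finset.mul_sum] at h
  have h2 := mul_le_mul_of_nonneg_left (sum_Ioc_one_div_mul_inv_log_sq_le hR) hC.le
  push_cast at h
  simp_rw [div_div]
  linarith

theorem sum_squarefree_radicalSum_one_le {R : ℝ} (hR : 1 ≤ R) :
    ∑ d ∈ Ioc 0 ⌊R⌋₊ with Squarefree d, 1 / (d : ℝ) * radicalSum d 1 (R / d) ≤ 1 + Real.log R := by
  have h := sum_squarefree_radicalSum_le (R := R) (g := 1)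
    (fun n hn hnR => by simp) (by linarith)
  refine h.trans (le_trans (le_of_eq ?_) (sum_Ioc_one_div_le_one_add_log hR))
  simp

/-- Lower bound: expand (m − d/φ(d))² ≥ 0, which reduces the form to 2 log R − ∑ 1/φ(d). Upper
bound: replace m by the radical sum A, use φ(d)/d²·A ≤ 1/d to remove one factor A, and collapse what
remains to sums over n ≤ R. -/
theorem exists_diagonalForm_log_le : ∃ C : ℝ, 0 < C ∧ ∀ R : ℝ, 1 ≤ R →
    |diagonalForm R (fun d => moebiusLogSumCoprime d (R / d)) - Real.log R| ≤ C := by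
  obtain ⟨C, hC, hE⟩ := exists_abs_moebiusLogSumCoprime_sub_le
  obtain ⟨V, hV, hV'⟩ := exists_sum_squarefree_inv_totient_le
  refine ⟨1 + V + (2 + C) * (3 * C), by positivity, fun R hR => abs_le.mpr ⟨?_, ?_⟩⟩
  · have h1 : ∑ d ∈ Ioc 0 ⌊R⌋₊ with Squarefree d, (2 * (1 / (d : ℝ) * moebiusLogSumCoprime d (R / d)) -
        1 / (Nat.totient d : ℝ)) ≤ diagonalForm R (fun d => moebiusLogSumCoprime d (R / d)) := by
      refine Finset.sum_le_sum fun d hd => ?_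
      rw [mem_filter, mem_Ioc] at hd
      have hd0 : (0 : ℝ) < d := by exact_mod_cast hd.1.1
      have hφ : (0 : ℝ) < Nat.totient d := by exact_mod_cast Nat.totient_pos.mpr hd.1.1
      set m := moebiusLogSumCoprime d (R / d)
      have e : (Nat.totient d : ℝ) / (d : ℝ) ^ 2 * m ^ 2 - (2 * (1 / (d : ℝ) * m) -
          1 / (Nat.totient d : ℝ)) = (Nat.totient d : ℝ) / (d : ℝ) ^ 2 * (m - d / Nat.totient d) ^ 2 := by
        field_simp
        ring
      have : 0 ≤ (Nat.totient d : ℝ) / (d : ℝ) ^ 2 * (m - d / Nat.totient d) ^ 2 := by positivity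
      linarith
    rw [Finset.sum_sub_distrib, ← Finset.mul_sum, sum_squarefree_mul_moebiusLogSumCoprime hR] at h1
    have h2 := hV' ⌊R⌋₊
    have h3 : Real.log ⌊R⌋₊ ≤ Real.log R :=
      Real.log_le_log (by exact_mod_cast Nat.floor_pos.mpr hR) (Nat.floor_le (by linarith))
    have : 0 ≤ (2 + C) * (3 * C) := by positivity
    linarith
  · have h1 : diagonalForm R (fun d => moebiusLogSumCoprime d (R / d)) ≤
        ∑ d ∈ Ioc 0 ⌊R⌋₊ with Squarefree d, (1 / (d : ℝ) * radicalSum d 1 (R / d) +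
          (2 + C) * (1 / (d : ℝ) *
            radicalSum d (fun b => C / (1 + Real.log (R / d / b)) ^ 2) (R / d))) := by
      refine Finset.sum_le_sum fun d hd => ?_
      rw [mem_filter, mem_Ioc] at hd
      have hx : 0 < R / d := div_pos (by linarith) (by exact_mod_cast hd.1.1)
      have hm := hE d hd.1.1.ne' (R / d) hx
      obtain ⟨hH0, hHA⟩ := radicalSum_inv_log_sq_bounds hC (d := d) hx.le
      have hA := radicalSum_one_le hd.1.1.ne' (R / d)
      have hA0 : 0 ≤ radicalSum d 1 (R / d) := radicalSum_nonneg hx.le fun b _ _ => zero_le_one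
      have hwA := totient_div_sq_mul_le hd.1.1 hA
      have hw : 0 ≤ (Nat.totient d : ℝ) / (d : ℝ) ^ 2 := by positivity
      set A := radicalSum d 1 (R / d)
      set H := radicalSum d (fun b => C / (1 + Real.log (R / d / b)) ^ 2) (R / d)
      set m := moebiusLogSumCoprime d (R / d)
      set w := (Nat.totient d : ℝ) / (d : ℝ) ^ 2
      -- H ≤ C·A turns the H² of (A + H)² into C·A·H, so that every term carries the factor A.
      have h2 : m ^ 2 ≤ A * (A + (2 + C) * H) := by
        have h3 : |m| ≤ A + H := by
          calc |m| = |(m - A) + A| := by ring_nf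
            _ ≤ |m - A| + |A| := abs_add_le _ _
            _ ≤ _ := by rw [abs_of_nonneg hA0]; linarith
        have h4 : m ^ 2 ≤ (A + H) ^ 2 := by
          rw [← sq_abs]; gcongr
        nlinarith
      calc w * m ^ 2 ≤ w * (A * (A + (2 + C) * H)) := by gcongr
        _ = w * A * (A + (2 + C) * H) := by ring
        _ ≤ 1 / (d : ℝ) * (A + (2 + C) * H) := by gcongr
        _ = _ := by ring
    rw [Finset.sum_add_distrib, ← Finset.mul_sum] at h1
    have h2 := sum_squarefree_radicalSum_one_le hR
    have h3 := sum_squarefree_radicalSum_inv_log_sq_le hC hR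
    have h4 : (2 + C) * ∑ d ∈ Ioc 0 ⌊R⌋₊ with Squarefree d, 1 / (d : ℝ) *
      radicalSum d (fun b => C / (1 + Real.log (R / d / b)) ^ 2) (R / d) ≤ (2 + C) * (3 * C) := by
      gcongr
    linarith

theorem radicalSum_one_sub {d : ℕ} (hd : 0 < d) {x y : ℝ} (hyx : y ≤ x) :
    radicalSum d 1 (x / d) - radicalSum d 1 (y / d) =
      radicalSum d (fun b => if ⌊y⌋₊ < d * b then 1 else 0) (x / d) := by
  have hfl : ⌊y⌋₊ ≤ ⌊x⌋₊ := Nat.floor_le_floor hyx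
  have h1 : radicalSum d 1 (y / d) = radicalSum d (fun b => if d * b ≤ ⌊y⌋₊ then 1 else 0) (x / d) := by
    simp only [radicalSum, Pi.one_apply, mul_ite, mul_one, mul_zero]
    rw [← Finset.sum_filter, Finset.filter_filter]
    refine Finset.sum_congr ?_ fun _ _ => rfl
    ext b
    simp only [mem_filter, mem_Ioc, Nat.floor_div_natCast, Nat.le_div_iff_mul_le hd]
    rw [mul_comm d b]
    constructor
    · rintro ⟨⟨h1, h2⟩, h3⟩
      exact ⟨⟨h1, h2.trans hfl⟩, h3, h2⟩
    · rintro ⟨⟨h1, h2⟩, h3, h4⟩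
      exact ⟨⟨h1, h4⟩, h3⟩
  rw [h1]
  simp only [radicalSum]
  rw [← Finset.sum_sub_distrib]
  refine Finset.sum_congr rfl fun b _ => ?_
  by_cases h : d * b ≤ ⌊y⌋₊
  · simp [h, not_lt.mpr h]
  · simp [h, not_le.mp h]

/-- The difference of the main terms A − A' collects the products d·b in (R/p, R], whose harmonic
mass is at most 1 + log p; the two approximation errors add O(1). -/
theorem exists_diagonalForm_sub_le : ∃ C : ℝ, 0 < C ∧ ∀ R : ℝ, 1 ≤ R → ∀ p : ℕ, 0 < p →
    diagonalForm R (fun d => moebiusLogSumCoprime d (R / d) - moebiusLogSumCoprime d (R / p / d)) ≤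
      C * (1 + Real.log p) := by
  obtain ⟨C, hC, hE⟩ := exists_abs_moebiusLogSumCoprime_sub_le
  refine ⟨3 + 18 * C ^ 2, by positivity, fun R hR p hp => ?_⟩
  have hp0 : (0 : ℝ) < p := by exact_mod_cast hp
  have hR0 : 0 < R := by linarith
  have hy0 : 0 < R / p := by positivity
  have hyR : R / p ≤ R := div_le_self hR0.le (by exact_mod_cast hp)
  set y := R / p with hy
  set G : ℝ → ℕ → ℝ := fun x d => radicalSum d (fun b => C / (1 + Real.log (x / d / b)) ^ 2) (x / d)
    with hG
  have h1 : diagonalForm R (fun d => moebiusLogSumCoprime d (R / d) - moebiusLogSumCoprime d (y / d)) ≤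
      ∑ d ∈ Ioc 0 ⌊R⌋₊ with Squarefree d, (3 * (1 / (d : ℝ) *
        radicalSum d (fun b => if ⌊y⌋₊ < d * b then 1 else 0) (R / d)) +
        3 * C * (1 / (d : ℝ) * G R d) + 3 * C * (1 / (d : ℝ) * G y d)) := by
    refine Finset.sum_le_sum fun d hd => ?_
    rw [mem_filter, mem_Ioc] at hd
    have hd0 : (0 : ℝ) < d := by exact_mod_cast hd.1.1
    have hx : 0 < R / d := by positivity
    have hx' : 0 < y / d := by positivity
    have hm := hE d hd.1.1.ne' (R / d) hx
    have hm' := hE d hd.1.1.ne' (y / d) hx'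
    obtain ⟨hH0, hHA⟩ := radicalSum_inv_log_sq_bounds hC (d := d) hx.le
    obtain ⟨hH0', hHA'⟩ := radicalSum_inv_log_sq_bounds hC (d := d) hx'.le
    have hwA := totient_div_sq_mul_le hd.1.1 (radicalSum_one_le hd.1.1.ne' (R / d))
    have hwA' := totient_div_sq_mul_le hd.1.1 (radicalSum_one_le hd.1.1.ne' (y / d))
    have hw : 0 ≤ (Nat.totient d : ℝ) / (d : ℝ) ^ 2 := by positivity
    have hsub := radicalSum_one_sub hd.1.1 hyR
    have hA0' : 0 ≤ radicalSum d 1 (y / d) := radicalSum_nonneg hx'.le fun b _ _ => zero_le_one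
    have hT0 : 0 ≤ radicalSum d (fun b => if ⌊y⌋₊ < d * b then 1 else 0) (R / d) :=
      radicalSum_nonneg hx.le fun b _ _ => by split_ifs <;> norm_num
    simp only [hG]
    set A := radicalSum d 1 (R / d)
    set A' := radicalSum d 1 (y / d)
    set T := radicalSum d (fun b => if ⌊y⌋₊ < d * b then 1 else 0) (R / d)
    set H := radicalSum d (fun b => C / (1 + Real.log (R / d / b)) ^ 2) (R / d)
    set H' := radicalSum d (fun b => C / (1 + Real.log (y / d / b)) ^ 2) (y / d)
    set m := moebiusLogSumCoprime d (R / d)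
    set m' := moebiusLogSumCoprime d (y / d)
    set w := (Nat.totient d : ℝ) / (d : ℝ) ^ 2
    have h2 : (m - m') ^ 2 ≤ 3 * (A * T) + 3 * (C * A * H) + 3 * (C * A' * H') := by
      have e1 : (m - A) ^ 2 ≤ C * A * H := by
        have : (m - A) ^ 2 ≤ H ^ 2 := by rw [← sq_abs]; gcongr
        nlinarith
      have e2 : (m' - A') ^ 2 ≤ C * A' * H' := by
        have : (m' - A') ^ 2 ≤ H' ^ 2 := by rw [← sq_abs]; gcongr
        nlinarith
      -- Here A − A' = T, and T ≤ A since A' ≥ 0.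
      have e3 : (A - A') ^ 2 ≤ A * T := by
        rw [hsub]; nlinarith
      have e4 : (m - m') ^ 2 ≤ 3 * (A - A') ^ 2 + 3 * (m - A) ^ 2 + 3 * (m' - A') ^ 2 := by
        have : m - m' = (A - A') + (m - A) - (m' - A') := by ring
        rw [this]
        nlinarith [sq_nonneg ((A - A') - (m - A)), sq_nonneg ((A - A') + (m' - A')),
          sq_nonneg ((m - A) + (m' - A'))]
      linarith
    calc w * (m - m') ^ 2 ≤ w * (3 * (A * T) + 3 * (C * A * H) + 3 * (C * A' * H')) := by gcongr
      _ = 3 * (w * A * T) + 3 * C * (w * A * H) + 3 * C * (w * A' * H') := by ring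
      _ ≤ 3 * (1 / (d : ℝ) * T) + 3 * C * (1 / (d : ℝ) * H) + 3 * C * (1 / (d : ℝ) * H') := by
        gcongr
  rw [Finset.sum_add_distrib, Finset.sum_add_distrib, ← Finset.mul_sum, ← Finset.mul_sum,
    ← Finset.mul_sum] at h1
  have b1 : ∑ d ∈ Ioc 0 ⌊R⌋₊ with Squarefree d, 1 / (d : ℝ) *
      radicalSum d (fun b => if ⌊y⌋₊ < d * b then 1 else 0) (R / d) ≤ 1 + Real.log p := by
    refine (sum_squarefree_radicalSum_le (g := fun n => if ⌊y⌋₊ < n then 1 else 0)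
      (fun n _ _ => by split_ifs <;> norm_num) hR0.le).trans ?_
    refine le_trans (le_of_eq ?_) (sum_Ioc_div_one_div_le ⌊R⌋₊ hp)
    simp only [mul_ite, mul_one, mul_zero]
    rw [← Finset.sum_filter]
    refine Finset.sum_congr ?_ fun _ _ => rfl
    ext n
    simp only [mem_filter, mem_Ioc, hy, Nat.floor_div_natCast]
    generalize ⌊R⌋₊ / p = k
    omega
  have b2 := sum_squarefree_radicalSum_inv_log_sq_le hC hR
  have b3 : ∑ d ∈ Ioc 0 ⌊R⌋₊ with Squarefree d, 1 / (d : ℝ) * G y d ≤ 3 * C := by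
    -- When R/p < 1 every sum over b is empty.
    rcases le_or_gt 1 y with h | h
    · refine le_trans (le_of_eq ?_) (sum_squarefree_radicalSum_inv_log_sq_le hC h)
      symm
      refine Finset.sum_subset (Finset.filter_subset_filter _
        (Finset.Ioc_subset_Ioc_right (Nat.floor_le_floor hyR))) fun d hd hd' => ?_
      rw [mem_filter, mem_Ioc] at hd hd'
      have : ⌊y⌋₊ / d = 0 := Nat.div_eq_of_lt
        (not_le.mp fun h => hd' ⟨⟨hd.1.1, h⟩, hd.2⟩)
      simp [radicalSum, Nat.floor_div_natCast, this]
    · rw [Finset.sum_eq_zero]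
      · positivity
      · intro d _
        simp [hG, radicalSum, Nat.floor_div_natCast, Nat.floor_eq_zero.mpr h]
  have hl : 0 ≤ Real.log p := Real.log_natCast_nonneg p
  have b2' : 3 * C * ∑ d ∈ Ioc 0 ⌊R⌋₊ with Squarefree d, 1 / (d : ℝ) * G R d ≤ 3 * C * (3 * C) := by
    gcongr
  have b3' : 3 * C * ∑ d ∈ Ioc 0 ⌊R⌋₊ with Squarefree d, 1 / (d : ℝ) * G y d ≤ 3 * C * (3 * C) := by
    gcongr
  nlinarith [mul_nonneg (sq_nonneg C) hl]

end

/-! ### Mean squares of Λ_R over a full period, and over the multiples of a prime. -/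

section

open Finset

theorem sum_range_mul_of_periodic {M : Type*} [AddCommMonoid M] {g : ℕ → M} {P : ℕ}
    (hg : Function.Periodic g P) (c : ℕ) :
    ∑ n ∈ range (c * P), g n = c • ∑ n ∈ range P, g n := by
  induction c with
  | zero => simp
  | succ c ih =>
    rw [Nat.succ_mul, Finset.sum_range_add, ih, succ_nsmul]
    congr 1
    refine Finset.sum_congr rfl fun n _ => ?_
    rw [add_comm]
    exact hg.nat_mul c n

theorem sum_range_eq_of_periodic {g : ℕ → ℂ} {P Q : ℕ} (hP : 0 < P) (h : P ∣ Q)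
    (hg : Function.Periodic g P) :
    ∑ n ∈ range Q, g n = (Q : ℂ) / P * ∑ n ∈ range P, g n := by
  obtain ⟨c, rfl⟩ := h
  have hP' : (P : ℂ) ≠ 0 := by exact_mod_cast hP.ne'
  rw [mul_comm P c, sum_range_mul_of_periodic hg, nsmul_eq_mul]
  push_cast
  field_simp

theorem sum_range_mul_filter_dvd {M : Type*} [AddCommMonoid M] (g : ℕ → M) {p : ℕ} (hp : 0 < p)
    (c : ℕ) : ∑ n ∈ range (p * c) with p ∣ n, g n = ∑ m ∈ range c, g (p * m) := by
  symm
  refine Finset.sum_bij (fun m _ => p * m) ?_ ?_ ?_ ?_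
  · intro m hm
    rw [mem_filter, mem_range]
    exact ⟨Nat.mul_lt_mul_of_pos_left (mem_range.mp hm) hp, dvd_mul_right p m⟩
  · intro a _ b _ hab
    exact Nat.eq_of_mul_eq_mul_left hp hab
  · intro n hn
    rw [mem_filter, mem_range] at hn
    obtain ⟨h, m, rfl⟩ := hn
    exact ⟨m, mem_range.mpr (Nat.lt_of_mul_lt_mul_left h), rfl⟩
  · intro m _
    rfl

theorem sum_range_ite_dvd {L Q : ℕ} (hL : 0 < L) (h : L ∣ Q) :
    ∑ n ∈ range Q, (if L ∣ n then (1 : ℝ) else 0) = Q / L := by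
  obtain ⟨c, rfl⟩ := h
  have hL' : (L : ℝ) ≠ 0 := by exact_mod_cast hL.ne'
  rw [← Finset.sum_filter, sum_range_mul_filter_dvd (fun _ => (1 : ℝ)) hL]
  simp
  field_simp

theorem gcd_eq_sum_totient {N k l : ℕ} (hk : k ∈ Ioc 0 N) :
    ((Nat.gcd k l : ℕ) : ℝ) = ∑ d ∈ Ioc 0 N, if d ∣ k ∧ d ∣ l then (Nat.totient d : ℝ) else 0 := by
  rw [mem_Ioc] at hk
  rw [← Finset.sum_filter]
  have : (Ioc 0 N).filter (fun d => d ∣ k ∧ d ∣ l) = (Nat.gcd k l).divisors := by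
    ext d
    simp only [mem_filter, mem_Ioc, Nat.mem_divisors, ← Nat.dvd_gcd_iff]
    constructor
    · rintro ⟨-, h⟩
      exact ⟨h, (Nat.gcd_pos_of_pos_left l hk.1).ne'⟩
    · rintro ⟨h, h0⟩
      have hdk := h.trans (Nat.gcd_dvd_left k l)
      exact ⟨⟨Nat.pos_of_dvd_of_pos hdk hk.1, (Nat.le_of_dvd hk.1 hdk).trans hk.2⟩, h⟩
  rw [this]
  exact_mod_cast (Nat.sum_totient (Nat.gcd k l)).symm

/-- Selberg's diagonalisation: every lcm(k,l) divides Q, so a pair has mean λ_kλ_l/lcm(k,l) =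
λ_kλ_l·gcd(k,l)/(kl), and gcd(k,l) is the sum of φ(d) over common divisors d. -/
theorem sum_range_sq_sum_dvd (lam : ℕ → ℝ) {N Q : ℕ} (hQ : N.factorial ∣ Q) :
    ∑ n ∈ range Q, (∑ k ∈ Ioc 0 N with k ∣ n, lam k) ^ 2 =
      Q * ∑ d ∈ Ioc 0 N, (Nat.totient d : ℝ) * (∑ k ∈ Ioc 0 N with d ∣ k, lam k / k) ^ 2 := by
  have h1 : ∀ n, (∑ k ∈ Ioc 0 N with k ∣ n, lam k) ^ 2 = ∑ k ∈ Ioc 0 N, ∑ l ∈ Ioc 0 N,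
      lam k * lam l * (if Nat.lcm k l ∣ n then 1 else 0) := by
    intro n
    rw [sq, Finset.sum_filter, Finset.sum_mul_sum]
    refine Finset.sum_congr rfl fun k _ => Finset.sum_congr rfl fun l _ => ?_
    simp only [Nat.lcm_dvd_iff]
    split_ifs <;> simp_all
  have h2 : ∀ d, (∑ k ∈ Ioc 0 N with d ∣ k, lam k / k) ^ 2 = ∑ k ∈ Ioc 0 N, ∑ l ∈ Ioc 0 N,
      lam k / k * (lam l / l) * (if d ∣ k ∧ d ∣ l then 1 else 0) := by
    intro d
    rw [sq, Finset.sum_filter, Finset.sum_mul_sum]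
    refine Finset.sum_congr rfl fun k _ => Finset.sum_congr rfl fun l _ => ?_
    split_ifs <;> simp_all
  have hcomm : ∀ (s : Finset ℕ) (F : ℕ → ℕ → ℕ → ℝ), ∑ n ∈ s, ∑ k ∈ Ioc 0 N, ∑ l ∈ Ioc 0 N,
      F n k l = ∑ k ∈ Ioc 0 N, ∑ l ∈ Ioc 0 N, ∑ n ∈ s, F n k l := by
    intro s F
    rw [Finset.sum_comm]
    exact Finset.sum_congr rfl fun k _ => Finset.sum_comm
  simp_rw [h1, h2, Finset.mul_sum]
  rw [hcomm, hcomm]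
  refine Finset.sum_congr rfl fun k hk => Finset.sum_congr rfl fun l hl => ?_
  rw [← Finset.mul_sum]
  have hk' := mem_Ioc.mp hk
  have hl' := mem_Ioc.mp hl
  have hk0 : (k : ℝ) ≠ 0 := by exact_mod_cast hk'.1.ne'
  have hl0 : (l : ℝ) ≠ 0 := by exact_mod_cast hl'.1.ne'
  have hL : Nat.lcm k l ∣ Q := (Nat.lcm_dvd (Nat.dvd_factorial hk'.1 hk'.2)
    (Nat.dvd_factorial hl'.1 hl'.2)).trans hQ
  rw [sum_range_ite_dvd (Nat.lcm_pos hk'.1 hl'.1) hL]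
  have e : ∑ d ∈ Ioc 0 N, (Q : ℝ) * ((Nat.totient d : ℝ) *
      (lam k / k * (lam l / l) * (if d ∣ k ∧ d ∣ l then 1 else 0))) =
      Q * (lam k / k * (lam l / l)) * (Nat.gcd k l : ℕ) := by
    rw [gcd_eq_sum_totient hk, Finset.mul_sum]
    refine Finset.sum_congr rfl fun d _ => ?_
    split_ifs <;> ring
  rw [e]
  have hg : ((Nat.gcd k l : ℕ) : ℝ) * (Nat.lcm k l : ℕ) = k * l := by
    exact_mod_cast Nat.gcd_mul_lcm k l
  have hlcm : ((Nat.lcm k l : ℕ) : ℝ) ≠ 0 := by exact_mod_cast (Nat.lcm_pos hk'.1 hl'.1).ne'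
  rw [eq_div_of_mul_eq hlcm hg]
  field_simp

/-- The weights `μ(k) log⁺ (R / k)` of the truncated von Mangoldt function. -/
noncomputable def truncWeight (R : ℝ) (k : ℕ) : ℝ :=
  (ArithmeticFunction.moebius k : ℝ) * max (Real.log (R / k)) 0

theorem truncWeight_of_le {R : ℝ} (hR : 0 ≤ R) {k : ℕ} (h : R ≤ k) : truncWeight R k = 0 := by
  rw [truncWeight, max_eq_right, mul_zero]
  exact Real.log_nonpos (by positivity) (div_le_one_of_le₀ h (by positivity))

/-- The weight vanishes for k ≥ R, so k < R versus k ≤ R is immaterial and any longer range serves.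
This lets the levels R and R/p share one range of summation. -/
theorem LambdaR_eq_sum {R : ℝ} (hR : 0 ≤ R) {N : ℕ} (hN : ⌊R⌋₊ ≤ N) (n : ℕ) :
    LambdaR R n = ∑ k ∈ Ioc 0 N with k ∣ n, truncWeight R k := by
  rw [LambdaR]
  have h1 : ∀ k ∈ (Ico 1 ⌈R⌉₊).filter (fun k => k ∣ n),
      (ArithmeticFunction.moebius k : ℝ) * Real.log (R / k) = truncWeight R k := by
    intro k hk
    rw [mem_filter, mem_Ico, Nat.lt_ceil] at hk
    have hk0 : (0 : ℝ) < k := by exact_mod_cast hk.1.1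
    rw [truncWeight, max_eq_left (Real.log_nonneg ((one_le_div hk0).mpr hk.1.2.le))]
  rw [Finset.sum_congr rfl h1]
  refine Finset.sum_subset ?_ ?_
  · intro k hk
    rw [mem_filter, mem_Ico, Nat.lt_ceil] at hk
    rw [mem_filter, mem_Ioc]
    exact ⟨⟨hk.1.1, (Nat.le_floor hk.1.2.le).trans hN⟩, hk.2⟩
  · intro k hk hk'
    rw [mem_filter, mem_Ico, Nat.lt_ceil] at hk'
    rw [mem_filter, mem_Ioc] at hk
    refine truncWeight_of_le hR (not_lt.mp fun h => hk' ⟨⟨hk.1.1, h⟩, hk.2⟩)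

theorem sum_truncWeight_div {R : ℝ} (hR : 0 < R) {N : ℕ} (hN : ⌊R⌋₊ ≤ N) {d : ℕ} (hd : 0 < d) :
    ∑ k ∈ Ioc 0 N with d ∣ k, truncWeight R k / k =
      (ArithmeticFunction.moebius d : ℝ) / d * moebiusLogSumCoprime d (R / d) := by
  have hd0 : (0 : ℝ) < d := by exact_mod_cast hd
  have hfl : ⌊R / d⌋₊ ≤ N / d := by
    rw [Nat.floor_div_natCast]; exact Nat.div_le_div_right hN
  rw [moebiusLogSumCoprime_eq d (div_pos hR hd0) hfl, Finset.mul_sum]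
  symm
  refine Finset.sum_bij (fun m _ => d * m) ?_ ?_ ?_ ?_
  · intro m hm
    rw [mem_Ioc, Nat.le_div_iff_mul_le hd, mul_comm] at hm
    rw [mem_filter, mem_Ioc]
    exact ⟨⟨Nat.mul_pos hd hm.1, hm.2⟩, dvd_mul_right d m⟩
  · intro a _ b _ hab
    exact Nat.eq_of_mul_eq_mul_left hd hab
  · intro n hn
    rw [mem_filter, mem_Ioc] at hn
    obtain ⟨⟨h0, h1⟩, m, rfl⟩ := hn
    refine ⟨m, ?_, rfl⟩
    rw [mem_Ioc, Nat.le_div_iff_mul_le hd, mul_comm]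
    exact ⟨Nat.pos_of_mul_pos_left h0, h1⟩
  · intro m _
    rw [truncWeight, moebius_mul_eq, div_div]
    push_cast
    rw [mul_div_mul_comm]
    ring

theorem sum_totient_mul_sq_eq_diagonalForm {R : ℝ} (f : ℕ → ℝ) :
    ∑ d ∈ Ioc 0 ⌊R⌋₊, (Nat.totient d : ℝ) * ((ArithmeticFunction.moebius d : ℝ) / d * f d) ^ 2 =
      diagonalForm R f := by
  rw [diagonalForm, Finset.sum_filter]
  refine Finset.sum_congr rfl fun d _ => ?_
  rw [mul_pow, div_pow, moebius_sq_eq]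
  split_ifs
  · ring
  · simp

theorem sum_range_LambdaR_sq {R : ℝ} (hR : 0 < R) {Q : ℕ} (hQ : (⌊R⌋₊).factorial ∣ Q) :
    ∑ n ∈ range Q, LambdaR R n ^ 2 =
      Q * diagonalForm R (fun d => moebiusLogSumCoprime d (R / d)) := by
  simp_rw [LambdaR_eq_sum hR.le le_rfl]
  rw [sum_range_sq_sum_dvd _ hQ, ← sum_totient_mul_sq_eq_diagonalForm]
  congr 1
  refine Finset.sum_congr rfl fun d hd => ?_
  rw [sum_truncWeight_div hR le_rfl (mem_Ioc.mp hd).1]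

theorem sum_range_LambdaR_sub_sq {R R' : ℝ} (hR' : 0 < R') (h : R' ≤ R) {Q : ℕ}
    (hQ : (⌊R⌋₊).factorial ∣ Q) :
    ∑ n ∈ range Q, (LambdaR R n - LambdaR R' n) ^ 2 =
      Q * diagonalForm R (fun d => moebiusLogSumCoprime d (R / d) - moebiusLogSumCoprime d (R' / d)) := by
  have hR : 0 < R := by linarith
  simp_rw [LambdaR_eq_sum hR.le le_rfl, LambdaR_eq_sum hR'.le (Nat.floor_le_floor h),
    ← Finset.sum_sub_distrib]
  rw [sum_range_sq_sum_dvd (fun k => truncWeight R k - truncWeight R' k) hQ,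
    ← sum_totient_mul_sq_eq_diagonalForm]
  congr 1
  refine Finset.sum_congr rfl fun d hd => ?_
  simp_rw [sub_div]
  rw [Finset.sum_sub_distrib, sum_truncWeight_div hR le_rfl (mem_Ioc.mp hd).1,
    sum_truncWeight_div hR' (Nat.floor_le_floor h) (mem_Ioc.mp hd).1, mul_sub]

theorem LambdaR_periodic {R : ℝ} (hR : 0 ≤ R) {Q : ℕ} (hQ : (⌊R⌋₊).factorial ∣ Q) :
    Function.Periodic (LambdaR R) Q := by
  intro n
  rw [LambdaR_eq_sum hR le_rfl, LambdaR_eq_sum hR le_rfl]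
  refine Finset.sum_congr (Finset.filter_congr fun k hk => ?_) fun _ _ => rfl
  rw [mem_Ioc] at hk
  exact (Nat.dvd_add_left ((Nat.dvd_factorial hk.1 hk.2).trans hQ))

theorem truncWeight_prime_mul {R : ℝ} {p : ℕ} (hp : p.Prime) (k : ℕ) :
    truncWeight R (p * k) = if p ∣ k then 0 else -truncWeight (R / p) k := by
  have hc : k.Coprime p ↔ ¬ p ∣ k := by rw [Nat.coprime_comm, hp.coprime_iff_not_dvd]
  rw [truncWeight, moebius_mul_eq, moebiusCoprime_apply, ArithmeticFunction.moebius_apply_prime hp]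
  by_cases h : p ∣ k
  · rw [if_neg (by rwa [hc, not_not]), if_pos h]
    simp
  · rw [if_pos (hc.mpr h), if_neg h, truncWeight]
    push_cast
    rw [div_mul_eq_div_div]
    ring

/-- For p ∤ m the new divisors of pm are pk with k ∣ m, and μ(pk) log(R/(pk)) = −μ(k) log((R/p)/k).
For p ∣ m, pm has no squarefree divisors beyond those of m. -/
theorem LambdaR_prime_mul {R : ℝ} (hR : 0 ≤ R) {p : ℕ} (hp : p.Prime) (m : ℕ) :
    LambdaR R (p * m) = if p ∣ m then LambdaR R m else LambdaR R m - LambdaR (R / p) m := by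
  have hp0 : 0 < p := hp.pos
  have hRp : R / p ≤ R := div_le_self hR (by exact_mod_cast hp.one_lt.le)
  set N := ⌊R⌋₊ with hN
  -- the multiples of `p` among the divisors
  have hsplit : ∀ n : ℕ, LambdaR R n = ∑ k ∈ Ioc 0 N with k ∣ n ∧ ¬ p ∣ k, truncWeight R k +
      ∑ k ∈ Ioc 0 N with k ∣ n ∧ p ∣ k, truncWeight R k := by
    intro n
    rw [LambdaR_eq_sum hR le_rfl, ← Finset.sum_filter_not_add_sum_filter _ (fun k => p ∣ k),
      Finset.filter_filter, Finset.filter_filter]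
  have hcop : ∀ k : ℕ, ¬ p ∣ k → (k ∣ p * m ↔ k ∣ m) := by
    intro k hk
    exact (Nat.Coprime.symm ((hp.coprime_iff_not_dvd).mpr hk)).dvd_mul_left
  have hfirst : (Ioc 0 N).filter (fun k => k ∣ p * m ∧ ¬ p ∣ k) =
      (Ioc 0 N).filter (fun k => k ∣ m ∧ ¬ p ∣ k) := by
    refine Finset.filter_congr fun k _ => ?_
    constructor
    · rintro ⟨h1, h2⟩; exact ⟨(hcop k h2).mp h1, h2⟩
    · rintro ⟨h1, h2⟩; exact ⟨(hcop k h2).mpr h1, h2⟩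
  have hmult : ∑ k ∈ Ioc 0 N with k ∣ p * m ∧ p ∣ k, truncWeight R k =
      -∑ k ∈ Ioc 0 (N / p) with k ∣ m ∧ ¬ p ∣ k, truncWeight (R / p) k := by
    rw [← Finset.sum_neg_distrib]
    have e : ∑ k ∈ Ioc 0 (N / p) with k ∣ m ∧ ¬ p ∣ k, -truncWeight (R / p) k =
        ∑ k ∈ Ioc 0 (N / p) with k ∣ m, truncWeight R (p * k) := by
      rw [← Finset.filter_filter, Finset.sum_filter (fun k => ¬ p ∣ k)]
      refine Finset.sum_congr rfl fun k _ => ?_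
      rw [truncWeight_prime_mul hp]
      split_ifs <;> simp_all
    rw [e]
    symm
    refine Finset.sum_bij (fun k _ => p * k) ?_ ?_ ?_ ?_
    · intro k hk
      rw [mem_filter, mem_Ioc, Nat.le_div_iff_mul_le hp0, mul_comm] at hk
      rw [mem_filter, mem_Ioc]
      exact ⟨⟨Nat.mul_pos hp0 hk.1.1, hk.1.2⟩, Nat.mul_dvd_mul_left p hk.2, dvd_mul_right p k⟩
    · intro a _ b _ hab
      exact Nat.eq_of_mul_eq_mul_left hp0 hab
    · intro n hn
      rw [mem_filter, mem_Ioc] at hn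
      obtain ⟨⟨h0, h1⟩, h2, k, rfl⟩ := hn
      refine ⟨k, ?_, rfl⟩
      rw [mem_filter, mem_Ioc, Nat.le_div_iff_mul_le hp0, mul_comm]
      exact ⟨⟨Nat.pos_of_mul_pos_left h0, h1⟩, Nat.dvd_of_mul_dvd_mul_left hp0 h2⟩
    · intro k _
      rfl
  split_ifs with hpm
  · obtain ⟨m', rfl⟩ := hpm
    -- squares of `p` do not contribute
    rw [LambdaR_eq_sum hR le_rfl, LambdaR_eq_sum hR le_rfl]
    symm
    refine Finset.sum_subset ?_ ?_
    · intro k hk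
      rw [mem_filter] at hk ⊢
      exact ⟨hk.1, hk.2.mul_left p⟩
    · intro k hk hk'
      rw [mem_filter] at hk hk'
      have hns : ¬ Squarefree k := by
        intro hs
        refine hk' ⟨hk.1, ?_⟩
        by_cases hpk : p ∣ k
        · obtain ⟨j, rfl⟩ := hpk
          have hj : ¬ p ∣ j := by
            intro hj
            have := hs p (Nat.mul_dvd_mul_left p hj)
            exact hp.one_lt.ne' (Nat.isUnit_iff.mp this)
          have h1 : j ∣ p * m' := Nat.dvd_of_mul_dvd_mul_left hp0 hk.2
          have h2 : j ∣ m' := (Nat.Coprime.symm ((hp.coprime_iff_not_dvd).mpr hj)).dvd_mul_left.mp h1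
          exact Nat.mul_dvd_mul_left p h2
        · exact (hcop k hpk).mp hk.2
      rw [truncWeight, ArithmeticFunction.moebius_eq_zero_of_not_squarefree hns]
      simp
  · have h2 : LambdaR (R / p) m =
        ∑ k ∈ Ioc 0 (N / p) with k ∣ m ∧ ¬ p ∣ k, truncWeight (R / p) k := by
      rw [LambdaR_eq_sum (by positivity) (le_of_eq (Nat.floor_div_natCast R p))]
      refine Finset.sum_congr (Finset.filter_congr fun k _ => ?_) fun _ _ => rfl
      exact ⟨fun h => ⟨h, fun h' => hpm (h'.trans h)⟩, fun h => h.1⟩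
    have h3 : (Ioc 0 N).filter (fun k => k ∣ m ∧ p ∣ k) = ∅ := by
      rw [Finset.filter_eq_empty_iff]
      rintro k _ ⟨h, h'⟩
      exact hpm (h'.trans h)
    rw [hsplit (p * m), hsplit m, hfirst, hmult, h2, h3]
    simp [sub_eq_add_neg]

/-- Let T be the sum over multiples of p. Substituting n = pm gives pT ≤ T + ∑(Λ_R − Λ_{R/p})², the
m divisible by p reproducing T. Since p ≥ 2, (p − 1)T ≥ pT/2. -/
theorem sum_range_dvd_LambdaR_sq_le {R : ℝ} (hR : 0 < R) {p Q : ℕ} (hp : p.Prime)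
    (hQ : p * (⌊R⌋₊).factorial ∣ Q) :
    (p : ℝ) * ∑ n ∈ range Q with p ∣ n, LambdaR R n ^ 2 ≤
      2 * ∑ n ∈ range Q, (LambdaR R n - LambdaR (R / p) n) ^ 2 := by
  obtain ⟨c, rfl⟩ := hQ
  set F := (⌊R⌋₊).factorial with hF
  have hp2 : (2 : ℝ) ≤ p := by exact_mod_cast hp.two_le
  set T := ∑ n ∈ range (p * F * c) with p ∣ n, LambdaR R n ^ 2 with hT
  have hT0 : 0 ≤ T := Finset.sum_nonneg fun _ _ => sq_nonneg _
  have h1 : T = ∑ m ∈ range (F * c), LambdaR R (p * m) ^ 2 := by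
    rw [hT, mul_assoc]
    exact sum_range_mul_filter_dvd (fun n => LambdaR R n ^ 2) hp.pos (F * c)
  have hper : Function.Periodic (fun m => LambdaR R (p * m) ^ 2) (F * c) := by
    intro m
    have := (LambdaR_periodic hR.le (dvd_mul_right F c)).nat_mul p (p * m)
    rw [Nat.cast_id] at this
    simp only [mul_add]
    rw [this]
  have h2 : (p : ℝ) * T = ∑ m ∈ range (p * F * c), LambdaR R (p * m) ^ 2 := by
    rw [h1, mul_assoc, sum_range_mul_of_periodic hper, nsmul_eq_mul]
  have h3 : ∑ m ∈ range (p * F * c), LambdaR R (p * m) ^ 2 ≤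
      T + ∑ n ∈ range (p * F * c), (LambdaR R n - LambdaR (R / p) n) ^ 2 := by
    rw [hT, Finset.sum_filter, ← Finset.sum_add_distrib]
    refine Finset.sum_le_sum fun m _ => ?_
    rw [LambdaR_prime_mul hR.le hp]
    split_ifs
    · exact le_add_of_nonneg_right (sq_nonneg _)
    · simp
  nlinarith

end

/-! ### Integers not coprime to q, and factorisation of the coprime sum. -/

section

open Finset

/-- Mertens' argument: ∑ Λ(n)⌊N/n⌋ = log N! ≤ N log N, with Λ the von Mangoldt function; the error
from the floors is θ(N) ≤ N log 4. -/
theorem sum_primes_log_div_le {N : ℕ} (hN : 0 < N) :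
    ∑ p ∈ Ioc 0 N with p.Prime, Real.log p / p ≤ Real.log N + Real.log 4 := by
  have hN0 : (0 : ℝ) < N := by exact_mod_cast hN
  have h1 := ArithmeticFunction.sum_Ioc_mul_zeta_eq_sum ArithmeticFunction.vonMangoldt N
  rw [ArithmeticFunction.vonMangoldt_mul_zeta] at h1
  have h2 : ∑ n ∈ Ioc 0 N, ArithmeticFunction.log n ≤ N * Real.log N := by
    calc ∑ n ∈ Ioc 0 N, ArithmeticFunction.log n ≤ ∑ n ∈ Ioc 0 N, Real.log N := by
          refine Finset.sum_le_sum fun n hn => ?_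
          rw [mem_Ioc] at hn
          rw [ArithmeticFunction.log_apply]
          exact Real.log_le_log (by exact_mod_cast hn.1) (by exact_mod_cast hn.2)
      _ = _ := by simp
  have h3 : ∑ p ∈ Ioc 0 N with p.Prime, Real.log p * (N / p - 1) ≤
      ∑ n ∈ Ioc 0 N, ArithmeticFunction.vonMangoldt n * ((N / n : ℕ) : ℝ) := by
    rw [Finset.sum_filter]
    refine Finset.sum_le_sum fun n _ => ?_
    split_ifs with hp
    · rw [ArithmeticFunction.vonMangoldt_apply_prime hp]
      refine mul_le_mul_of_nonneg_left ?_ (Real.log_natCast_nonneg n)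
      have := Nat.lt_floor_add_one ((N : ℝ) / n)
      rw [Nat.floor_div_eq_div] at this
      linarith
    · exact mul_nonneg ArithmeticFunction.vonMangoldt_nonneg (by positivity)
  have h4 := Chebyshev.theta_le_log4_mul_x hN0.le
  rw [Chebyshev.theta, Nat.floor_natCast] at h4
  have e : ∑ p ∈ Ioc 0 N with p.Prime, Real.log p * (N / p - 1) =
      N * ∑ p ∈ Ioc 0 N with p.Prime, Real.log p / p - ∑ p ∈ Ioc 0 N with p.Prime, Real.log p := by
    rw [Finset.mul_sum, ← Finset.sum_sub_distrib]
    exact Finset.sum_congr rfl fun p _ => by ring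
  have h5 : (N : ℝ) * ∑ p ∈ Ioc 0 N with p.Prime, Real.log p / p ≤
      N * (Real.log N + Real.log 4) := by
    linarith
  exact le_of_mul_le_mul_left h5 hN0

theorem card_primeFactors_mul_log_two_le {q : ℕ} (hq : 0 < q) :
    (q.primeFactors.card : ℝ) * Real.log 2 ≤ Real.log q := by
  have h1 : 2 ^ q.primeFactors.card ≤ q := by
    calc 2 ^ q.primeFactors.card ≤ ∏ p ∈ q.primeFactors, p :=
          Finset.pow_card_le_prod _ _ _ fun p hp => (Nat.prime_of_mem_primeFactors hp).two_le
      _ ≤ q := Nat.le_of_dvd hq (Nat.prod_primeFactors_dvd q)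
  rw [← Real.log_pow]
  exact Real.log_le_log (by positivity) (by exact_mod_cast h1)

/-- Cut at X = ⌊log q⌋ + 3. Smaller primes fall under Mertens' bound. There are at most log q / log
2 ≤ 2X larger ones, each contributing at most log X / X because log x / x decreases beyond e < X. -/
theorem sum_primeFactors_log_div_le {q : ℕ} (hq : 0 < q) :
    ∑ p ∈ q.primeFactors, Real.log p / p ≤ 4 * (1 + Real.log (3 + Real.log q)) := by
  set X := ⌊Real.log q⌋₊ + 3 with hX
  have hl : 0 ≤ Real.log q := Real.log_natCast_nonneg q
  have hX1 : (X : ℝ) ≤ 3 + Real.log q := by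
    rw [hX]; push_cast; linarith [Nat.floor_le hl]
  have hX2 : Real.log q ≤ X := by
    rw [hX]; push_cast; linarith [Nat.lt_floor_add_one (Real.log q)]
  have hX3 : (3 : ℝ) ≤ X := by rw [hX]; push_cast; linarith [(⌊Real.log q⌋₊).cast_nonneg (α := ℝ)]
  have hXpos : (0 : ℝ) < X := by linarith
  have hlX : 0 ≤ Real.log X := Real.log_nonneg (by linarith)
  rw [← Finset.sum_filter_add_sum_filter_not q.primeFactors (fun p => p ≤ X)]
  have b1 : ∑ p ∈ q.primeFactors with p ≤ X, Real.log p / p ≤ Real.log X + Real.log 4 := by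
    refine le_trans (Finset.sum_le_sum_of_subset_of_nonneg ?_ fun p _ _ =>
      div_nonneg (Real.log_natCast_nonneg p) (by positivity)) (sum_primes_log_div_le (N := X) (by omega))
    intro p hp
    rw [mem_filter] at hp ⊢
    have hpp := Nat.prime_of_mem_primeFactors hp.1
    exact ⟨mem_Ioc.mpr ⟨hpp.pos, hp.2⟩, hpp⟩
  have b2 : ∑ p ∈ q.primeFactors with ¬ p ≤ X, Real.log p / p ≤ 2 * Real.log X := by
    have hexp : Real.exp 1 ≤ X := by linarith [Real.exp_one_lt_three]
    calc ∑ p ∈ q.primeFactors with ¬ p ≤ X, Real.log p / p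
        ≤ ∑ p ∈ q.primeFactors with ¬ p ≤ X, Real.log X / X := by
          refine Finset.sum_le_sum fun p hp => ?_
          rw [mem_filter, not_le] at hp
          have hXp : (X : ℝ) ≤ p := by exact_mod_cast hp.2.le
          exact Real.log_div_self_antitoneOn hexp (hexp.trans hXp) hXp
      _ ≤ ∑ p ∈ q.primeFactors, Real.log X / X :=
          Finset.sum_le_sum_of_subset_of_nonneg (Finset.filter_subset _ _) fun _ _ _ => by positivity
      _ = q.primeFactors.card * (Real.log X / X) := by simp
      _ ≤ (2 * X) * (Real.log X / X) := by
          gcongr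
          have := card_primeFactors_mul_log_two_le hq
          have h2 := Real.log_two_gt_d9
          have h3 : (0 : ℝ) ≤ q.primeFactors.card := by positivity
          nlinarith
      _ = _ := by field_simp
  have h4 : Real.log 4 ≤ 2 := by
    have : (4 : ℝ) = 2 ^ 2 := by norm_num
    rw [this, Real.log_pow]
    push_cast
    linarith [Real.log_two_lt_d9]
  have h5 : Real.log X ≤ Real.log (3 + Real.log q) := Real.log_le_log hXpos hX1
  linarith

/-- Union bound over p ∣ q: the multiples of p carry O(Q log p / p), since the mean of (Λ_R −
Λ_{R/p})² is O(1 + log p). -/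
theorem exists_sum_range_not_coprime_LambdaR_sq_le : ∃ C : ℝ, 0 < C ∧ ∀ R : ℝ, 1 ≤ R →
    ∀ q : ℕ, 0 < q → ∀ Q : ℕ, q * (⌊R⌋₊).factorial ∣ Q →
    ∑ n ∈ range Q with ¬ n.Coprime q, LambdaR R n ^ 2 ≤
      C * Q * (1 + Real.log (3 + Real.log q)) := by
  obtain ⟨C, hC, h⟩ := exists_diagonalForm_sub_le
  refine ⟨24 * C, by positivity, fun R hR q hq Q hQ => ?_⟩
  have hR0 : 0 < R := by linarith
  have hp : ∀ p ∈ q.primeFactors, ∑ n ∈ range Q with p ∣ n, LambdaR R n ^ 2 ≤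
      6 * C * Q * (Real.log p / p) := by
    intro p hp
    have hpp := Nat.prime_of_mem_primeFactors hp
    have hp0 : (0 : ℝ) < p := by exact_mod_cast hpp.pos
    have hpQ : p * (⌊R⌋₊).factorial ∣ Q :=
      (Nat.mul_dvd_mul_right (Nat.dvd_of_mem_primeFactors hp) _).trans hQ
    have h1 := sum_range_dvd_LambdaR_sq_le hR0 hpp hpQ
    rw [sum_range_LambdaR_sub_sq (by positivity) (div_le_self hR0.le (by exact_mod_cast hpp.one_lt.le))
      ((dvd_mul_left _ _).trans hpQ)] at h1
    have h2 := h R hR p hpp.pos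
    have h3 : 1 + Real.log p ≤ 3 * Real.log p := by
      have : Real.log 2 ≤ Real.log p :=
        Real.log_le_log (by norm_num) (by exact_mod_cast hpp.two_le)
      linarith [Real.log_two_gt_d9]
    rw [← mul_div_assoc, le_div_iff₀ hp0, mul_comm]
    calc _ ≤ _ := h1
      _ ≤ 2 * (Q * (C * (3 * Real.log p))) := by
        gcongr
        exact h2.trans (by gcongr)
      _ = _ := by ring
  calc ∑ n ∈ range Q with ¬ n.Coprime q, LambdaR R n ^ 2
      ≤ ∑ n ∈ range Q, ∑ p ∈ q.primeFactors, if p ∣ n then LambdaR R n ^ 2 else 0 := by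
        rw [Finset.sum_filter]
        refine Finset.sum_le_sum fun n _ => ?_
        have hnn : ∀ p ∈ q.primeFactors, 0 ≤ if p ∣ n then LambdaR R n ^ 2 else 0 := by
          intro p _; split_ifs <;> positivity
        split_ifs with hc
        · exact Finset.sum_nonneg hnn
        · obtain ⟨p, hpp, hpn, hpq⟩ := Nat.Prime.not_coprime_iff_dvd.mp hc
          refine le_trans (le_of_eq ?_) (Finset.single_le_sum hnn
            (Nat.mem_primeFactors.mpr ⟨hpp, hpq, hq.ne'⟩))
          rw [if_pos hpn]
    _ = ∑ p ∈ q.primeFactors, ∑ n ∈ range Q with p ∣ n, LambdaR R n ^ 2 := by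
        rw [Finset.sum_comm]
        exact Finset.sum_congr rfl fun p _ => (Finset.sum_filter _ _).symm
    _ ≤ ∑ p ∈ q.primeFactors, 6 * C * Q * (Real.log p / p) := Finset.sum_le_sum hp
    _ = 6 * C * Q * ∑ p ∈ q.primeFactors, Real.log p / p := (Finset.mul_sum _ _ _).symm
    _ ≤ 6 * C * Q * (4 * (1 + Real.log (3 + Real.log q))) := by
        gcongr
        exact sum_primeFactors_log_div_le hq
    _ = _ := by ring

theorem exists_sum_range_coprime_LambdaR_sq : ∃ C : ℝ, 0 < C ∧ ∀ R : ℝ, 1 ≤ R →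
    ∀ q : ℕ, 0 < q → ∀ Q : ℕ, q * (⌊R⌋₊).factorial ∣ Q →
    ∑ n ∈ range Q with ¬ n.Coprime q, LambdaR R n ^ 2 ≤
      C * Q * (1 + Real.log (3 + Real.log q)) ∧
    |∑ n ∈ range Q with n.Coprime q, LambdaR R n ^ 2 - Q * Real.log R| ≤
      C * Q * (1 + Real.log (3 + Real.log q)) := by
  obtain ⟨C, hC, h⟩ := exists_sum_range_not_coprime_LambdaR_sq_le
  obtain ⟨D, hD, h'⟩ := exists_diagonalForm_log_le
  refine ⟨C + D, by positivity, fun R hR q hq Q hQ => ?_⟩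
  have h1 := h R hR q hq Q hQ
  have h2 := h' R hR
  have h3 := sum_range_LambdaR_sq (R := R) (by linarith) ((dvd_mul_left _ _).trans hQ)
  rw [← Finset.sum_filter_add_sum_filter_not _ (fun n => n.Coprime q)] at h3
  have hl : 0 ≤ Real.log (3 + Real.log q) :=
    Real.log_nonneg (by linarith [Real.log_natCast_nonneg q])
  have h0 : 0 ≤ ∑ n ∈ range Q with ¬ n.Coprime q, LambdaR R n ^ 2 :=
    Finset.sum_nonneg fun _ _ => sq_nonneg _
  set T := ∑ n ∈ range Q with ¬ n.Coprime q, LambdaR R n ^ 2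
  set S := ∑ n ∈ range Q with n.Coprime q, LambdaR R n ^ 2
  set G := diagonalForm R fun d => moebiusLogSumCoprime d (R / d)
  set ℓ := 1 + Real.log (3 + Real.log q) with hℓ
  have hQ0 : (0 : ℝ) ≤ Q := by positivity
  have hDQ : D * Q ≤ D * Q * ℓ := le_mul_of_one_le_right (by positivity) (by linarith)
  have e1 : (C + D) * Q * ℓ = C * Q * ℓ + D * Q * ℓ := by ring
  have hDQ0 : 0 ≤ D * Q := by positivity
  refine ⟨by linarith, ?_⟩
  have h4 : |(Q : ℝ) * (G - Real.log R)| ≤ D * Q := by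
    rw [abs_mul, abs_of_nonneg hQ0, mul_comm]
    gcongr
  rw [abs_le] at h4 ⊢
  rw [mul_sub] at h4
  have hCQ0 : 0 ≤ C * Q * ℓ := by positivity
  constructor <;> linarith

theorem sum_mul_LambdaR_sq_eq {R : ℝ} (hR : 0 ≤ R) (s : Finset ℕ) (g : ℕ → ℂ) :
    ∑ n ∈ s, g n * ((LambdaR R n ^ 2 : ℝ) : ℂ) = ∑ k ∈ Ioc 0 ⌊R⌋₊, ∑ l ∈ Ioc 0 ⌊R⌋₊,
      ((truncWeight R k * truncWeight R l : ℝ) : ℂ) * ∑ n ∈ s with Nat.lcm k l ∣ n, g n := by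
  have h1 : ∀ n, g n * ((LambdaR R n ^ 2 : ℝ) : ℂ) = ∑ k ∈ Ioc 0 ⌊R⌋₊, ∑ l ∈ Ioc 0 ⌊R⌋₊,
      ((truncWeight R k * truncWeight R l : ℝ) : ℂ) * (if Nat.lcm k l ∣ n then g n else 0) := by
    intro n
    rw [LambdaR_eq_sum hR le_rfl, sq, Finset.sum_filter, Finset.sum_mul_sum]
    push_cast
    rw [Finset.mul_sum]
    refine Finset.sum_congr rfl fun k _ => ?_
    rw [Finset.mul_sum]
    refine Finset.sum_congr rfl fun l _ => ?_
    simp only [Nat.lcm_dvd_iff]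
    split_ifs <;> simp_all [mul_comm]
  simp_rw [h1]
  rw [Finset.sum_comm]
  refine Finset.sum_congr rfl fun k _ => ?_
  rw [Finset.sum_comm]
  refine Finset.sum_congr rfl fun l _ => ?_
  rw [← Finset.mul_sum, Finset.sum_filter]

theorem sum_range_mul_left_of_coprime {M : Type*} [AddCommMonoid M] {g : ℕ → M} {q L : ℕ}
    (hq : 0 < q) (hg : Function.Periodic g q) (h : L.Coprime q) :
    ∑ m ∈ range q, g (L * m) = ∑ m ∈ range q, g m := by
  have hinj : Set.InjOn (fun m => L * m % q) (range q) := by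
    intro a ha b hb hab
    have : L * a ≡ L * b [MOD q] := hab
    have := Nat.ModEq.cancel_left_of_coprime h.symm this
    rw [Nat.ModEq, Nat.mod_eq_of_lt (mem_range.mp ha), Nat.mod_eq_of_lt (mem_range.mp hb)] at this
    exact this
  have himg : (range q).image (fun m => L * m % q) = range q := by
    refine Finset.eq_of_subset_of_card_le ?_ ?_
    · intro x hx
      obtain ⟨m, -, rfl⟩ := mem_image.mp hx
      exact mem_range.mpr (Nat.mod_lt _ hq)
    · rw [Finset.card_image_of_injOn hinj]
  calc ∑ m ∈ range q, g (L * m) = ∑ m ∈ range q, g (L * m % q) :=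
        Finset.sum_congr rfl fun m _ => (hg.map_mod_nat _).symm
    _ = ∑ x ∈ (range q).image (fun m => L * m % q), g x := (Finset.sum_image hinj).symm
    _ = _ := by rw [himg]

theorem periodic_filter_dvd {g : ℕ → ℂ} {q : ℕ} (hg : Function.Periodic g q) (L : ℕ) :
    Function.Periodic (fun n => if L ∣ n then g n else 0) (L * q) := by
  intro n
  have h1 : (L ∣ n + L * q) ↔ L ∣ n := (Nat.dvd_add_left (dvd_mul_right L q))
  have h2 := hg.nat_mul L n
  rw [Nat.cast_id] at h2
  simp only [h1, h2]

theorem sum_range_filter_dvd_eq {g : ℕ → ℂ} {q L Q : ℕ} (hq : 0 < q) (hL : 0 < L)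
    (hg : Function.Periodic g q) (hQ : L * q ∣ Q) :
    ∑ n ∈ range Q with L ∣ n, g n = (Q : ℂ) / (L * q : ℕ) * ∑ m ∈ range q, g (L * m) := by
  rw [Finset.sum_filter, sum_range_eq_of_periodic (Nat.mul_pos hL hq) hQ (periodic_filter_dvd hg L),
    ← Finset.sum_filter, sum_range_mul_filter_dvd _ hL]

theorem periodic_ite_coprime {f : ℕ → ℂ} {q : ℕ} (hf : Function.Periodic f q) :
    Function.Periodic (fun n => if n.Coprime q then f n else 0) q := by
  intro n
  simp only [Nat.coprime_add_self_left, hf n]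

/-- For each pair k, l either lcm(k,l) shares a factor with q and no coprime n occurs, or
multiplication by it permutes the residues mod q and the sum of f factors out. -/
theorem totient_mul_sum_range_coprime_LambdaR_sq {R : ℝ} (hR : 0 ≤ R) {q Q : ℕ} (hq : 0 < q)
    (hQ : q * (⌊R⌋₊).factorial ∣ Q) {f : ℕ → ℂ} (hf : Function.Periodic f q) :
    (Nat.totient q : ℂ) * ∑ n ∈ range Q with n.Coprime q, f n * ((LambdaR R n ^ 2 : ℝ) : ℂ) =
      (∑ n ∈ range q with n.Coprime q, f n) *
        ((∑ n ∈ range Q with n.Coprime q, LambdaR R n ^ 2 : ℝ) : ℂ) := by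
  -- both sides are multiples of a quantity independent of `f`
  set G : ℂ := ∑ k ∈ Ioc 0 ⌊R⌋₊, ∑ l ∈ Ioc 0 ⌊R⌋₊, ((truncWeight R k * truncWeight R l : ℝ) : ℂ) *
    (if (Nat.lcm k l).Coprime q then (Q : ℂ) / (Nat.lcm k l * q : ℕ) else 0) with hG
  have key : ∀ {f : ℕ → ℂ}, Function.Periodic f q →
      ∑ n ∈ range Q with n.Coprime q, f n * ((LambdaR R n ^ 2 : ℝ) : ℂ) =
        (∑ n ∈ range q with n.Coprime q, f n) * G := by
    intro f hf
    have hF := periodic_ite_coprime hf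
    have e1 : ∑ n ∈ range Q with n.Coprime q, f n * ((LambdaR R n ^ 2 : ℝ) : ℂ) =
        ∑ n ∈ range Q, (if n.Coprime q then f n else 0) * ((LambdaR R n ^ 2 : ℝ) : ℂ) := by
      rw [Finset.sum_filter]
      exact Finset.sum_congr rfl fun n _ => by split_ifs <;> simp
    rw [e1, sum_mul_LambdaR_sq_eq hR, hG, Finset.mul_sum]
    refine Finset.sum_congr rfl fun k hk => ?_
    rw [Finset.mul_sum]
    refine Finset.sum_congr rfl fun l hl => ?_
    rw [mem_Ioc] at hk hl
    have hL : 0 < Nat.lcm k l := Nat.lcm_pos hk.1 hl.1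
    have hLQ : Nat.lcm k l * q ∣ Q := by
      refine dvd_trans ?_ hQ
      rw [mul_comm]
      exact Nat.mul_dvd_mul_left q (Nat.lcm_dvd (Nat.dvd_factorial hk.1 hk.2)
        (Nat.dvd_factorial hl.1 hl.2))
    rw [sum_range_filter_dvd_eq hq hL hF hLQ]
    split_ifs with hc
    · rw [sum_range_mul_left_of_coprime hq hF hc, ← Finset.sum_filter]
      ring
    · have : ∑ m ∈ range q, (if (Nat.lcm k l * m).Coprime q then f (Nat.lcm k l * m) else 0) = 0 := by
        refine Finset.sum_eq_zero fun m _ => if_neg fun h => hc ?_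
        exact Nat.Coprime.coprime_mul_right h
      rw [this]
      simp
  have h1 := key hf
  -- The case f = 1 identifies φ(q)·G with the coprime sum of Λ_R².
  have h2 := key (f := fun _ => 1) (fun _ => rfl)
  have h3 : ∑ n ∈ range q with n.Coprime q, (1 : ℂ) = Nat.totient q := by
    rw [Finset.sum_const, nsmul_eq_mul, mul_one, Nat.totient_eq_card_coprime]
    simp only [Nat.coprime_comm]
  simp only [one_mul] at h2
  rw [h3] at h2
  rw [h1, Complex.ofReal_sum, h2]
  ring

end

/-! ### Periodic functions summed over an interval. -/

section

open Finset

/-- An interval lies between the open and the closed interval with some endpoints `α ≤ β`, whose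
distance is its length. -/
theorem Set.OrdConnected.exists_Ioo_subset_subset_Icc {I : Set ℝ} (hI : I.OrdConnected) {a b : ℝ}
    (hab : I ⊆ Set.Icc a b) (hne : I.Nonempty) :
    ∃ α β : ℝ, α ≤ β ∧ a ≤ α ∧ Set.Ioo α β ⊆ I ∧ I ⊆ Set.Icc α β ∧
      MeasureTheory.volume.real I = β - α := by
  have hbb : BddBelow I := ⟨a, fun x hx => (hab hx).1⟩
  have hba : BddAbove I := ⟨b, fun x hx => (hab hx).2⟩
  have h1 : Set.Ioo (sInf I) (sSup I) ⊆ I :=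
    IsConnected.Ioo_csInf_csSup_subset ⟨hne, isPreconnected_iff_ordConnected.mpr hI⟩ hbb hba
  have h2 : I ⊆ Set.Icc (sInf I) (sSup I) := subset_Icc_csInf_csSup hbb hba
  have h3 : sInf I ≤ sSup I := by
    obtain ⟨x, hx⟩ := hne
    exact (h2 hx).1.trans (h2 hx).2
  refine ⟨sInf I, sSup I, h3, le_csInf hne fun x hx => (hab hx).1, h1, h2, le_antisymm ?_ ?_⟩
  · have := MeasureTheory.measureReal_mono (μ := MeasureTheory.volume) h2
      (by simp)
    rwa [Real.volume_real_Icc_of_le h3] at this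
  · have := MeasureTheory.measureReal_mono (μ := MeasureTheory.volume) h1
      (ne_top_of_le_ne_top (by simp) (MeasureTheory.measure_mono h2))
    rwa [Real.volume_real_Ioo_of_le h3] at this

theorem mem_natPoints {N : ℕ} {I : Set ℝ} {n : ℕ} :
    n ∈ natPoints N I ↔ n ≤ N ∧ (n : ℝ) ∈ I := by
  simp [natPoints]

/-- Writing n = r + Pj, the integers j range between x and y, with the ends in doubt; either way
their number is within 1 of y − x. Since α ≥ 0 and r < P, x > −1, so no negative j occurs. -/
theorem abs_card_natPoints_mod_sub_le {N : ℕ} {I : Set ℝ} (hI : I.OrdConnected)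
    (hIN : I ⊆ Set.Icc 0 (N : ℝ)) {P r : ℕ} (hr : r < P) :
    |(#{n ∈ natPoints N I | n % P = r} : ℝ) - MeasureTheory.volume.real I / P| ≤ 1 := by
  have hP : (0 : ℝ) < P := by exact_mod_cast (Nat.zero_le r).trans_lt hr
  rcases I.eq_empty_or_nonempty with rfl | hne
  · simp [natPoints]
  obtain ⟨α, β, hαβ, hα, h1, h2, hV⟩ := hI.exists_Ioo_subset_subset_Icc hIN hne
  rw [hV]
  set x := (α - r) / P with hx
  set y := (β - r) / P with hy
  have hxy : (β - α) / P = y - x := by rw [hx, hy]; ring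
  have hxy0 : x ≤ y := by rw [hx, hy]; gcongr
  have hxP : x * P = α - r := by rw [hx]; field_simp
  have hyP : y * P = β - r := by rw [hy]; field_simp
  have hx1 : (-1 : ℝ) < x := by
    have : (r : ℝ) < P := by exact_mod_cast hr
    by_contra! hc
    nlinarith
  rw [hxy, abs_le]
  constructor
  · have hsub : (Finset.Ioo ⌊x⌋ ⌈y⌉).image (fun j : ℤ => (r + P * j).toNat) ⊆
        {n ∈ natPoints N I | n % P = r} := by
      intro n hn
      obtain ⟨j, hj, rfl⟩ := Finset.mem_image.mp hn
      obtain ⟨hj1, hj2⟩ := Finset.mem_Ioo.mp hj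
      have hj1' : x < j := Int.floor_lt.mp hj1
      have hj2' : (j : ℝ) < y := Int.lt_ceil.mp hj2
      have hj0 : 0 ≤ j := by
        have : (-1 : ℝ) < j := hx1.trans hj1'
        have : (-1 : ℤ) < j := by exact_mod_cast this
        omega
      lift j to ℕ using hj0
      have e : ((r : ℤ) + P * (j : ℤ)).toNat = r + P * j := by
        rw [← Nat.cast_mul, ← Nat.cast_add, Int.toNat_natCast]
      rw [e]
      have hm : ((r + P * j : ℕ) : ℝ) ∈ I := by
        apply h1
        push_cast at hj1' hj2' ⊢
        constructor <;> nlinarith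
      rw [Finset.mem_filter, mem_natPoints]
      refine ⟨⟨by exact_mod_cast (hIN hm).2, hm⟩, ?_⟩
      rw [Nat.add_mul_mod_self_left, Nat.mod_eq_of_lt hr]
    have hinj : Set.InjOn (fun j : ℤ => ((r : ℤ) + P * j).toNat) (Finset.Ioo ⌊x⌋ ⌈y⌉) := by
      intro i hi j hj hij
      have hnn : ∀ j ∈ Finset.Ioo ⌊x⌋ ⌈y⌉, 0 ≤ j := by
        intro j hj
        have : (-1 : ℝ) < j := hx1.trans (Int.floor_lt.mp (Finset.mem_Ioo.mp hj).1)
        have : (-1 : ℤ) < j := by exact_mod_cast this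
        omega
      have hi0 := hnn i hi
      have hj0 := hnn j hj
      have hPz : (0 : ℤ) < P := by exact_mod_cast hP
      have e := congrArg (Nat.cast : ℕ → ℤ) hij
      simp only at e
      rw [Int.toNat_of_nonneg (by positivity), Int.toNat_of_nonneg (by positivity)] at e
      exact mul_left_cancel₀ hPz.ne' (by linarith)
    have hc := Finset.card_le_card hsub
    rw [Finset.card_image_of_injOn hinj, Int.card_Ioo] at hc
    have hc' : (⌈y⌉ - ⌊x⌋ - 1 : ℤ) ≤ (#{n ∈ natPoints N I | n % P = r} : ℤ) :=
      (Int.self_le_toNat _).trans (by exact_mod_cast hc)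
    have hc'' : (⌈y⌉ - ⌊x⌋ - 1 : ℝ) ≤ (#{n ∈ natPoints N I | n % P = r} : ℝ) := by
      exact_mod_cast hc'
    linarith [Int.le_ceil y, Int.floor_le x]
  · have hsub : {n ∈ natPoints N I | n % P = r} ⊆
        (Finset.Icc ⌈x⌉ ⌊y⌋).image (fun j : ℤ => (r + P * j).toNat) := by
      intro n hn
      rw [Finset.mem_filter, mem_natPoints] at hn
      obtain ⟨⟨-, hnI⟩, hnr⟩ := hn
      have hn2 := h2 hnI
      have e := Nat.mod_add_div n P
      rw [hnr] at e
      have e' : (r : ℝ) + P * (n / P : ℕ) = n := by exact_mod_cast e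
      refine Finset.mem_image.mpr ⟨((n / P : ℕ) : ℤ), Finset.mem_Icc.mpr ⟨?_, ?_⟩, ?_⟩
      · rw [Int.ceil_le, Int.cast_natCast, hx, div_le_iff₀ hP]
        linarith [hn2.1]
      · rw [Int.le_floor, Int.cast_natCast, hy, le_div_iff₀ hP]
        linarith [hn2.2]
      · rw [← Nat.cast_mul, ← Nat.cast_add, Int.toNat_natCast, e]
    have hc := (Finset.card_le_card hsub).trans Finset.card_image_le
    rw [Int.card_Icc] at hc
    have h3 : (0 : ℝ) ≤ y - x + 1 := by linarith
    have hc' : (#{n ∈ natPoints N I | n % P = r} : ℝ) ≤ ((⌊y⌋ + 1 - ⌈x⌉).toNat : ℝ) := by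
      exact_mod_cast hc
    rcases le_total 0 (⌊y⌋ + 1 - ⌈x⌉) with h0 | h0
    · have e : ((⌊y⌋ + 1 - ⌈x⌉).toNat : ℝ) = ⌊y⌋ + 1 - ⌈x⌉ := by
        have := Int.toNat_of_nonneg h0
        exact_mod_cast congrArg (Int.cast : ℤ → ℝ) this
      linarith [Int.le_ceil x, Int.floor_le y]
    · rw [Int.toNat_of_nonpos h0, Nat.cast_zero] at hc'
      linarith

/-- The error is the ℓ¹ norm over a period rather than the period times the maximum: for f·1_{L ∣
n}, of period Lq, it is q‖f‖ and not Lq‖f‖. -/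
theorem norm_sum_natPoints_sub_le {N : ℕ} {I : Set ℝ} (hI : I.OrdConnected)
    (hIN : I ⊆ Set.Icc 0 (N : ℝ)) {P : ℕ} (hP : 0 < P) {g : ℕ → ℂ} (hg : Function.Periodic g P) :
    ‖∑ n ∈ natPoints N I, g n -
      ((MeasureTheory.volume.real I : ℂ) / P) * ∑ n ∈ range P, g n‖ ≤ ∑ n ∈ range P, ‖g n‖ := by
  have h1 : ∑ n ∈ natPoints N I, g n =
      ∑ r ∈ range P, (#{n ∈ natPoints N I | n % P = r} : ℂ) * g r := by
    rw [← Finset.sum_fiberwise_of_maps_to (s := natPoints N I) (t := range P) (g := fun n => n % P)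
      (fun n _ => Finset.mem_range.mpr (Nat.mod_lt n hP))]
    refine Finset.sum_congr rfl fun r _ => ?_
    rw [← nsmul_eq_mul, ← Finset.sum_const]
    refine Finset.sum_congr rfl fun n hn => ?_
    rw [← (Finset.mem_filter.mp hn).2, hg.map_mod_nat]
  rw [h1, Finset.mul_sum, ← Finset.sum_sub_distrib]
  refine (norm_sum_le _ _).trans (Finset.sum_le_sum fun r hr => ?_)
  rw [← sub_mul, norm_mul]
  refine mul_le_of_le_one_left (norm_nonneg _) ?_
  have := abs_card_natPoints_mod_sub_le hI hIN (Finset.mem_range.mp hr)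
  rw [← Real.norm_eq_abs, ← Complex.norm_real] at this
  simpa using this

theorem norm_le_periodicSupNorm {q : ℕ} (hq : 0 < q) {f : ℕ → ℂ} (hf : Function.Periodic f q)
    (n : ℕ) : ‖f n‖ ≤ periodicSupNorm q f := by
  have key : ∀ r ∈ Finset.Icc 1 q, ‖f r‖ ≤ periodicSupNorm q f := by
    intro r hr
    rw [periodicSupNorm, ← coe_nnnorm, NNReal.coe_le_coe]
    exact Finset.le_sup (f := fun r => ‖f r‖₊) hr
  rw [← hf.map_mod_nat]
  rcases Nat.eq_zero_or_pos (n % q) with h | h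
  · have := hf 0
    rw [zero_add] at this
    rw [h, ← this]
    exact key _ (Finset.mem_Icc.mpr ⟨hq, le_rfl⟩)
  · exact key _ (Finset.mem_Icc.mpr ⟨h, (Nat.mod_lt n hq).le⟩)

end

/-! ### From the interval to a full period, and the estimate in terms of q. -/

section

open Finset

theorem abs_truncWeight_le {R : ℝ} (hR : 1 ≤ R) {k : ℕ} (hk : 0 < k) :
    |truncWeight R k| ≤ Real.log R := by
  have hk1 : (1 : ℝ) ≤ k := by exact_mod_cast hk
  have h1 : |(ArithmeticFunction.moebius k : ℝ)| ≤ 1 := by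
    exact_mod_cast ArithmeticFunction.abs_moebius_le_one (n := k)
  have h2 : 0 ≤ Real.log R := Real.log_nonneg hR
  have h3 : max (Real.log (R / k)) 0 ≤ Real.log R :=
    max_le (Real.log_le_log (by positivity) (div_le_self (by linarith) hk1)) h2
  rw [truncWeight, abs_mul, abs_of_nonneg (le_max_right _ (0 : ℝ))]
  exact (mul_le_of_le_one_left (le_max_right _ _) h1).trans h3

/-- At most R² pairs k, l, each with weight at most log² R and error at most qM. -/
theorem norm_sum_natPoints_mul_LambdaR_sq_sub_le {N : ℕ} {I : Set ℝ} (hI : I.OrdConnected)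
    (hIN : I ⊆ Set.Icc 0 (N : ℝ)) {R : ℝ} (hR : 1 ≤ R) {q Q : ℕ} (hq : 0 < q) (hQ0 : 0 < Q)
    (hQ : q * (⌊R⌋₊).factorial ∣ Q) {f : ℕ → ℂ} (hf : Function.Periodic f q) {M : ℝ}
    (hM : ∀ n, ‖f n‖ ≤ M) :
    ‖∑ n ∈ natPoints N I, f n * ((LambdaR R n ^ 2 : ℝ) : ℂ) -
      ((MeasureTheory.volume.real I : ℂ) / Q) * ∑ n ∈ range Q, f n * ((LambdaR R n ^ 2 : ℝ) : ℂ)‖ ≤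
      q * M * (R * Real.log R) ^ 2 := by
  have hR0 : 0 ≤ R := by linarith
  have hlog : 0 ≤ Real.log R := Real.log_nonneg hR
  have hM0 : 0 ≤ M := (norm_nonneg _).trans (hM 0)
  rw [sum_mul_LambdaR_sq_eq hR0, sum_mul_LambdaR_sq_eq hR0, Finset.mul_sum,
    ← Finset.sum_sub_distrib]
  have hpair : ∀ k ∈ Ioc 0 ⌊R⌋₊, ∀ l ∈ Ioc 0 ⌊R⌋₊,
      ‖((truncWeight R k * truncWeight R l : ℝ) : ℂ) *
          ∑ n ∈ natPoints N I with Nat.lcm k l ∣ n, f n -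
        ((MeasureTheory.volume.real I : ℂ) / Q) * (((truncWeight R k * truncWeight R l : ℝ) : ℂ) *
          ∑ n ∈ range Q with Nat.lcm k l ∣ n, f n)‖ ≤ Real.log R ^ 2 * (q * M) := by
    intro k hk l hl
    rw [mem_Ioc] at hk hl
    have hL : 0 < Nat.lcm k l := Nat.lcm_pos hk.1 hl.1
    have hLQ : Nat.lcm k l * q ∣ Q := by
      refine dvd_trans ?_ hQ
      rw [mul_comm]
      exact Nat.mul_dvd_mul_left q (Nat.lcm_dvd (Nat.dvd_factorial hk.1 hk.2)
        (Nat.dvd_factorial hl.1 hl.2))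
    have hper := periodic_filter_dvd hf (Nat.lcm k l)
    have hPpos := Nat.mul_pos hL hq
    have h1 := norm_sum_natPoints_sub_le hI hIN hPpos hper
    have h2 := sum_range_eq_of_periodic hPpos hLQ hper
    have hP : ((Nat.lcm k l * q : ℕ) : ℂ) ≠ 0 := by exact_mod_cast hPpos.ne'
    have hQ' : (Q : ℂ) ≠ 0 := by exact_mod_cast hQ0.ne'
    have e : ((MeasureTheory.volume.real I : ℂ) / (Nat.lcm k l * q : ℕ)) *
        ∑ n ∈ range (Nat.lcm k l * q), (if Nat.lcm k l ∣ n then f n else 0) =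
        ((MeasureTheory.volume.real I : ℂ) / Q) *
          ∑ n ∈ range Q, (if Nat.lcm k l ∣ n then f n else 0) := by
      rw [h2]
      field_simp
    have h3 : ∑ n ∈ range (Nat.lcm k l * q), ‖if Nat.lcm k l ∣ n then f n else 0‖ ≤ q * M := by
      calc ∑ n ∈ range (Nat.lcm k l * q), ‖if Nat.lcm k l ∣ n then f n else 0‖
          = ∑ n ∈ range (Nat.lcm k l * q) with Nat.lcm k l ∣ n, ‖f n‖ := by
            rw [Finset.sum_filter]
            exact Finset.sum_congr rfl fun n _ => by split_ifs <;> simp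
        _ = ∑ m ∈ range q, ‖f (Nat.lcm k l * m)‖ := sum_range_mul_filter_dvd _ hL q
        _ ≤ ∑ m ∈ range q, M := Finset.sum_le_sum fun m _ => hM _
        _ = q * M := by simp
    rw [e, ← Finset.sum_filter, ← Finset.sum_filter] at h1
    rw [mul_left_comm, ← mul_sub, norm_mul, Complex.norm_real, Real.norm_eq_abs, abs_mul]
    refine mul_le_mul ?_ (h1.trans h3) (norm_nonneg _) (by positivity)
    rw [sq]
    exact mul_le_mul (abs_truncWeight_le hR hk.1) (abs_truncWeight_le hR hl.1) (abs_nonneg _) hlog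
  have hcard : ((⌊R⌋₊ : ℕ) : ℝ) ≤ R := Nat.floor_le hR0
  calc _ ≤ ∑ k ∈ Ioc 0 ⌊R⌋₊, ∑ l ∈ Ioc 0 ⌊R⌋₊, Real.log R ^ 2 * (q * M) := by
        refine (norm_sum_le _ _).trans (Finset.sum_le_sum fun k hk => ?_)
        rw [Finset.mul_sum, ← Finset.sum_sub_distrib]
        exact (norm_sum_le _ _).trans (Finset.sum_le_sum fun l hl => hpair k hk l hl)
    _ = (⌊R⌋₊ : ℝ) * (⌊R⌋₊ * (Real.log R ^ 2 * (q * M))) := by simp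
    _ ≤ R * (R * (Real.log R ^ 2 * (q * M))) := by gcongr
    _ = _ := by ring

theorem norm_sum_natPoints_coprime_sub_le {N : ℕ} {I : Set ℝ} (hI : I.OrdConnected)
    (hIN : I ⊆ Set.Icc 0 (N : ℝ)) {q : ℕ} (hq : 0 < q) {f : ℕ → ℂ} (hf : Function.Periodic f q)
    {M : ℝ} (hM : ∀ n, ‖f n‖ ≤ M) :
    ‖∑ n ∈ natPoints N I with n.Coprime q, f n -
      ((MeasureTheory.volume.real I : ℂ) / q) * ∑ n ∈ range q with n.Coprime q, f n‖ ≤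
      Nat.totient q * M := by
  have h1 := norm_sum_natPoints_sub_le hI hIN hq (periodic_ite_coprime hf)
  rw [← Finset.sum_filter, ← Finset.sum_filter] at h1
  refine h1.trans ?_
  calc ∑ n ∈ range q, ‖if n.Coprime q then f n else 0‖
      ≤ ∑ n ∈ range q, if n.Coprime q then M else 0 := by
        refine Finset.sum_le_sum fun n _ => ?_
        split_ifs
        · exact hM n
        · simp
    _ = _ := by
        rw [← Finset.sum_filter, Finset.sum_const, nsmul_eq_mul, Nat.totient_eq_card_coprime]
        simp only [Nat.coprime_comm]

theorem Real.log_sq_le_four_mul {x : ℝ} (hx : 1 ≤ x) : Real.log x ^ 2 ≤ 4 * x := by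
  have h0 : (0 : ℝ) < √x := Real.sqrt_pos.mpr (by linarith)
  have h1 : Real.log x = 2 * Real.log √x := by
    rw [Real.log_sqrt (by linarith)]; ring
  have h2 := Real.log_le_sub_one_of_pos h0
  have h3 : 0 ≤ Real.log √x := Real.log_nonneg (by rwa [Real.one_le_sqrt])
  have h4 := Real.sq_sqrt (show 0 ≤ x by linarith)
  rw [h1]
  nlinarith

theorem exists_norm_sum_nuR_sub_le : ∃ C : ℝ, 0 < C ∧ ∀ R : ℝ, 3 ≤ R → ∀ (N q : ℕ), 0 < q →
    ∀ I : Set ℝ, I.OrdConnected → I ⊆ Set.Icc 0 (N : ℝ) →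
    (q : ℝ) * R ^ 3 ≤ MeasureTheory.volume.real I →
    ∀ f : ℕ → ℂ, Function.Periodic f q → ∀ M : ℝ, (∀ n, ‖f n‖ ≤ M) →
    ‖(1 / (MeasureTheory.volume.real I : ℂ)) * ∑ n ∈ natPoints N I, f n * (nuR R n : ℂ) -
      ((q : ℂ) / ((Nat.totient q : ℂ) * (MeasureTheory.volume.real I : ℂ))) *
        ∑ n ∈ (natPoints N I).filter (fun n => Nat.Coprime n q), f n‖ ≤
      C * M * (1 + Real.log (3 + Real.log q)) / Real.log R := by
  obtain ⟨C, hC, h⟩ := exists_sum_range_coprime_LambdaR_sq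
  refine ⟨2 * C + 5, by positivity, fun R hR N q hq I hI hIN hV f hf M hM => ?_⟩
  have hR1 : 1 ≤ R := by linarith
  have hR0 : 0 < R := by linarith
  have hqR : (0 : ℝ) < q := by exact_mod_cast hq
  have hφ : 0 < Nat.totient q := Nat.totient_pos.mpr hq
  have hφR : (0 : ℝ) < Nat.totient q := by exact_mod_cast hφ
  have hM0 : 0 ≤ M := (norm_nonneg _).trans (hM 0)
  have hL : 0 < Real.log R := Real.log_pos (by linarith)
  set Q := q * (⌊R⌋₊).factorial with hQdef
  have hQ : 0 < Q := Nat.mul_pos hq (Nat.factorial_pos _)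
  have hQR : (0 : ℝ) < Q := by exact_mod_cast hQ
  obtain ⟨hY, hZ⟩ := h R hR1 q hq Q dvd_rfl
  have hF := totient_mul_sum_range_coprime_LambdaR_sq hR0.le hq (Q := Q) dvd_rfl hf
  have hE1 := norm_sum_natPoints_mul_LambdaR_sq_sub_le hI hIN hR1 hq hQ dvd_rfl hf hM
  have hE3 := norm_sum_natPoints_coprime_sub_le hI hIN hq hf hM
  have hV0 : 0 < MeasureTheory.volume.real I := lt_of_lt_of_le (by positivity) hV
  set V := MeasureTheory.volume.real I
  set ℓ := 1 + Real.log (3 + Real.log q)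
  have hℓ : 1 ≤ ℓ := by
    have : 0 ≤ Real.log (3 + Real.log q) :=
      Real.log_nonneg (by linarith [Real.log_natCast_nonneg q])
    simp only [ℓ]; linarith
  set F := ∑ n ∈ range q with n.Coprime q, f n with hFdef
  have hFn : ‖F‖ ≤ Nat.totient q * M := by
    refine (norm_sum_le _ _).trans ((Finset.sum_le_sum fun n _ => hM n).trans (le_of_eq ?_))
    rw [Finset.sum_const, nsmul_eq_mul, Nat.totient_eq_card_coprime]
    simp only [Nat.coprime_comm]
  rw [← Finset.sum_filter_add_sum_filter_not (range Q) (fun n => n.Coprime q)] at hE1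
  have hYn : ‖∑ n ∈ range Q with ¬ n.Coprime q, f n * ((LambdaR R n ^ 2 : ℝ) : ℂ)‖ ≤
      M * (C * Q * ℓ) := by
    refine (norm_sum_le _ _).trans (le_trans ?_ (mul_le_mul_of_nonneg_left hY hM0))
    rw [Finset.mul_sum]
    refine Finset.sum_le_sum fun n _ => ?_
    rw [norm_mul, Complex.norm_real, Real.norm_eq_abs, abs_of_nonneg (sq_nonneg _)]
    gcongr
    exact hM n
  have hν : ∑ n ∈ natPoints N I, f n * (nuR R n : ℂ) =
      (∑ n ∈ natPoints N I, f n * ((LambdaR R n ^ 2 : ℝ) : ℂ)) / (Real.log R : ℂ) := by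
    rw [Finset.sum_div]
    refine Finset.sum_congr rfl fun n _ => ?_
    rw [nuR, Complex.ofReal_div, mul_div_assoc]
  rw [hν]
  set S := ∑ n ∈ natPoints N I, f n * ((LambdaR R n ^ 2 : ℝ) : ℂ)
  set X := ∑ n ∈ range Q with n.Coprime q, f n * ((LambdaR R n ^ 2 : ℝ) : ℂ)
  set Y := ∑ n ∈ range Q with ¬ n.Coprime q, f n * ((LambdaR R n ^ 2 : ℝ) : ℂ)
  set T := ∑ n ∈ natPoints N I with n.Coprime q, f n
  set Z := ∑ n ∈ range Q with n.Coprime q, LambdaR R n ^ 2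
  set e₁ := S - (V : ℂ) / Q * (X + Y) with he₁
  set e₂ := Z - Q * Real.log R with he₂
  set e₃ := T - (V : ℂ) / q * F with he₃
  have hVC : (V : ℂ) ≠ 0 := by exact_mod_cast hV0.ne'
  have hLC : (Real.log R : ℂ) ≠ 0 := by exact_mod_cast hL.ne'
  have hQC : (Q : ℂ) ≠ 0 := by exact_mod_cast hQ.ne'
  have hqC : (q : ℂ) ≠ 0 := by exact_mod_cast hq.ne'
  have hφC : (Nat.totient q : ℂ) ≠ 0 := by exact_mod_cast hφ.ne'
  have hXe : X = F * ((Q : ℂ) * Real.log R + e₂) / Nat.totient q := by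
    rw [eq_div_iff hφC, mul_comm, hF, he₂]
    push_cast
    ring
  have hSe : S = e₁ + (V : ℂ) / Q * (X + Y) := by rw [he₁]; ring
  have hTe : T = e₃ + (V : ℂ) / q * F := by rw [he₃]; ring
  -- The main terms cancel. What is left is the passage from I to a period for fΛ_R², the n not
  -- coprime to q, the deviation of the coprime mean square from log R, and the passage from I to a
  -- period for f. The bounds `b1` to `b4` treat them in this order.
  have hD : 1 / (V : ℂ) * (S / (Real.log R : ℂ)) - (q : ℂ) / ((Nat.totient q : ℂ) * V) * T =
      e₁ / (V * Real.log R) + Y / (Q * Real.log R) + F * e₂ / (Nat.totient q * (Q * Real.log R)) -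
        q * e₃ / (Nat.totient q * V) := by
    rw [hSe, hTe, hXe]
    field_simp
    ring
  rw [hD]
  have hRL : Real.log R ≤ R := (Real.log_le_sub_one_of_pos hR0).trans (by linarith)
  have hR3 : R ≤ R ^ 3 := le_self_pow₀ hR1 (by norm_num)
  have hLL := Real.log_sq_le_four_mul hR1
  have b1 : ‖e₁ / (V * Real.log R)‖ ≤ 4 * M / Real.log R := by
    rw [norm_div, norm_mul, Complex.norm_real, Complex.norm_real, Real.norm_of_nonneg hV0.le,
      Real.norm_of_nonneg hL.le, div_le_div_iff₀ (by positivity) hL]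
    calc ‖e₁‖ * Real.log R ≤ (q * M * (R * Real.log R) ^ 2) * Real.log R := by gcongr
      _ = q * M * R ^ 2 * Real.log R * Real.log R ^ 2 := by ring
      _ ≤ q * M * R ^ 2 * Real.log R * (4 * R) := by gcongr
      _ = 4 * M * (q * R ^ 3 * Real.log R) := by ring
      _ ≤ 4 * M * (V * Real.log R) := by gcongr
  have b2 : ‖Y / (Q * Real.log R)‖ ≤ C * M * ℓ / Real.log R := by
    rw [norm_div, norm_mul, Complex.norm_real, Complex.norm_natCast, Real.norm_of_nonneg hL.le,
      div_le_div_iff₀ (by positivity) hL]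
    calc ‖Y‖ * Real.log R ≤ M * (C * Q * ℓ) * Real.log R := by gcongr
      _ = _ := by ring
  have b3 : ‖F * e₂ / (Nat.totient q * (Q * Real.log R))‖ ≤ C * M * ℓ / Real.log R := by
    rw [norm_div, norm_mul, norm_mul, norm_mul, Complex.norm_real, Complex.norm_natCast,
      Complex.norm_natCast, Complex.norm_real, Real.norm_of_nonneg hL.le, Real.norm_eq_abs,
      div_le_div_iff₀ (by positivity) hL]
    calc ‖F‖ * |e₂| * Real.log R ≤ (Nat.totient q * M) * (C * Q * ℓ) * Real.log R := by gcongr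
      _ = _ := by ring
  have b4 : ‖q * e₃ / (Nat.totient q * V)‖ ≤ M / Real.log R := by
    rw [norm_div, norm_mul, norm_mul, Complex.norm_real, Complex.norm_natCast,
      Complex.norm_natCast, Real.norm_of_nonneg hV0.le, div_le_div_iff₀ (by positivity) hL]
    calc q * ‖e₃‖ * Real.log R ≤ q * (Nat.totient q * M) * R ^ 3 := by
          gcongr
          exact hRL.trans hR3
      _ = M * (Nat.totient q * (q * R ^ 3)) := by ring
      _ ≤ _ := by gcongr
  refine ((norm_sub_le _ _).trans (add_le_add_left ((norm_add_le _ _).trans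
    (add_le_add_left (norm_add_le _ _) _)) _)).trans ?_
  calc _ ≤ 4 * M / Real.log R + C * M * ℓ / Real.log R + C * M * ℓ / Real.log R +
        M / Real.log R := by linarith
    _ = (2 * C * M * ℓ + 5 * M * 1) / Real.log R := by ring
    _ ≤ (2 * C * M * ℓ + 5 * M * ℓ) / Real.log R := by gcongr
    _ = _ := by ring

end

/-! ### From log log q to log log R, and the theorem. -/

/-- R ≥ cN^ε and q ≤ N give log q = O(log R). Since R ≥ 3 > e, log log R is at least log log 3 > 0,
so additive constants can be absorbed. -/
theorem exists_log_three_add_log_le {ε c : ℝ} (hε : 0 < ε) (hc : 0 < c) :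
    ∃ K : ℝ, 0 < K ∧ ∀ R : ℝ, 3 ≤ R → ∀ N q : ℕ, 0 < q → q ≤ N → c * (N : ℝ) ^ ε ≤ R →
      1 + Real.log (3 + Real.log q) ≤ K * Real.log (Real.log R) := by
  set K := 3 + (1 + |Real.log c|) / ε with hK
  have hq0 : 0 ≤ (1 + |Real.log c|) / ε := by positivity
  have hK1 : 1 ≤ K := by linarith
  have h1log3 : 1 < Real.log 3 := by
    rw [Real.lt_log_iff_exp_lt (by norm_num)]
    exact Real.exp_one_lt_d9.trans (by norm_num)
  set κ := Real.log (Real.log 3) with hκ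
  have hκ0 : 0 < κ := Real.log_pos h1log3
  have hlK : 0 ≤ Real.log K := Real.log_nonneg hK1
  refine ⟨(1 + Real.log K) / κ + 1, by positivity, fun R hR N q hq hqN hN => ?_⟩
  have hL3 : Real.log 3 ≤ Real.log R := Real.log_le_log (by norm_num) hR
  have hL : 1 ≤ Real.log R := h1log3.le.trans hL3
  have hLL : κ ≤ Real.log (Real.log R) := Real.log_le_log (by linarith) hL3
  have hN0 : (0 : ℝ) < N := by exact_mod_cast hq.trans_le hqN
  have h1 : Real.log q ≤ Real.log N :=
    Real.log_le_log (by exact_mod_cast hq) (by exact_mod_cast hqN)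
  have h2 : Real.log c + ε * Real.log N ≤ Real.log R := by
    rw [← Real.log_rpow hN0, ← Real.log_mul hc.ne' (by positivity)]
    exact Real.log_le_log (by positivity) hN
  have h3 : Real.log N ≤ (1 + |Real.log c|) / ε * Real.log R := by
    rw [div_mul_eq_mul_div, le_div_iff₀ hε]
    have := neg_abs_le (Real.log c)
    have := le_mul_of_one_le_right (abs_nonneg (Real.log c)) hL
    linarith
  have h4 : 3 + Real.log q ≤ K * Real.log R := by
    rw [hK, add_mul]
    linarith
  have h5 : Real.log (3 + Real.log q) ≤ Real.log K + Real.log (Real.log R) := by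
    rw [← Real.log_mul (by linarith) (by linarith)]
    exact Real.log_le_log (by linarith [Real.log_natCast_nonneg q]) h4
  have h6 : 1 + Real.log K ≤ (1 + Real.log K) / κ * Real.log (Real.log R) := by
    rw [div_mul_eq_mul_div, le_div_iff₀ hκ0]
    gcongr
  linarith

theorem theorem2p4 (ε c₁ c₂ : ℝ) (hε : 0 < ε) (hc₁ : 0 < c₁) (hc₂ : 0 < c₂) :
    ∃ C : ℝ, 0 < C ∧ ∀ (N : ℕ) (R : ℝ), 3 ≤ R →
      c₁ * (N : ℝ) ^ ε ≤ R → R ≤ c₂ * (N : ℝ) ^ ε →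
      (∀ (q : ℕ), 0 < q → ∀ (I : Set ℝ), I.OrdConnected → I ⊆ Set.Icc 0 (N : ℝ) →
        (q : ℝ) * R ^ 3 ≤ MeasureTheory.volume.real I →
        ∀ (f : ℕ → ℂ), Function.Periodic f q →
          ‖(1 / (MeasureTheory.volume.real I : ℂ)) *
                ∑ n ∈ natPoints N I, f n * (nuR R n : ℂ)
              - ((q : ℂ) / ((Nat.totient q : ℂ) * (MeasureTheory.volume.real I : ℂ))) *
                ∑ n ∈ (natPoints N I).filter (fun n => Nat.Coprime n q), f n‖
            ≤ C * (periodicSupNorm q f * Real.log (Real.log R) / Real.log R)) ∧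
      (R ^ 3 ≤ (N : ℝ) →
        |(1 / (N : ℝ)) * ∑ n ∈ Finset.Icc 1 N, nuR R n - 1|
          ≤ C * (Real.log (Real.log R) / Real.log R)) := by
  obtain ⟨C, hC, h⟩ := exists_norm_sum_nuR_sub_le
  obtain ⟨K, hK, hKl⟩ := exists_log_three_add_log_le hε hc₁
  refine ⟨C * K, by positivity, fun N R hR hN₁ hN₂ => ?_⟩
  have hL : 0 < Real.log R := Real.log_pos (by linarith)
  have hpart : ∀ (q : ℕ), 0 < q → ∀ (I : Set ℝ), I.OrdConnected → I ⊆ Set.Icc 0 (N : ℝ) →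
        (q : ℝ) * R ^ 3 ≤ MeasureTheory.volume.real I →
        ∀ (f : ℕ → ℂ), Function.Periodic f q →
          ‖(1 / (MeasureTheory.volume.real I : ℂ)) *
                ∑ n ∈ natPoints N I, f n * (nuR R n : ℂ)
              - ((q : ℂ) / ((Nat.totient q : ℂ) * (MeasureTheory.volume.real I : ℂ))) *
                ∑ n ∈ (natPoints N I).filter (fun n => Nat.Coprime n q), f n‖
            ≤ C * K * (periodicSupNorm q f * Real.log (Real.log R) / Real.log R) := by
    intro q hq I hI hIN hV f hf
    have hM0 : 0 ≤ periodicSupNorm q f :=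
      (norm_nonneg _).trans (norm_le_periodicSupNorm hq hf 0)
    have hVN : MeasureTheory.volume.real I ≤ N := by
      have := MeasureTheory.measureReal_mono (μ := MeasureTheory.volume) hIN (by simp)
      simpa using this
    -- An admissible interval exists only for q ≤ qR³ ≤ |I| ≤ N.
    have hqN : q ≤ N := by
      have h1 : (1 : ℝ) ≤ R ^ 3 := one_le_pow₀ (by linarith)
      have h2 : (q : ℝ) ≤ q * R ^ 3 := le_mul_of_one_le_right (by positivity) h1
      exact_mod_cast h2.trans (hV.trans hVN)
    refine (h R hR N q hq I hI hIN hV f hf _ (norm_le_periodicSupNorm hq hf)).trans ?_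
    calc _ ≤ C * periodicSupNorm q f * (K * Real.log (Real.log R)) / Real.log R := by
          gcongr
          exact hKl R hR N q hq hqN hN₁
      _ = _ := by ring
  refine ⟨hpart, fun hRN => ?_⟩
  have h3N : (0 : ℝ) < N := lt_of_lt_of_le (by positivity) hRN
  -- The half-open interval (0, N] excludes n = 0, where Λ_R is a sum over all k < R, and has length
  -- exactly N.
  have h1 := hpart 1 one_pos (Set.Ioc 0 N) Set.ordConnected_Ioc Set.Ioc_subset_Icc_self
    (by simpa using hRN) (fun _ => 1) (fun _ => rfl)
  have hpts : natPoints N (Set.Ioc 0 (N : ℝ)) = Finset.Icc 1 N := by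
    ext n
    simp only [mem_natPoints, Set.mem_Ioc, Finset.mem_Icc, Nat.cast_pos, Nat.cast_le]
    omega
  have hsup : periodicSupNorm 1 (fun _ => 1) = 1 := by simp [periodicSupNorm]
  have hvol : MeasureTheory.volume.real (Set.Ioc 0 (N : ℝ)) = N := by simp
  rw [hpts, hsup, hvol] at h1
  have hNC : (N : ℂ) ≠ 0 := by exact_mod_cast h3N.ne'
  have e : (1 / ((N : ℝ) : ℂ)) * ∑ n ∈ Finset.Icc 1 N, 1 * (nuR R n : ℂ) -
      (((1 : ℕ) : ℂ) / ((Nat.totient 1 : ℂ) * ((N : ℝ) : ℂ))) *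
        ∑ n ∈ (Finset.Icc 1 N).filter (fun n => Nat.Coprime n 1), (1 : ℂ) =
      (((1 / (N : ℝ)) * ∑ n ∈ Finset.Icc 1 N, nuR R n - 1 : ℝ) : ℂ) := by
    simp [hNC]
  rw [e, Complex.norm_real, Real.norm_eq_abs, one_mul] at h1
  exact h1
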